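/- A real Lie superalgebra is a $\mathbb Z_2$-graded real vector space $V=V_0\oplus V_1$ with a graded bilinear bracket satisfying $[x,y]=-(-1)^{|x||y|}[y,x]$ and the super Jacobi identity; its superdimension is $(\dim V_0,\dim V_1)$. A Drinfel'd superdouble is a real Lie superalgebra $\mathcal D$ with a nondegenerate, supersymmetric ($\langle x,y\rangle=(-1)^{|x||y|}\langle y,x\rangle$), super ad-invariant ($\langle [x,y],z\rangle+(-1)^{|x||y|}\langle y,[x,z]\rangle=0$) bilinear form such that $\mathcal D=\mathcal S\oplus\tilde{\mathcal S}$ for some maximally isotropic graded subalgebras $\mathcal S,\tilde{\mathcal S}$ with $\langle\mathcal S_0,\tilde{\mathcal S}_1\rangle=\langle\mathcal S_1,\tilde{\mathcal S}_0\rangle=0$; such a $(\mathcal D,\mathcal S,\tilde{\mathcal S})=(\mathcal S|\tilde{\mathcal S})$ is called a Manin supertriple and $(\tilde{\mathcal S}|\mathcal S)$ its dual. Isomorphisms of superdoubles are linear bijections preserving grading, bracket and form; isomorphisms of supertriples moreover map $\mathcal S$ to $\mathcal S'$ and $\tilde{\mathcal S}$ to $\tilde{\mathcal S}'$. For a real $2\times2$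 matrix $H=({H_j}^k)$ and $\alpha,\beta,\gamma\in\mathbb R$ put $G=\begin{pmatrix}\alpha&\beta\\ \beta&\gamma\end{pmatrix}$ and let $(C|N_{12}^{\alpha,\beta,\gamma})$ be the real Lie superalgebra with even basis elements $b_1,\tilde b^1$ and odd basis elements $f_1,f_2,\tilde f^1,\tilde f^2$, in which $$[b_1,f_j]={H_j}^kf_k,\quad [\tilde f^j,\tilde f^k]=G^{jk}\tilde b^1,\quad [f_j,\tilde f^k]={H_j}^k\tilde b^1,\quad [b_1,\tilde f^k]=G^{kj}f_j-{H_j}^k\tilde f^j$$ (and the brackets obtained from these by super skew symmetry), the other brackets of basis elements being zero, with the form for which $\langle b_1,\tilde b^1\rangle=\langle\tilde b^1,b_1\rangle=1$, $\langle f_j,\tilde f^k\rangle=-\langle\tilde f^k,f_j\rangle=\delta_j^k$ and all other products vanish, and with $\mathcal S=C=\mathrm{span}(b_1,f_1,f_2)$, $\tilde{\mathcal S}=N_{12}^{\alpha,\beta,\gamma}=\mathrm{span}(\tilde b^1,\tilde f^1,\tilde f^2)$. The superalgebra $C$ is one of: $A_{12}$ (abelian); $C^2_p$: $[b_1,f_1]=f_1$,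 $[b_1,f_2]=pf_2$; $C^3$: $[b_1,f_2]=f_1$; $C^4$: $[b_1,f_1]=f_1$, $[b_1,f_2]=f_1+f_2$; $C^5_p$: $[b_1,f_1]=pf_1-f_2$, $[b_1,f_2]=f_1+pf_2$. One has $A_{12}=N_{12}^{0,0,0}$. **Theorem.** Every real Drinfel'd superdouble of superdimension $(2,4)$ belongs to exactly one of the following classes (that is, it is isomorphic to the superdouble of a supertriple listed there). It decomposes, up to isomorphism of supertriples, into all Manin supertriples listed in its class and their duals, and into no others. Two such superdoubles are isomorphic if and only if they belong to the same class. Everything listed is a Manin supertriple of superdimension $(2,4)$. (All parameters are real and arbitrary unless restricted.) - $I$: $(A_{12}|A_{12})$; - $II_p$, $0<p<1$: $(C^2_{p}|N_{12}^{\alpha,\beta,\gamma})$, $(C^2_{-p}|N_{12}^{\alpha,\beta,\gamma})$; - $II_1$: $(C^2_1|N_{12}^{\alpha,\beta,\gamma})$, $(C^2_{-1}|N_{12}^{\lambda,0,\kappa})$; - $II_0$: $(C^2_0|N_{12}^{\alpha,\beta,0})$; - $III$: $(C^3|N_{12}^{\alpha,\beta,0})$, $(A_{12}|N_{12}^{\lambda,\kappa,\gamma})$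 with $\lambda\gamma<\kappa^2$; - $IV$: $(C^4|N_{12}^{\alpha,\beta,\gamma})$, $(C^2_{-1}|N_{12}^{\lambda,\kappa,\rho})$ with $\kappa\ne0$; - $V_p$, $p>0$: $(C^5_p|N_{12}^{\alpha,\beta,\gamma})$; - $V_0$: $(C^5_0|N_{12}^{\alpha,\beta,-\alpha})$; - $VI$: $(C^2_0|N_{12}^{\alpha,\beta,\gamma})$ with $\gamma\ne0$; - $VII$: $(C^3|N_{12}^{\alpha,\beta,\gamma})$ with $\gamma\ne0$; - $VIII$: $(C^5_0|N_{12}^{\alpha,\beta,\gamma})$ with $\alpha\ne-\gamma$; - $IX$: $(A_{12}|N_{12}^{\alpha,\beta,\gamma})$ with $\alpha\gamma>\beta^2$; - $X$: $(A_{12}|N_{12}^{\alpha,\beta,\gamma})$ with $(\alpha,\beta,\gamma)\ne(0,0,0)$ and $\alpha\gamma=\beta^2$. Moreover, every Manin supertriple of superdimension $(2,4)$ is isomorphic, up to replacing it by its dual, to exactly one of the following $(C|N_{12}^{\alpha,\beta,\gamma})$, which form 31 classes (some depending on parameters); here $\epsilon,\epsilon_1,\epsilon_2=\pm1$, $\delta\in\{0,1\}$: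 - 1–3: $C=A_{12}$, $(\alpha,\beta,\gamma)=(0,0,0),\ (1,0,0),\ (1,0,\epsilon)$; - 4–8: $C=C^2_p$, $|p|<1$: $(0,0,0),\ (0,1,0),\ (0,\delta,\epsilon),\ (\epsilon,\delta,0),\ (\epsilon_1,\kappa,\epsilon_2)$ with $\kappa\ge0$; - 9–12: $C=C^2_1$: $(0,0,0),\ (\epsilon,0,\epsilon),\ (1,0,-1),\ (0,0,\epsilon)$; - 13–17: $C=C^2_{-1}$: $(0,0,0),\ (0,1,0),\ (0,\delta,\epsilon),\ (1,\kappa,1),\ (\epsilon,\kappa,-\epsilon)$ with $\kappa\ge0$; - 18–22: $C=C^3$: $(0,0,0),\ (\epsilon,0,1),\ (1,0,0),\ (0,\epsilon,0),\ (0,0,1)$; - 23–26: $C=C^4$: $(0,0,0),\ (\epsilon,0,0),\ (0,\epsilon,0),\ (\kappa,0,\epsilon)$ with $\kappa\in\mathbb R$; - 27–29: $C=C^5_p$, $p>0$: $(0,0,0),\ (\kappa,0,\epsilon)$ with $-1<\kappa\le1$, $(-1,0,-1)$; - 30–31: $C=C^5_0$: $(0,0,0),\ (\kappa,0,1)$ with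 $-1\le\kappa\le1$. -/

import Mathlib

open Module

/-- The sign `(-1)^{|x||y|}` for elements of parities `i` and `j`. -/
def superSign (i j : ZMod 2) : ℝ := (-1) ^ (i.val * j.val)

/-- A real Lie superalgebra: a `ℤ/2`-graded real vector space `V = V₀ ⊕ V₁` with an even bilinear
bracket that is super skew symmetric and satisfies the super Jacobi identity. -/
structure LieSuperalgebra (V : Type*) [AddCommGroup V] [Module ℝ V] where
  part : ZMod 2 → Submodule ℝ V
  isCompl : IsCompl (part 0) (part 1)
  bracket : V →ₗ[ℝ] V →ₗ[ℝ] V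
  bracket_mem : ∀ i j : ZMod 2, ∀ x ∈ part i, ∀ y ∈ part j, bracket x y ∈ part (i + j)
  skew : ∀ i j : ZMod 2, ∀ x ∈ part i, ∀ y ∈ part j,
    bracket x y = -(superSign i j • bracket y x)
  jacobi : ∀ i j k : ZMod 2, ∀ x ∈ part i, ∀ y ∈ part j, ∀ z ∈ part k,
    superSign i k • bracket x (bracket y z) + superSign j i • bracket y (bracket z x)
      + superSign k j • bracket z (bracket x y) = 0

/-- A real Lie superalgebra with a nondegenerate, supersymmetric and super ad-invariant
bilinear form. -/
structure MetricLieSuperalgebra (V : Type*) [AddCommGroup V] [Module ℝ V]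
    extends LieSuperalgebra V where
  form : V →ₗ[ℝ] V →ₗ[ℝ] ℝ
  nondegenerate : form.Nondegenerate
  supersymmetric : ∀ i j : ZMod 2, ∀ x ∈ part i, ∀ y ∈ part j,
    form x y = superSign i j * form y x
  ad_invariant : ∀ i j k : ZMod 2, ∀ x ∈ part i, ∀ y ∈ part j, ∀ z ∈ part k,
    form (bracket x y) z + superSign i j * form y (bracket x z) = 0

/-- The superdimension is `(m, n)`: `dim V₀ = m` and `dim V₁ = n`. -/
def LieSuperalgebra.HasSuperdim {V : Type*} [AddCommGroup V] [Module ℝ V]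
    (L : LieSuperalgebra V) (m n : ℕ) : Prop :=
  Module.Finite ℝ V ∧ finrank ℝ (L.part 0) = m ∧ finrank ℝ (L.part 1) = n

/-- A (graded) subalgebra of a Lie superalgebra. -/
structure LieSuperalgebra.IsSubalgebra {V : Type*} [AddCommGroup V] [Module ℝ V]
    (L : LieSuperalgebra V) (S : Submodule ℝ V) : Prop where
  graded : S = (S ⊓ L.part 0) ⊔ (S ⊓ L.part 1)
  bracket_mem : ∀ x ∈ S, ∀ y ∈ S, L.bracket x y ∈ S

namespace MetricLieSuperalgebra

def IsIsotropic {V : Type*} [AddCommGroup V] [Module ℝ V]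
    (D : MetricLieSuperalgebra V) (S : Submodule ℝ V) : Prop :=
  ∀ x ∈ S, ∀ y ∈ S, D.form x y = 0

def IsMaximalIsotropic {V : Type*} [AddCommGroup V] [Module ℝ V]
    (D : MetricLieSuperalgebra V) (S : Submodule ℝ V) : Prop :=
  D.IsIsotropic S ∧ ∀ T : Submodule ℝ V, D.IsIsotropic T → S ≤ T → T = S

/-- `(D, S, S')` is a boson-fermion orthogonal Manin supertriple. -/
structure IsManinSupertriple {V : Type*} [AddCommGroup V] [Module ℝ V]
    (D : MetricLieSuperalgebra V) (S S' : Submodule ℝ V) : Prop where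
  left_subalgebra : D.IsSubalgebra S
  right_subalgebra : D.IsSubalgebra S'
  left_isotropic : D.IsMaximalIsotropic S
  right_isotropic : D.IsMaximalIsotropic S'
  isCompl : IsCompl S S'
  even_odd : ∀ x ∈ S ⊓ D.part 0, ∀ y ∈ S' ⊓ D.part 1, D.form x y = 0
  odd_even : ∀ x ∈ S ⊓ D.part 1, ∀ y ∈ S' ⊓ D.part 0, D.form x y = 0

/-- `D` is a Drinfel'd superdouble. -/
def IsDrinfeldSuperdouble {V : Type*} [AddCommGroup V] [Module ℝ V]
    (D : MetricLieSuperalgebra V) : Prop :=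
  ∃ S S' : Submodule ℝ V, D.IsManinSupertriple S S'

/-- The linear bijection `P` respects the gradings, the brackets and the bilinear forms. -/
structure IsIsoMap {V W : Type*} [AddCommGroup V] [Module ℝ V] [AddCommGroup W] [Module ℝ W]
    (D : MetricLieSuperalgebra V) (E : MetricLieSuperalgebra W) (P : V ≃ₗ[ℝ] W) : Prop where
  map_part : ∀ (i : ZMod 2) (x : V), P x ∈ E.part i ↔ x ∈ D.part i
  map_bracket : ∀ x y : V, P (D.bracket x y) = E.bracket (P x) (P y)
  map_form : ∀ x y : V, E.form (P x) (P y) = D.form x y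

/-- Isomorphism of Drinfel'd superdoubles. -/
def Isomorphic {V W : Type*} [AddCommGroup V] [Module ℝ V] [AddCommGroup W] [Module ℝ W]
    (D : MetricLieSuperalgebra V) (E : MetricLieSuperalgebra W) : Prop :=
  ∃ P : V ≃ₗ[ℝ] W, D.IsIsoMap E P

/-- Isomorphism of the Manin supertriples `(D, S, S')` and `(E, T, T')`. -/
def TripleIsomorphic {V W : Type*} [AddCommGroup V] [Module ℝ V] [AddCommGroup W] [Module ℝ W]
    (D : MetricLieSuperalgebra V) (S S' : Submodule ℝ V)
    (E : MetricLieSuperalgebra W) (T T' : Submodule ℝ W) : Prop :=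
  ∃ P : V ≃ₗ[ℝ] W, D.IsIsoMap E P ∧
    S.map (P : V →ₗ[ℝ] W) = T ∧ S'.map (P : V →ₗ[ℝ] W) = T'

end MetricLieSuperalgebra

/-! ### The Manin supertriples `(C|N^{α,β,γ})` -/

/-- The vector `((s, u), (t, w))` stands for
`s b₁ + u₁ f₁ + u₂ f₂ + t b̃¹ + w₁ f̃¹ + w₂ f̃²`. -/
abbrev TripleSpace : Type := (ℝ × (Fin 2 → ℝ)) × (ℝ × (Fin 2 → ℝ))

/-- The matrix of the brackets `[f̃ʲ, f̃ᵏ] = Gʲᵏ b̃¹` of `N^{α,β,γ}`. -/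
def matN (α β γ : ℝ) : Matrix (Fin 2) (Fin 2) ℝ := !![α, β; β, γ]

/-- The bracket on `S ⊕ S̃` with
`[b₁, f_j] = H_j^k f_k`, `[f̃ʲ, f̃ᵏ] = Gʲᵏ b̃¹`, `[f_j, f̃ᵏ] = H_j^k b̃¹`,
`[b₁, f̃ᵏ] = Gᵏʲ f_j - H_j^k f̃ʲ`, `[f_j, f_k] = 0` and `b̃¹` central, where `G = matN α β γ`. -/
def tripleBracket (H : Matrix (Fin 2) (Fin 2) ℝ) (α β γ : ℝ) :
    TripleSpace →ₗ[ℝ] TripleSpace →ₗ[ℝ] TripleSpace :=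
  LinearMap.mk₂ ℝ
    (fun x y =>
      ((0, fun k => x.1.1 * (∑ j, y.1.2 j * H j k + ∑ j, y.2.2 j * matN α β γ j k)
            - y.1.1 * (∑ j, x.1.2 j * H j k + ∑ j, x.2.2 j * matN α β γ j k)),
        (∑ j, ∑ k, (x.1.2 j * y.2.2 k + y.1.2 j * x.2.2 k) * H j k
            + ∑ j, ∑ k, x.2.2 j * y.2.2 k * matN α β γ j k,
          fun j => y.1.1 * ∑ k, H j k * x.2.2 k - x.1.1 * ∑ k, H j k * y.2.2 k)))
    (by
      intro x x' y
      refine Prod.ext (Prod.ext ?_ (funext fun k => ?_)) (Prod.ext ?_ (funext fun k => ?_))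
      all_goals simp only [Fin.sum_univ_two, Prod.fst_add, Prod.snd_add, Pi.add_apply]
      all_goals ring)
    (by
      intro c x y
      refine Prod.ext (Prod.ext ?_ (funext fun k => ?_)) (Prod.ext ?_ (funext fun k => ?_))
      all_goals simp only [Fin.sum_univ_two, Prod.smul_fst, Prod.smul_snd, Pi.smul_apply,
        smul_eq_mul]
      all_goals ring)
    (by
      intro x y y'
      refine Prod.ext (Prod.ext ?_ (funext fun k => ?_)) (Prod.ext ?_ (funext fun k => ?_))
      all_goals simp only [Fin.sum_univ_two, Prod.fst_add, Prod.snd_add, Pi.add_apply]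
      all_goals ring)
    (by
      intro c x y
      refine Prod.ext (Prod.ext ?_ (funext fun k => ?_)) (Prod.ext ?_ (funext fun k => ?_))
      all_goals simp only [Fin.sum_univ_two, Prod.smul_fst, Prod.smul_snd, Pi.smul_apply,
        smul_eq_mul]
      all_goals ring)

/-- The form for which `b₁, f₁, f₂, b̃¹, f̃¹, f̃²` is a dual homogeneous basis:
`⟨b₁, b̃¹⟩ = ⟨b̃¹, b₁⟩ = 1`, `⟨f_j, f̃ᵏ⟩ = -⟨f̃ᵏ, f_j⟩ = δ_j^k`, all other products zero. -/
def tripleForm : TripleSpace →ₗ[ℝ] TripleSpace →ₗ[ℝ] ℝ :=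
  LinearMap.mk₂ ℝ
    (fun x y => x.1.1 * y.2.1 + x.2.1 * y.1.1
      + ∑ j, x.1.2 j * y.2.2 j - ∑ j, x.2.2 j * y.1.2 j)
    (by
      intro x x' y
      simp only [Fin.sum_univ_two, Prod.fst_add, Prod.snd_add, Pi.add_apply]
      ring)
    (by
      intro c x y
      simp only [Fin.sum_univ_two, Prod.smul_fst, Prod.smul_snd, Pi.smul_apply, smul_eq_mul]
      ring)
    (by
      intro x y y'
      simp only [Fin.sum_univ_two, Prod.fst_add, Prod.snd_add, Pi.add_apply]
      ring)
    (by
      intro c x y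
      simp only [Fin.sum_univ_two, Prod.smul_fst, Prod.smul_snd, Pi.smul_apply, smul_eq_mul]
      ring)

/-- The even part is spanned by `b₁, b̃¹`, the odd part by `f₁, f₂, f̃¹, f̃²`. -/
def triplePart (i : ZMod 2) : Submodule ℝ TripleSpace where
  carrier := {x | if i = 0 then x.1.2 = 0 ∧ x.2.2 = 0 else x.1.1 = 0 ∧ x.2.1 = 0}
  zero_mem' := by split_ifs <;> simp
  add_mem' := by
    intro x y hx hy
    split_ifs at * <;> simp_all
  smul_mem' := by
    intro c x hx
    split_ifs at * <;> simp_all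

theorem mem_triplePart_zero (x : TripleSpace) :
    x ∈ triplePart 0 ↔ x.1.2 = 0 ∧ x.2.2 = 0 := by
  simp [triplePart]

theorem mem_triplePart_one (x : TripleSpace) :
    x ∈ triplePart 1 ↔ x.1.1 = 0 ∧ x.2.1 = 0 := by
  simp [triplePart]

theorem forall_zmod_two {p : ZMod 2 → Prop} (h0 : p 0) (h1 : p 1) : ∀ i, p i := by
  intro i
  fin_cases i
  · exact h0
  · exact h1

theorem superSign_zero_left (i : ZMod 2) : superSign 0 i = 1 := by simp [superSign]

theorem superSign_zero_right (i : ZMod 2) : superSign i 0 = 1 := by simp [superSign]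

theorem superSign_one_one : superSign 1 1 = -1 := by simp [superSign, ZMod.val_one]

theorem zmod_two_one_add_one : (1 + 1 : ZMod 2) = 0 := by decide

set_option maxHeartbeats 4000000 in
theorem triple_jacobi (H : Matrix (Fin 2) (Fin 2) ℝ) (α β γ : ℝ) (i j k : ZMod 2) :
    ∀ x ∈ triplePart i, ∀ y ∈ triplePart j, ∀ z ∈ triplePart k,
    superSign i k • tripleBracket H α β γ x (tripleBracket H α β γ y z)
      + superSign j i • tripleBracket H α β γ y (tripleBracket H α β γ z x)
      + superSign k j • tripleBracket H α β γ z (tripleBracket H α β γ x y) = 0 := by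
  revert i j k
  refine forall_zmod_two (forall_zmod_two (forall_zmod_two ?_ ?_) (forall_zmod_two ?_ ?_))
    (forall_zmod_two (forall_zmod_two ?_ ?_) (forall_zmod_two ?_ ?_)) <;>
  · rintro ⟨⟨s, u⟩, ⟨t, w⟩⟩ hx ⟨⟨s', u'⟩, ⟨t', w'⟩⟩ hy ⟨⟨s'', u''⟩, ⟨t'', w''⟩⟩ hz
    simp only [mem_triplePart_zero, mem_triplePart_one] at hx hy hz
    obtain ⟨rfl, rfl⟩ := hx
    obtain ⟨rfl, rfl⟩ := hy
    obtain ⟨rfl, rfl⟩ := hz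
    refine Prod.ext (Prod.ext ?_ (funext fun k => ?_)) (Prod.ext ?_ (funext fun k => ?_)) <;>
      simp [tripleBracket, superSign_zero_left, superSign_zero_right, superSign_one_one,
        Fin.sum_univ_two, matN] <;>
      ring

set_option maxHeartbeats 4000000 in
theorem triple_ad_invariant (H : Matrix (Fin 2) (Fin 2) ℝ) (α β γ : ℝ) (i j k : ZMod 2) :
    ∀ x ∈ triplePart i, ∀ y ∈ triplePart j, ∀ z ∈ triplePart k,
    tripleForm (tripleBracket H α β γ x y) z
      + superSign i j * tripleForm y (tripleBracket H α β γ x z) = 0 := by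
  revert i j k
  refine forall_zmod_two (forall_zmod_two (forall_zmod_two ?_ ?_) (forall_zmod_two ?_ ?_))
    (forall_zmod_two (forall_zmod_two ?_ ?_) (forall_zmod_two ?_ ?_)) <;>
  · rintro ⟨⟨s, u⟩, ⟨t, w⟩⟩ hx ⟨⟨s', u'⟩, ⟨t', w'⟩⟩ hy ⟨⟨s'', u''⟩, ⟨t'', w''⟩⟩ hz
    simp only [mem_triplePart_zero, mem_triplePart_one] at hx hy hz
    obtain ⟨rfl, rfl⟩ := hx
    obtain ⟨rfl, rfl⟩ := hy
    obtain ⟨rfl, rfl⟩ := hz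
    simp [tripleForm, tripleBracket, superSign_zero_left, superSign_zero_right,
      superSign_one_one, Fin.sum_univ_two, matN] <;>
    ring

/-- The Drinfel'd superdouble of `(C|N^{α,β,γ})`, where `[b₁, f_j] = H_j^k f_k` in `C`. -/
def tripleDouble (H : Matrix (Fin 2) (Fin 2) ℝ) (α β γ : ℝ) :
    MetricLieSuperalgebra TripleSpace where
  part := triplePart
  isCompl := by
    rw [isCompl_iff, Submodule.disjoint_def, Submodule.codisjoint_iff_exists_add_eq]
    constructor
    · intro x h0 h1
      rw [mem_triplePart_zero] at h0
      rw [mem_triplePart_one] at h1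
      exact Prod.ext (Prod.ext h1.1 h0.1) (Prod.ext h1.2 h0.2)
    · intro x
      refine ⟨((x.1.1, 0), (x.2.1, 0)), ((0, x.1.2), (0, x.2.2)), ?_, ?_, ?_⟩
      · simp [mem_triplePart_zero]
      · simp [mem_triplePart_one]
      · simp
  bracket := tripleBracket H α β γ
  bracket_mem := by
    refine forall_zmod_two (forall_zmod_two ?_ ?_) (forall_zmod_two ?_ ?_) <;>
    · rintro ⟨⟨s, u⟩, ⟨t, w⟩⟩ hx ⟨⟨s', u'⟩, ⟨t', w'⟩⟩ hy
      simp only [mem_triplePart_zero, mem_triplePart_one, add_zero, zero_add,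
        zmod_two_one_add_one] at *
      obtain ⟨rfl, rfl⟩ := hx
      obtain ⟨rfl, rfl⟩ := hy
      simp [tripleBracket, funext_iff]
  skew := by
    refine forall_zmod_two (forall_zmod_two ?_ ?_) (forall_zmod_two ?_ ?_) <;>
    · rintro ⟨⟨s, u⟩, ⟨t, w⟩⟩ hx ⟨⟨s', u'⟩, ⟨t', w'⟩⟩ hy
      simp only [mem_triplePart_zero, mem_triplePart_one] at hx hy
      obtain ⟨rfl, rfl⟩ := hx
      obtain ⟨rfl, rfl⟩ := hy
      refine Prod.ext (Prod.ext ?_ (funext fun k => ?_)) (Prod.ext ?_ (funext fun k => ?_)) <;>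
        simp [tripleBracket, superSign_zero_left, superSign_zero_right, superSign_one_one,
          Fin.sum_univ_two, matN] <;>
        ring
  jacobi := triple_jacobi H α β γ
  form := tripleForm
  nondegenerate := by
    constructor
    · intro x hx
      refine Prod.ext (Prod.ext ?_ (funext fun k => ?_)) (Prod.ext ?_ (funext fun k => ?_))
      · simpa [tripleForm] using hx ((0, 0), (1, 0))
      · have h := hx ((0, 0), (0, Pi.single k 1))
        fin_cases k <;> simpa [tripleForm] using h
      · simpa [tripleForm] using hx ((1, 0), (0, 0))
      · have h := hx ((0, Pi.single k 1), (0, 0))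
        fin_cases k <;> simpa [tripleForm] using h
    · intro x hx
      refine Prod.ext (Prod.ext ?_ (funext fun k => ?_)) (Prod.ext ?_ (funext fun k => ?_))
      · simpa [tripleForm] using hx ((0, 0), (1, 0))
      · have h := hx ((0, 0), (0, Pi.single k 1))
        fin_cases k <;> simpa [tripleForm] using h
      · simpa [tripleForm] using hx ((1, 0), (0, 0))
      · have h := hx ((0, Pi.single k 1), (0, 0))
        fin_cases k <;> simpa [tripleForm] using h
  supersymmetric := by
    refine forall_zmod_two (forall_zmod_two ?_ ?_) (forall_zmod_two ?_ ?_) <;>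
    · rintro ⟨⟨s, u⟩, ⟨t, w⟩⟩ hx ⟨⟨s', u'⟩, ⟨t', w'⟩⟩ hy
      simp only [mem_triplePart_zero, mem_triplePart_one] at hx hy
      obtain ⟨rfl, rfl⟩ := hx
      obtain ⟨rfl, rfl⟩ := hy
      simp [tripleForm, superSign_zero_left, superSign_zero_right, superSign_one_one,
        Fin.sum_univ_two] <;>
      ring
  ad_invariant := triple_ad_invariant H α β γ

/-- The subalgebra `C` spanned by `b₁, f₁, f₂`. -/
def tripleLeft : Submodule ℝ TripleSpace := LinearMap.ker (LinearMap.snd ℝ _ _)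

/-- The subalgebra `N^{α,β,γ}` spanned by `b̃¹, f̃¹, f̃²`. -/
def tripleRight : Submodule ℝ TripleSpace := LinearMap.ker (LinearMap.fst ℝ _ _)

/-- `(D, S, S')` is isomorphic to the Manin supertriple `(C|N^{α,β,γ})`. -/
def IsTriple {V : Type*} [AddCommGroup V] [Module ℝ V] (D : MetricLieSuperalgebra V)
    (S S' : Submodule ℝ V) (H : Matrix (Fin 2) (Fin 2) ℝ) (α β γ : ℝ) : Prop :=
  D.TripleIsomorphic S S' (tripleDouble H α β γ) tripleLeft tripleRight

/-- `(D, S, S')` is isomorphic to the dual `(N^{α,β,γ}|C)` of `(C|N^{α,β,γ})`. -/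
def IsDualTriple {V : Type*} [AddCommGroup V] [Module ℝ V] (D : MetricLieSuperalgebra V)
    (S S' : Submodule ℝ V) (H : Matrix (Fin 2) (Fin 2) ℝ) (α β γ : ℝ) : Prop :=
  D.TripleIsomorphic S S' (tripleDouble H α β γ) tripleRight tripleLeft

/-! ### The superalgebras `C`, each given by the matrix of `[b₁, f_j] = H_j^k f_k` -/

/-- The abelian superalgebra `A₁₂`. -/
def A12 : Matrix (Fin 2) (Fin 2) ℝ := 0

/-- `C²_p`: `[b₁, f₁] = f₁`, `[b₁, f₂] = p f₂`. -/
def C2 (p : ℝ) : Matrix (Fin 2) (Fin 2) ℝ := !![1, 0; 0, p]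

/-- `C³`: `[b₁, f₂] = f₁`. -/
def C3 : Matrix (Fin 2) (Fin 2) ℝ := !![0, 0; 1, 0]

/-- `C⁴`: `[b₁, f₁] = f₁`, `[b₁, f₂] = f₁ + f₂`. -/
def C4 : Matrix (Fin 2) (Fin 2) ℝ := !![1, 0; 1, 1]

/-- `C⁵_p`: `[b₁, f₁] = p f₁ - f₂`, `[b₁, f₂] = f₁ + p f₂`. -/
def C5 (p : ℝ) : Matrix (Fin 2) (Fin 2) ℝ := !![p, -1; 1, p]

/-! ### The lists of superdoubles and of supertriples -/

/-- The labels of the classes; `II p` (with `0 < p < 1`) and `V p` (with `0 < p`) are families. -/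
inductive SuperdoubleClass : Type
  | I
  | II (p : Set.Ioo (0 : ℝ) 1)
  | II_one
  | II_zero
  | III
  | IV
  | V (p : Set.Ioi (0 : ℝ))
  | V_zero
  | VI
  | VII
  | VIII
  | IX
  | X

/-- `Lists c H α β γ`: the Manin supertriple `(C|N^{α,β,γ})`, with `C` given by `H`, is listed in
the class `c`. -/
inductive SuperdoubleClass.Lists :
    SuperdoubleClass → Matrix (Fin 2) (Fin 2) ℝ → ℝ → ℝ → ℝ → Prop
  | I : Lists .I A12 0 0 0
  | II_pos (p : Set.Ioo (0 : ℝ) 1) (α β γ : ℝ) : Lists (.II p) (C2 p) α β γ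
  | II_neg (p : Set.Ioo (0 : ℝ) 1) (α β γ : ℝ) : Lists (.II p) (C2 (-p)) α β γ
  | II_one (α β γ : ℝ) : Lists .II_one (C2 1) α β γ
  | II_one_neg (lam κ : ℝ) : Lists .II_one (C2 (-1)) lam 0 κ
  | II_zero (α β : ℝ) : Lists .II_zero (C2 0) α β 0
  | III (α β : ℝ) : Lists .III C3 α β 0
  | III_abelian (lam κ γ : ℝ) (h : lam * γ < κ ^ 2) : Lists .III A12 lam κ γ
  | IV (α β γ : ℝ) : Lists .IV C4 α β γ
  | IV_neg (lam κ ρ : ℝ) (h : κ ≠ 0) : Lists .IV (C2 (-1)) lam κ ρ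
  | V (p : Set.Ioi (0 : ℝ)) (α β γ : ℝ) : Lists (.V p) (C5 p) α β γ
  | V_zero (α β : ℝ) : Lists .V_zero (C5 0) α β (-α)
  | VI (α β γ : ℝ) (h : γ ≠ 0) : Lists .VI (C2 0) α β γ
  | VII (α β γ : ℝ) (h : γ ≠ 0) : Lists .VII C3 α β γ
  | VIII (α β γ : ℝ) (h : α ≠ -γ) : Lists .VIII (C5 0) α β γ
  | IX (α β γ : ℝ) (h : α * γ > β ^ 2) : Lists .IX A12 α β γ
  | X (α β γ : ℝ) (h : (α, β, γ) ≠ (0, 0, 0)) (h' : α * γ = β ^ 2) : Lists .X A12 α β γ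

/-- The superdouble `D` belongs to the class `c`: it is isomorphic to the superdouble of a Manin
supertriple listed in `c`. -/
def BelongsTo {V : Type*} [AddCommGroup V] [Module ℝ V] (D : MetricLieSuperalgebra V)
    (c : SuperdoubleClass) : Prop :=
  ∃ H α β γ, c.Lists H α β γ ∧ D.Isomorphic (tripleDouble H α β γ)

/-- `IsSign ε`: `ε = ±1`. -/
def IsSign (ε : ℝ) : Prop := ε = 1 ∨ ε = -1

/-- The 31 classes of Manin supertriples `(C|N^{α,β,γ})` of superdimension `(2, 4)` up to
T-duality, with `C` given by `H`; some classes are families depending on parameters. -/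
inductive InTable : Matrix (Fin 2) (Fin 2) ℝ → ℝ → ℝ → ℝ → Prop
  | row1 : InTable A12 0 0 0
  | row2 : InTable A12 1 0 0
  | row3 (ε : ℝ) (hε : IsSign ε) : InTable A12 1 0 ε
  | row4 (p : ℝ) (hp : |p| < 1) : InTable (C2 p) 0 0 0
  | row5 (p : ℝ) (hp : |p| < 1) : InTable (C2 p) 0 1 0
  | row6 (p δ ε : ℝ) (hp : |p| < 1) (hδ : δ = 0 ∨ δ = 1) (hε : IsSign ε) : InTable (C2 p) 0 δ ε
  | row7 (p δ ε : ℝ) (hp : |p| < 1) (hδ : δ = 0 ∨ δ = 1) (hε : IsSign ε) : InTable (C2 p) ε δ 0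
  | row8 (p κ ε₁ ε₂ : ℝ) (hp : |p| < 1) (hκ : 0 ≤ κ) (h₁ : IsSign ε₁) (h₂ : IsSign ε₂) :
      InTable (C2 p) ε₁ κ ε₂
  | row9 : InTable (C2 1) 0 0 0
  | row10 (ε : ℝ) (hε : IsSign ε) : InTable (C2 1) ε 0 ε
  | row11 : InTable (C2 1) 1 0 (-1)
  | row12 (ε : ℝ) (hε : IsSign ε) : InTable (C2 1) 0 0 ε
  | row13 : InTable (C2 (-1)) 0 0 0
  | row14 : InTable (C2 (-1)) 0 1 0
  | row15 (δ ε : ℝ) (hδ : δ = 0 ∨ δ = 1) (hε : IsSign ε) : InTable (C2 (-1)) 0 δ ε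
  | row16 (κ : ℝ) (hκ : 0 ≤ κ) : InTable (C2 (-1)) 1 κ 1
  | row17 (κ ε : ℝ) (hκ : 0 ≤ κ) (hε : IsSign ε) : InTable (C2 (-1)) ε κ (-ε)
  | row18 : InTable C3 0 0 0
  | row19 (ε : ℝ) (hε : IsSign ε) : InTable C3 ε 0 1
  | row20 : InTable C3 1 0 0
  | row21 (ε : ℝ) (hε : IsSign ε) : InTable C3 0 ε 0
  | row22 : InTable C3 0 0 1
  | row23 : InTable C4 0 0 0
  | row24 (ε : ℝ) (hε : IsSign ε) : InTable C4 ε 0 0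
  | row25 (ε : ℝ) (hε : IsSign ε) : InTable C4 0 ε 0
  | row26 (κ ε : ℝ) (hε : IsSign ε) : InTable C4 κ 0 ε
  | row27 (p : ℝ) (hp : 0 < p) : InTable (C5 p) 0 0 0
  | row28 (p κ ε : ℝ) (hp : 0 < p) (hκ : -1 < κ) (hκ' : κ ≤ 1) (hε : IsSign ε) :
      InTable (C5 p) κ 0 ε
  | row29 (p : ℝ) (hp : 0 < p) : InTable (C5 p) (-1) 0 (-1)
  | row30 : InTable (C5 0) 0 0 0
  | row31 (κ : ℝ) (hκ : -1 ≤ κ) (hκ' : κ ≤ 1) : InTable (C5 0) κ 0 1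

/-! Everything is governed by one operator. The even part of the superdouble is a hyperbolic plane
spanned by null vectors `b ∈ S₀` and `b̃ ∈ S̃₀`. Ad-invariance makes this plane abelian, lets it act
on the odd part by symplectic operators, and gives `[u, v] = ⟨[b̃, u], v⟩ b + ⟨[b, u], v⟩ b̃` for
odd `u, v`. The Jacobi identity for `u, u, u`, paired with `u`, says that the quadratic forms of `ad
b` and `ad b̃` have product zero. Hence one of them vanishes and its vector is central
(`IsFrame.ad_eq_zero_or`). After exchanging the subalgebras if necessary, the bracket is determined
by `X = ad b`. Since `S` is an isotropic subalgebra, one block of the form of `X` is zero, and the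
remaining ones are `H` and `G` (`exists_isTriple_or_isDualTriple`).

Supertriples are therefore pairs `(H, G)` modulo `H' = s A⁻¹ H A`, `G' = s Aᵀ G A`
(`TripleChange.tripleRel`, `TripleRel.exists_change`). Trace and determinant normalise `H`, and the
transformations fixing a normal `H` then normalise `G` (`exists_inTable`). The same equations show
that table entries are pairwise inequivalent (`TripleRel.eq_of_inTable`). A supertriple `(C|N)` is
isomorphic to a dual one only in the abelian case, so duality causes no further coincidences.

For superdoubles every symplectic map of the odd part is allowed. Shears replace `G` by `G + T H +
(T H)ᵀ`, and exchanges of `f_j` with `f̃ʲ` negate eigenvalues of `H`; together with isomorphisms of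
triples they connect everything listed in a class (`SuperdoubleClass.Lists.doubleRel_rep`).
Conversely, `X` is an invariant up to scale and symplectic conjugation
(`DoubleRel.exists_intertwining`). The traces of `X²` and `X⁴` recover its spectrum up to scale.
Classes with equal spectrum are separated by whether `X = 0`, whether `X³` is a multiple of `X`, and
whether its quadratic form is semidefinite or of rank at most one
(`SuperdoubleClass.eq_of_doubleRel_rep`). -/

namespace MetricLieSuperalgebra

/-! ### Isomorphisms form a groupoid, along which supertriples are transported. -/

section Groupoid

variable {U V W : Type*} [AddCommGroup U] [Module ℝ U] [AddCommGroup V] [Module ℝ V]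
  [AddCommGroup W] [Module ℝ W]
  {D : MetricLieSuperalgebra U} {E : MetricLieSuperalgebra V} {F : MetricLieSuperalgebra W}

theorem IsIsoMap.refl (D : MetricLieSuperalgebra U) : D.IsIsoMap D (LinearEquiv.refl ℝ U) :=
  ⟨fun _ _ => Iff.rfl, fun _ _ => rfl, fun _ _ => rfl⟩

theorem IsIsoMap.symm {P : U ≃ₗ[ℝ] V} (h : D.IsIsoMap E P) : E.IsIsoMap D P.symm := by
  refine ⟨fun i x => ?_, fun x y => ?_, fun x y => ?_⟩
  · rw [← h.map_part i, P.apply_symm_apply]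
  · rw [P.symm_apply_eq, h.map_bracket, P.apply_symm_apply, P.apply_symm_apply]
  · rw [← h.map_form, P.apply_symm_apply, P.apply_symm_apply]

theorem IsIsoMap.trans {P : U ≃ₗ[ℝ] V} {Q : V ≃ₗ[ℝ] W} (h : D.IsIsoMap E P)
    (h' : E.IsIsoMap F Q) : D.IsIsoMap F (P.trans Q) := by
  refine ⟨fun i x => ?_, fun x y => ?_, fun x y => ?_⟩
  · rw [LinearEquiv.trans_apply, h'.map_part, h.map_part]
  · simp only [LinearEquiv.trans_apply, h.map_bracket, h'.map_bracket]
  · simp only [LinearEquiv.trans_apply, h.map_form, h'.map_form]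

theorem Isomorphic.refl (D : MetricLieSuperalgebra U) : D.Isomorphic D :=
  ⟨_, IsIsoMap.refl D⟩

theorem Isomorphic.symm (h : D.Isomorphic E) : E.Isomorphic D :=
  let ⟨P, hP⟩ := h
  ⟨P.symm, hP.symm⟩

theorem Isomorphic.trans (h : D.Isomorphic E) (h' : E.Isomorphic F) : D.Isomorphic F :=
  let ⟨_, hP⟩ := h
  let ⟨_, hQ⟩ := h'
  ⟨_, hP.trans hQ⟩

variable {S S' : Submodule ℝ U} {T T' : Submodule ℝ V} {R R' : Submodule ℝ W}

theorem TripleIsomorphic.isomorphic (h : D.TripleIsomorphic S S' E T T') : D.Isomorphic E :=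
  let ⟨P, hP, _⟩ := h
  ⟨P, hP⟩

theorem TripleIsomorphic.swap (h : D.TripleIsomorphic S S' E T T') :
    D.TripleIsomorphic S' S E T' T :=
  let ⟨P, hP, h1, h2⟩ := h
  ⟨P, hP, h2, h1⟩

theorem TripleIsomorphic.symm (h : D.TripleIsomorphic S S' E T T') :
    E.TripleIsomorphic T T' D S S' := by
  obtain ⟨P, hP, rfl, rfl⟩ := h
  refine ⟨P.symm, hP.symm, ?_, ?_⟩ <;>
  · ext x
    simp

theorem TripleIsomorphic.trans (h : D.TripleIsomorphic S S' E T T')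
    (h' : E.TripleIsomorphic T T' F R R') : D.TripleIsomorphic S S' F R R' := by
  obtain ⟨P, hP, rfl, rfl⟩ := h
  obtain ⟨Q, hQ, rfl, rfl⟩ := h'
  refine ⟨P.trans Q, hP.trans hQ, ?_, ?_⟩ <;>
  · ext x
    simp

theorem IsManinSupertriple.swap (h : D.IsManinSupertriple S S') : D.IsManinSupertriple S' S where
  left_subalgebra := h.right_subalgebra
  right_subalgebra := h.left_subalgebra
  left_isotropic := h.right_isotropic
  right_isotropic := h.left_isotropic
  isCompl := h.isCompl.symm
  even_odd x hx y hy := by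
    rw [D.supersymmetric 0 1 x hx.2 y hy.2, h.odd_even y hy x hx, mul_zero]
  odd_even x hx y hy := by
    rw [D.supersymmetric 1 0 x hx.2 y hy.2, h.even_odd y hy x hx, mul_zero]

theorem IsIsoMap.comap_isSubalgebra {P : U ≃ₗ[ℝ] V} (hP : D.IsIsoMap E P)
    (h : E.IsSubalgebra T) : D.IsSubalgebra (T.comap (P : U →ₗ[ℝ] V)) where
  graded := by
    refine le_antisymm (fun x hx => ?_) (sup_le inf_le_left inf_le_left)
    have hx' : P x ∈ (T ⊓ E.part 0) ⊔ (T ⊓ E.part 1) := by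
      rw [← h.graded]
      exact hx
    obtain ⟨y, hy, z, hz, hyz⟩ := Submodule.mem_sup.1 hx'
    refine Submodule.mem_sup.2 ⟨P.symm y, ⟨?_, ?_⟩, P.symm z, ⟨?_, ?_⟩, ?_⟩
    · simpa using hy.1
    · simpa [← hP.map_part] using hy.2
    · simpa using hz.1
    · simpa [← hP.map_part] using hz.2
    · rw [← map_add, hyz, P.symm_apply_apply]
  bracket_mem x hx y hy := by
    simp only [Submodule.mem_comap, LinearEquiv.coe_coe] at *
    rw [hP.map_bracket]
    exact h.bracket_mem _ hx _ hy

theorem IsIsoMap.comap_isMaximalIsotropic {P : U ≃ₗ[ℝ] V} (hP : D.IsIsoMap E P)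
    (h : E.IsMaximalIsotropic T) : D.IsMaximalIsotropic (T.comap (P : U →ₗ[ℝ] V)) := by
  refine ⟨fun x hx y hy => ?_, fun R hR hle => ?_⟩
  · rw [← hP.map_form]
    exact h.1 _ hx _ hy
  -- An isotropic extension of the preimage maps to an isotropic extension of `T`, hence to `T`.
  · have h1 : R.map (P : U →ₗ[ℝ] V) = T := by
      refine h.2 _ ?_ fun x hx => ?_
      · rintro _ ⟨x, hx, rfl⟩ _ ⟨y, hy, rfl⟩
        rw [LinearEquiv.coe_coe, hP.map_form]
        exact hR x hx y hy
      · exact ⟨P.symm x, hle (by simpa using hx), by simp⟩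
    rw [← h1]
    ext x
    simp

theorem IsIsoMap.comap_isManinSupertriple {P : U ≃ₗ[ℝ] V} (hP : D.IsIsoMap E P)
    (h : E.IsManinSupertriple T T') :
    D.IsManinSupertriple (T.comap (P : U →ₗ[ℝ] V)) (T'.comap (P : U →ₗ[ℝ] V)) where
  left_subalgebra := hP.comap_isSubalgebra h.left_subalgebra
  right_subalgebra := hP.comap_isSubalgebra h.right_subalgebra
  left_isotropic := hP.comap_isMaximalIsotropic h.left_isotropic
  right_isotropic := hP.comap_isMaximalIsotropic h.right_isotropic
  isCompl := by
    have := h.isCompl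
    rw [isCompl_iff, Submodule.disjoint_def, Submodule.codisjoint_iff_exists_add_eq] at this ⊢
    refine ⟨fun x hx hx' => ?_, fun x => ?_⟩
    · simpa using this.1 (P x) hx hx'
    · obtain ⟨y, z, hy, hz, hyz⟩ := this.2 (P x)
      refine ⟨P.symm y, P.symm z, by simpa using hy, by simpa using hz, ?_⟩
      rw [← map_add, hyz, P.symm_apply_apply]
  even_odd x hx y hy := by
    rw [← hP.map_form]
    exact h.even_odd _ ⟨hx.1, (hP.map_part _ _).2 hx.2⟩ _ ⟨hy.1, (hP.map_part _ _).2 hy.2⟩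
  odd_even x hx y hy := by
    rw [← hP.map_form]
    exact h.odd_even _ ⟨hx.1, (hP.map_part _ _).2 hx.2⟩ _ ⟨hy.1, (hP.map_part _ _).2 hy.2⟩

/-- A superdouble isomorphic to `E` decomposes in the same way as `E`. -/
theorem Isomorphic.exists_tripleIsomorphic (h : D.Isomorphic E)
    (hT : E.IsManinSupertriple T T') :
    ∃ S S' : Submodule ℝ U, D.IsManinSupertriple S S' ∧ D.TripleIsomorphic S S' E T T' := by
  obtain ⟨P, hP⟩ := h
  refine ⟨_, _, hP.comap_isManinSupertriple hT, P, hP, ?_, ?_⟩ <;>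
  · rw [Submodule.map_comap_eq_of_surjective]
    exact P.surjective

end Groupoid

end MetricLieSuperalgebra

/-! ### Vectors of the standard space -/

/-- The even basis vector `b₁`. -/
def evenLeft : TripleSpace := ((1, 0), (0, 0))

/-- The even basis vector `b̃¹`. -/
def evenRight : TripleSpace := ((0, 0), (1, 0))

/-- The projection to the odd part. -/
def oddProj : TripleSpace →ₗ[ℝ] TripleSpace where
  toFun x := ((0, x.1.2), (0, x.2.2))
  map_add' x y := by simp
  map_smul' c x := by simp

theorem oddProj_apply (x : TripleSpace) : oddProj x = ((0, x.1.2), (0, x.2.2)) := rfl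

theorem oddProj_mem (x : TripleSpace) : oddProj x ∈ triplePart 1 := by
  simp [mem_triplePart_one, oddProj_apply]

theorem evenLeft_mem : evenLeft ∈ triplePart 0 := by simp [mem_triplePart_zero, evenLeft]

theorem evenRight_mem : evenRight ∈ triplePart 0 := by simp [mem_triplePart_zero, evenRight]

theorem eq_even_add_odd (x : TripleSpace) :
    x = x.1.1 • evenLeft + x.2.1 • evenRight + oddProj x := by
  refine Prod.ext (Prod.ext ?_ ?_) (Prod.ext ?_ ?_) <;>
    simp [evenLeft, evenRight, oddProj_apply]

theorem eq_even_of_mem {x : TripleSpace} (hx : x ∈ triplePart 0) :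
    x = x.1.1 • evenLeft + x.2.1 • evenRight := by
  rw [mem_triplePart_zero] at hx
  refine Prod.ext (Prod.ext ?_ ?_) (Prod.ext ?_ ?_) <;>
    simp [evenLeft, evenRight, hx]

theorem tripleForm_apply (x y : TripleSpace) :
    tripleForm x y = x.1.1 * y.2.1 + x.2.1 * y.1.1 + x.1.2 ⬝ᵥ y.2.2 - x.2.2 ⬝ᵥ y.1.2 := rfl

theorem tripleForm_oddProj {x : TripleSpace} (hx : x ∈ triplePart 1) (y : TripleSpace) :
    tripleForm x (oddProj y) = tripleForm x y := by
  rw [mem_triplePart_one] at hx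
  simp [tripleForm_apply, oddProj_apply, hx]

theorem finrank_tripleSpace : finrank ℝ TripleSpace = 6 := by
  simp

open Matrix in
theorem tripleBracket_evenLeft (H : Matrix (Fin 2) (Fin 2) ℝ) (α β γ : ℝ) (x : TripleSpace) :
    tripleBracket H α β γ evenLeft x =
      ((0, x.1.2 ᵥ* H + x.2.2 ᵥ* matN α β γ), (0, -(H *ᵥ x.2.2))) := by
  refine Prod.ext (Prod.ext ?_ (funext fun k => ?_)) (Prod.ext ?_ (funext fun k => ?_))
  all_goals simp [tripleBracket, evenLeft, vecMul, dotProduct]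
  fin_cases k <;> simp

theorem tripleBracket_evenRight (H : Matrix (Fin 2) (Fin 2) ℝ) (α β γ : ℝ) (x : TripleSpace) :
    tripleBracket H α β γ evenRight x = 0 := by
  refine Prod.ext (Prod.ext ?_ (funext fun k => ?_)) (Prod.ext ?_ (funext fun k => ?_)) <;>
    simp [tripleBracket, evenRight]

theorem tripleBracket_evenLeft_mem (H : Matrix (Fin 2) (Fin 2) ℝ) (α β γ : ℝ) (x : TripleSpace) :
    tripleBracket H α β γ evenLeft x ∈ triplePart 1 := by
  rw [tripleBracket_evenLeft]
  simp [mem_triplePart_one]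

/-! ### Frames: copies of the standard graded form inside a superdouble. -/

namespace MetricLieSuperalgebra

variable {V : Type*} [AddCommGroup V] [Module ℝ V]

/-- Ad-invariance moves `u` across the form; the signs from `[u, a] = -[a, u]` and from exchanging
two odd arguments cancel. This recovers odd brackets from the action of the even part. -/
theorem form_bracket_odd (D : MetricLieSuperalgebra V) {a u v : V} (ha : a ∈ D.part 0)
    (hu : u ∈ D.part 1) (hv : v ∈ D.part 1) :
    D.form (D.bracket u v) a = D.form (D.bracket a u) v := by
  have h1 := D.ad_invariant 1 1 0 u hu v hv a ha
  have h2 := D.skew 1 0 u hu a ha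
  have hau : D.bracket a u ∈ D.part 1 := by simpa using D.bracket_mem 0 1 a ha u hu
  have h3 := D.supersymmetric 1 1 v hv _ hau
  rw [superSign_one_one] at h1 h3
  rw [superSign_zero_right, one_smul] at h2
  rw [h2, map_neg] at h1
  linarith

theorem bracket_even_self (D : MetricLieSuperalgebra V) {a : V} (ha : a ∈ D.part 0) :
    D.bracket a a = 0 := by
  have h := D.skew 0 0 a ha a ha
  rw [superSign_zero_left, one_smul] at h
  have h2 : (2 : ℝ) • D.bracket a a = 0 := by rw [two_smul, ← sub_neg_eq_add, ← h, sub_self]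
  exact (smul_eq_zero.1 h2).resolve_left two_ne_zero

theorem form_bracket_even (D : MetricLieSuperalgebra V) {a x y : V} (ha : a ∈ D.part 0)
    {i j : ZMod 2} (hx : x ∈ D.part i) (hy : y ∈ D.part j) :
    D.form (D.bracket a x) y = -D.form x (D.bracket a y) := by
  have h := D.ad_invariant 0 i j a ha x hx y hy
  rw [superSign_zero_left, one_mul] at h
  linarith

theorem bracket_even_comm (D : MetricLieSuperalgebra V) {a x : V} (ha : a ∈ D.part 0)
    {i : ZMod 2} (hx : x ∈ D.part i) : D.bracket x a = -D.bracket a x := by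
  have h := D.skew i 0 x hx a ha
  rwa [superSign_zero_right, one_smul] at h

/-- The linear map `Q` from the standard space to a superdouble respects gradings and forms. -/
structure IsFrame (D : MetricLieSuperalgebra V) (Q : TripleSpace →ₗ[ℝ] V) : Prop where
  map_mem : ∀ i, ∀ x ∈ triplePart i, Q x ∈ D.part i
  map_form : ∀ x y, D.form (Q x) (Q y) = tripleForm x y

namespace IsFrame

variable {D : MetricLieSuperalgebra V} {Q : TripleSpace →ₗ[ℝ] V}

theorem injective (h : D.IsFrame Q) : Function.Injective Q := by
  refine (injective_iff_map_eq_zero Q).2 fun x hx => ?_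
  -- All standard superdoubles share the form, so the one with zero parameters supplies its
  -- nondegeneracy.
  refine (tripleDouble 0 0 0 0).nondegenerate.1 x fun y => ?_
  change tripleForm x y = 0
  rw [← h.map_form, hx, map_zero, LinearMap.zero_apply]

theorem surjective (h : D.IsFrame Q) (hV : finrank ℝ V = 6) : Function.Surjective Q := by
  have : FiniteDimensional ℝ V := FiniteDimensional.of_finrank_pos (by omega)
  exact (LinearMap.injective_iff_surjective_of_finrank_eq_finrank
    (by rw [finrank_tripleSpace, hV])).1 h.injective

/-- The component of `x` of the wrong parity maps into both parts at once, hence to zero, and `Q` is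
injective. -/
theorem mem_iff (h : D.IsFrame Q) (i : ZMod 2) (x : TripleSpace) :
    Q x ∈ D.part i ↔ x ∈ triplePart i := by
  refine ⟨fun hx => ?_, h.map_mem i x⟩
  have hd := Submodule.disjoint_def.1 D.isCompl.disjoint
  have he : x.1.1 • evenLeft + x.2.1 • evenRight ∈ triplePart 0 :=
    add_mem (Submodule.smul_mem _ _ evenLeft_mem) (Submodule.smul_mem _ _ evenRight_mem)
  have hsum := eq_even_add_odd x
  have h0 := h.map_mem 0 _ he
  have h1 := h.map_mem 1 _ (oddProj_mem x)
  have hQ : Q x = Q (x.1.1 • evenLeft + x.2.1 • evenRight) + Q (oddProj x) := by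
    rw [← map_add, ← hsum]
  revert i
  refine forall_zmod_two (fun hx => ?_) fun hx => ?_
  · have : Q (oddProj x) = 0 := by
      refine hd _ ?_ h1
      rw [eq_sub_of_add_eq' hQ.symm]
      exact sub_mem hx h0
    rw [hsum, h.injective (this.trans (map_zero Q).symm), add_zero]
    exact he
  · have : Q (x.1.1 • evenLeft + x.2.1 • evenRight) = 0 := by
      refine hd _ h0 ?_
      rw [eq_sub_of_add_eq hQ.symm]
      exact sub_mem hx h1
    rw [hsum, h.injective (this.trans (map_zero Q).symm), zero_add]
    exact oddProj_mem x

/-- An even vector is determined by its products with the even vectors of a frame. -/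
theorem even_eq (h : D.IsFrame Q) (hV : finrank ℝ V = 6) {v : V} (hv : v ∈ D.part 0) :
    v = D.form v (Q evenRight) • Q evenLeft + D.form v (Q evenLeft) • Q evenRight := by
  obtain ⟨x, rfl⟩ := h.surjective hV v
  have hx := eq_even_of_mem ((h.mem_iff 0 x).1 hv)
  rw [h.map_form, h.map_form, ← map_smul, ← map_smul, ← map_add]
  congr 1
  have h1 : tripleForm x evenRight = x.1.1 := by simp [tripleForm_apply, evenRight]
  have h2 : tripleForm x evenLeft = x.2.1 := by simp [tripleForm_apply, evenLeft]
  rw [h1, h2]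
  exact hx

/-- By invariance and skew symmetry the bracket is orthogonal to both even frame vectors. -/
theorem bracket_even_even (h : D.IsFrame Q) (hV : finrank ℝ V = 6) :
    D.bracket (Q evenLeft) (Q evenRight) = 0 := by
  have hl := h.map_mem 0 _ evenLeft_mem
  have hr := h.map_mem 0 _ evenRight_mem
  have hm : D.bracket (Q evenLeft) (Q evenRight) ∈ D.part 0 := by
    simpa using D.bracket_mem 0 0 _ hl _ hr
  rw [h.even_eq hV hm, D.form_bracket_even hl hr hl, D.bracket_even_self hl,
    ← neg_eq_iff_eq_neg.2 (D.bracket_even_comm hl hr), map_neg, LinearMap.neg_apply,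
    D.form_bracket_even hr hl hr, D.bracket_even_self hr]
  simp

theorem bracket_odd_odd (h : D.IsFrame Q) (hV : finrank ℝ V = 6) {u v : V} (hu : u ∈ D.part 1)
    (hv : v ∈ D.part 1) :
    D.bracket u v = D.form (D.bracket (Q evenRight) u) v • Q evenLeft
      + D.form (D.bracket (Q evenLeft) u) v • Q evenRight := by
  have hm : D.bracket u v ∈ D.part 0 := by
    simpa [zmod_two_one_add_one] using D.bracket_mem 1 1 _ hu _ hv
  rw [← D.form_bracket_odd (h.map_mem 0 _ evenLeft_mem) hu hv,
    ← D.form_bracket_odd (h.map_mem 0 _ evenRight_mem) hu hv, ← h.even_eq hV hm]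

/-- Once `Q evenRight` acts trivially, the single operator `ad (Q evenLeft)` on the odd part
determines every bracket. -/
theorem bracket_eq (h : D.IsFrame Q) (hV : finrank ℝ V = 6)
    (hr : ∀ x ∈ triplePart 1, D.bracket (Q evenRight) (Q x) = 0) (x y : TripleSpace) :
    D.bracket (Q x) (Q y) =
      x.1.1 • D.bracket (Q evenLeft) (Q (oddProj y))
      - y.1.1 • D.bracket (Q evenLeft) (Q (oddProj x))
      + D.form (D.bracket (Q evenLeft) (Q (oddProj x))) (Q (oddProj y)) • Q evenRight := by
  have ml := h.map_mem 0 _ evenLeft_mem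
  have mr := h.map_mem 0 _ evenRight_mem
  have mx := h.map_mem 1 _ (oddProj_mem x)
  have my := h.map_mem 1 _ (oddProj_mem y)
  have h1 : D.bracket (Q evenRight) (Q evenLeft) = 0 := by
    rw [D.bracket_even_comm ml mr, h.bracket_even_even hV, neg_zero]
  conv_lhs => rw [eq_even_add_odd x, eq_even_add_odd y]
  simp only [map_add, map_smul, LinearMap.add_apply, LinearMap.smul_apply,
    h.bracket_odd_odd hV mx my, D.bracket_even_comm ml mx, D.bracket_even_comm mr mx,
    D.bracket_even_self ml, D.bracket_even_self mr, h.bracket_even_even hV, h1,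
    hr _ (oddProj_mem x), hr _ (oddProj_mem y)]
  simp only [LinearMap.zero_apply, map_zero]
  module

theorem id (H : Matrix (Fin 2) (Fin 2) ℝ) (α β γ : ℝ) :
    (tripleDouble H α β γ).IsFrame LinearMap.id :=
  ⟨fun _ _ hx => hx, fun _ _ => rfl⟩

/-- A frame whose second even vector is central and on which the first even vector acts as `b₁`
does is an isomorphism with the superdouble of `(C|N^{α,β,γ})`. -/
theorem exists_isIsoMap (h : D.IsFrame Q) (hV : finrank ℝ V = 6)
    (hr : ∀ x ∈ triplePart 1, D.bracket (Q evenRight) (Q x) = 0)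
    {H : Matrix (Fin 2) (Fin 2) ℝ} {α β γ : ℝ}
    (hl : ∀ x ∈ triplePart 1,
      D.bracket (Q evenLeft) (Q x) = Q (tripleBracket H α β γ evenLeft x)) :
    ∃ P : TripleSpace ≃ₗ[ℝ] V, (tripleDouble H α β γ).IsIsoMap D P ∧
      (P : TripleSpace →ₗ[ℝ] V) = Q := by
  refine ⟨LinearEquiv.ofBijective Q ⟨h.injective, h.surjective hV⟩,
    ⟨fun i x => h.mem_iff i x, fun x y => ?_, fun x y => h.map_form x y⟩, rfl⟩
  -- The standard superdouble obeys the same formula in its identity frame, so the brackets agree as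
  -- soon as the two operators do.
  have key := (IsFrame.id H α β γ).bracket_eq finrank_tripleSpace
    (fun x _ => tripleBracket_evenRight H α β γ x) x y
  simp only [LinearMap.id_apply] at key
  change Q ((tripleDouble H α β γ).bracket x y) = D.bracket (Q x) (Q y)
  rw [h.bracket_eq hV hr, key, hl _ (oddProj_mem x), hl _ (oddProj_mem y), h.map_form]
  simp only [map_add, map_sub, map_smul]
  rfl

end IsFrame

end MetricLieSuperalgebra

theorem LieSuperalgebra.HasSuperdim.finrank_eq {V : Type*} [AddCommGroup V] [Module ℝ V]
    {L : LieSuperalgebra V} {m n : ℕ} (h : L.HasSuperdim m n) : finrank ℝ V = m + n := by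
  have := h.1
  rw [← Submodule.finrank_add_eq_of_isCompl L.isCompl, h.2.1, h.2.2]

/-! ### From a Manin supertriple to an adapted frame. -/

namespace MetricLieSuperalgebra

variable {V : Type*} [AddCommGroup V] [Module ℝ V] {D : MetricLieSuperalgebra V}

/-- `ad a` is skew for the form, and the form itself is antisymmetric on odd vectors: the two signs
cancel. -/
theorem form_odd_symm (D : MetricLieSuperalgebra V) {a u v : V} (ha : a ∈ D.part 0)
    (hu : u ∈ D.part 1) (hv : v ∈ D.part 1) :
    D.form (D.bracket a u) v = D.form (D.bracket a v) u := by
  have hav : D.bracket a v ∈ D.part 1 := by simpa using D.bracket_mem 0 1 a ha v hv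
  have h := D.supersymmetric 1 1 u hu _ hav
  rw [superSign_one_one] at h
  rw [D.form_bracket_even ha hu hv, h]
  ring

namespace IsManinSupertriple

variable {S S' : Submodule ℝ V}

/-- Both subalgebras are graded, and in the decomposition of `x` the components of the other parity
sum to a vector lying in both parts. -/
theorem exists_add (h : D.IsManinSupertriple S S') (i : ZMod 2) {x : V} (hx : x ∈ D.part i) :
    ∃ s ∈ S ⊓ D.part i, ∃ s' ∈ S' ⊓ D.part i, s + s' = x := by
  have hd := Submodule.disjoint_def.1 D.isCompl.disjoint
  obtain ⟨s, hs, s', hs', rfl⟩ := Submodule.mem_sup.1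
    (h.isCompl.sup_eq_top ▸ Submodule.mem_top : x ∈ S ⊔ S')
  rw [h.left_subalgebra.graded] at hs
  rw [h.right_subalgebra.graded] at hs'
  obtain ⟨s0, hs0, s1, hs1, rfl⟩ := Submodule.mem_sup.1 hs
  obtain ⟨t0, ht0, t1, ht1, rfl⟩ := Submodule.mem_sup.1 hs'
  have h0 : s0 + t0 ∈ D.part 0 := add_mem hs0.2 ht0.2
  have h1 : s1 + t1 ∈ D.part 1 := add_mem hs1.2 ht1.2
  have hsum : s0 + s1 + (t0 + t1) = (s0 + t0) + (s1 + t1) := by abel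
  rw [hsum] at hx ⊢
  revert i
  refine forall_zmod_two (fun hx => ⟨s0, hs0, t0, ht0, ?_⟩) fun hx => ⟨s1, hs1, t1, ht1, ?_⟩
  · rw [hd (s1 + t1) (by simpa using sub_mem hx h0) h1, add_zero]
  · rw [hd (s0 + t0) h0 (by simpa using sub_mem hx h1), zero_add]

/-- Inside each subalgebra this is isotropy; across the two it is the assumed boson-fermion
orthogonality. -/
theorem form_even_odd (h : D.IsManinSupertriple S S') {x y : V} (hx : x ∈ D.part 0)
    (hy : y ∈ D.part 1) : D.form x y = 0 := by
  obtain ⟨s, hs, s', hs', rfl⟩ := h.exists_add 0 hx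
  obtain ⟨t, ht, t', ht', rfl⟩ := h.exists_add 1 hy
  simp only [map_add, LinearMap.add_apply, h.left_isotropic.1 s hs.1 t ht.1,
    h.right_isotropic.1 s' hs'.1 t' ht'.1, h.even_odd s hs t' ht', h.swap.even_odd s' hs' t ht,
    add_zero]

theorem eq_zero_of_forall (h : D.IsManinSupertriple S S') (i : ZMod 2) {x : V}
    (hx : x ∈ S ⊓ D.part i) (h0 : ∀ y ∈ S' ⊓ D.part i, D.form x y = 0) : x = 0 := by
  have key : ∀ y ∈ D.part i, D.form x y = 0 := by
    intro y hy
    obtain ⟨s, hs, s', hs', rfl⟩ := h.exists_add i hy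
    rw [map_add, h.left_isotropic.1 x hx.1 s hs.1, h0 s' hs', add_zero]
  refine D.nondegenerate.1 x fun y => ?_
  obtain ⟨y0, hy0, y1, hy1, rfl⟩ := Submodule.mem_sup.1
    (D.isCompl.sup_eq_top ▸ Submodule.mem_top : y ∈ D.part 0 ⊔ D.part 1)
  rw [map_add]
  revert i
  refine forall_zmod_two (fun hx _ key => ?_) fun hx _ key => ?_
  · rw [key y0 hy0, h.form_even_odd hx.2 hy1, add_zero]
  · rw [key y1 hy1, D.supersymmetric 1 0 x hx.2 y0 hy0, h.form_even_odd hy0 hx.2, mul_zero,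
      add_zero]

/-- The pairing of the homogeneous components of the two subalgebras. -/
def pairing (D : MetricLieSuperalgebra V) (S S' : Submodule ℝ V) (i : ZMod 2) :
    ↥(S ⊓ D.part i) →ₗ[ℝ] Dual ℝ ↥(S' ⊓ D.part i) :=
  (D.form.domRestrict₁₂ (S ⊓ D.part i) (S' ⊓ D.part i))

theorem pairing_apply (i : ZMod 2) (x : ↥(S ⊓ D.part i)) (y : ↥(S' ⊓ D.part i)) :
    pairing D S S' i x y = D.form x y := rfl

theorem pairing_injective (h : D.IsManinSupertriple S S') (i : ZMod 2) :
    Function.Injective (pairing D S S' i) := by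
  refine (injective_iff_map_eq_zero _).2 fun x hx => Subtype.ext ?_
  exact h.eq_zero_of_forall i x.2 fun y hy => DFunLike.congr_fun hx (⟨y, hy⟩ : ↥(S' ⊓ D.part i))

/-- The pairing embeds one component in the dual of the other. With the roles exchanged this gives
equality, so the pairing is perfect. -/
theorem finrank_le (h : D.IsManinSupertriple S S') [FiniteDimensional ℝ V] (i : ZMod 2) :
    finrank ℝ ↥(S ⊓ D.part i) ≤ finrank ℝ ↥(S' ⊓ D.part i) := by
  rw [← Subspace.dual_finrank_eq (V := ↥(S' ⊓ D.part i))]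
  exact LinearMap.finrank_le_finrank_of_injective (h.pairing_injective i)

theorem finrank_add (h : D.IsManinSupertriple S S') [FiniteDimensional ℝ V] (i : ZMod 2) :
    finrank ℝ ↥(S ⊓ D.part i) + finrank ℝ ↥(S' ⊓ D.part i) = finrank ℝ (D.part i) := by
  rw [← Submodule.finrank_sup_add_finrank_inf_eq]
  have h1 : S ⊓ D.part i ⊔ S' ⊓ D.part i = D.part i := by
    refine le_antisymm (sup_le inf_le_right inf_le_right) fun x hx => ?_
    obtain ⟨s, hs, s', hs', rfl⟩ := h.exists_add i hx
    exact Submodule.add_mem_sup hs hs'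
  have h2 : S ⊓ D.part i ⊓ (S' ⊓ D.part i) = ⊥ :=
    (h.isCompl.disjoint.mono inf_le_left inf_le_left).eq_bot
  rw [h1, h2, finrank_bot, add_zero]

theorem exists_dual_bases (h : D.IsManinSupertriple S S') [FiniteDimensional ℝ V] (i : ZMod 2)
    {n : ℕ} (hn : finrank ℝ (D.part i) = 2 * n) :
    ∃ f g : Fin n → V, (∀ j, f j ∈ S ⊓ D.part i) ∧ (∀ j, g j ∈ S' ⊓ D.part i) ∧
      ∀ j k, D.form (f j) (g k) = if j = k then 1 else 0 := by
  have h1 := h.finrank_le i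
  have h2 := h.swap.finrank_le i
  have h3 := h.finrank_add i
  have hS' : finrank ℝ ↥(S' ⊓ D.part i) = n := by omega
  let g := finBasisOfFinrankEq ℝ ↥(S' ⊓ D.part i) hS'
  have hsurj : Function.Surjective (pairing D S S' i) :=
    (LinearMap.injective_iff_surjective_of_finrank_eq_finrank
      (by rw [Subspace.dual_finrank_eq]; omega)).1 (h.pairing_injective i)
  -- Preimages of the coordinate functionals of `g` form the dual family.
  choose f hf using fun j => hsurj (g.coord j)
  refine ⟨fun j => f j, fun j => g j, fun j => (f j).2, fun j => (g j).2, fun j k => ?_⟩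
  rw [← pairing_apply, hf, Basis.coord_apply, Basis.repr_self, Finsupp.single_apply]
  simp only [eq_comm]

theorem exists_frame (h : D.IsManinSupertriple S S') (hD : D.HasSuperdim 2 4) :
    ∃ Q : TripleSpace →ₗ[ℝ] V, D.IsFrame Q ∧ (∀ x ∈ tripleLeft, Q x ∈ S) ∧
      ∀ x ∈ tripleRight, Q x ∈ S' := by
  have := hD.1
  obtain ⟨b, b', hb, hb', hbb⟩ := h.exists_dual_bases 0 (n := 1) hD.2.1
  obtain ⟨f, g, hf, hg, hfg⟩ := h.exists_dual_bases 1 (n := 2) hD.2.2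
  have hb := hb 0
  have hb' := hb' 0
  have hbb : D.form (b 0) (b' 0) = 1 := by simpa using hbb 0 0
  generalize b 0 = b at *
  generalize b' 0 = b' at *
  have hbb' : D.form b' b = 1 := by
    rw [D.supersymmetric 0 0 b' hb'.2 b hb.2, superSign_zero_left, hbb, one_mul]
  have hgf : ∀ j k, D.form (g j) (f k) = -(if k = j then 1 else 0) := fun j k => by
    rw [D.supersymmetric 1 1 _ (hg j).2 _ (hf k).2, superSign_one_one, hfg, neg_one_mul]
  let Q : TripleSpace →ₗ[ℝ] V :=
    { toFun := fun x => x.1.1 • b + (x.1.2 0 • f 0 + x.1.2 1 • f 1) +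
        (x.2.1 • b' + (x.2.2 0 • g 0 + x.2.2 1 • g 1))
      map_add' := fun x y => by
        simp only [Prod.fst_add, Prod.snd_add, Pi.add_apply]
        module
      map_smul' := fun c x => by
        simp only [Prod.smul_fst, Prod.smul_snd, Pi.smul_apply, smul_eq_mul, RingHom.id_apply]
        module }
  have hQ : ∀ x, Q x = x.1.1 • b + (x.1.2 0 • f 0 + x.1.2 1 • f 1) +
    (x.2.1 • b' + (x.2.2 0 • g 0 + x.2.2 1 • g 1)) := fun _ => rfl
  refine ⟨Q, ⟨forall_zmod_two (fun x hx => ?_) fun x hx => ?_, fun x y => ?_⟩, fun x hx => ?_,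
    fun x hx => ?_⟩
  · rw [mem_triplePart_zero] at hx
    rw [hQ, hx.1, hx.2]
    simpa using add_mem ((D.part 0).smul_mem x.1.1 hb.2) ((D.part 0).smul_mem x.2.1 hb'.2)
  · rw [mem_triplePart_one] at hx
    rw [hQ, hx.1, hx.2, zero_smul, zero_smul, zero_add, zero_add]
    exact add_mem (add_mem ((D.part 1).smul_mem _ (hf 0).2) ((D.part 1).smul_mem _ (hf 1).2))
      (add_mem ((D.part 1).smul_mem _ (hg 0).2) ((D.part 1).smul_mem _ (hg 1).2))
  · have z1 := h.left_isotropic.1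
    have z2 := h.right_isotropic.1
    simp only [hQ, map_add, map_smul, LinearMap.add_apply, LinearMap.smul_apply, smul_eq_mul,
      hbb, hbb', hfg, hgf, z1 b hb.1 b hb.1, z2 b' hb'.1 b' hb'.1,
      fun j => z1 b hb.1 (f j) (hf j).1, fun j => z1 (f j) (hf j).1 b hb.1,
      fun j => z2 b' hb'.1 (g j) (hg j).1, fun j => z2 (g j) (hg j).1 b' hb'.1,
      fun j k => z1 (f j) (hf j).1 (f k) (hf k).1, fun j k => z2 (g j) (hg j).1 (g k) (hg k).1,
      fun j => h.even_odd b hb (g j) (hg j), fun j => h.odd_even (f j) (hf j) b' hb',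
      fun j => h.swap.even_odd b' hb' (f j) (hf j), fun j => h.swap.odd_even (g j) (hg j) b hb,
      tripleForm_apply, dotProduct, Fin.sum_univ_two]
    simp
    ring
  · have hx : x.2 = 0 := hx
    rw [hQ, hx]
    simpa using add_mem (S.smul_mem x.1.1 hb.1)
      (add_mem (S.smul_mem (x.1.2 0) (hf 0).1) (S.smul_mem (x.1.2 1) (hf 1).1))
  · have hx : x.1 = 0 := hx
    rw [hQ, hx]
    simpa using add_mem (S'.smul_mem x.2.1 hb'.1)
      (add_mem (S'.smul_mem (x.2.2 0) (hg 0).1) (S'.smul_mem (x.2.2 1) (hg 1).1))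

end IsManinSupertriple

/-! ### One of the two even vectors is central. -/

/-- The product of two nonzero quadratic forms is nonzero. -/
theorem quadratic_dichotomy {W : Submodule ℝ V} (B C : V →ₗ[ℝ] V →ₗ[ℝ] ℝ)
    (hB : ∀ u ∈ W, ∀ v ∈ W, B u v = B v u) (hC : ∀ u ∈ W, ∀ v ∈ W, C u v = C v u)
    (h : ∀ u ∈ W, B u u * C u u = 0) :
    (∀ u ∈ W, B u u = 0) ∨ ∀ u ∈ W, C u u = 0 := by
  by_contra! hne
  obtain ⟨⟨u, hu, hBu⟩, v, hv, hCv⟩ := hne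
  have hCu := (mul_eq_zero.1 (h u hu)).resolve_left hBu
  have hBv := (mul_eq_zero.1 (h v hv)).resolve_right hCv
  -- On the line `u + t v` the product is `t` times two nonzero affine functions of `t`, because `C
  -- u u = B v v = 0`. Each has at most one root, so `t = 1, 2, 3` is one value too many.
  have key : ∀ t : ℝ, t = 0 ∨ B u u + t * (2 * B u v) = 0 ∨ 2 * C u v + t * C v v = 0 := by
    intro t
    have := h (u + t • v) (add_mem hu (W.smul_mem t hv))
    simp only [map_add, map_smul, LinearMap.add_apply, LinearMap.smul_apply, smul_eq_mul, hCu,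
      hBv, hB v hv u hu, hC v hv u hu] at this
    have h2 : t * ((B u u + t * (2 * B u v)) * (2 * C u v + t * C v v)) = 0 := by
      linear_combination this
    simpa using h2
  generalize B u u = a at *
  generalize C v v = c at *
  generalize B u v = m at *
  generalize C u v = n at *
  rcases key 1 with h1 | h1 | h1 <;> rcases key 2 with h2 | h2 | h2 <;>
    rcases key 3 with h3 | h3 | h3 <;>
    first
    | linarith
    | exact hBu (by linarith)
    | exact hCv (by linarith)

namespace IsFrame

variable {Q : TripleSpace →ₗ[ℝ] V}

/-- Polarising the symmetric form `⟨[a, u], v⟩` kills it on odd vectors. As `[a, u]` is odd, it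
pairs only with odd components, and nondegeneracy applies. -/
theorem ad_eq_zero_of_quadratic (hV : finrank ℝ V = 6) (hQ : D.IsFrame Q) {a : V}
    (ha : a ∈ D.part 0) (h : ∀ u ∈ D.part 1, D.form (D.bracket a u) u = 0) :
    ∀ u ∈ D.part 1, D.bracket a u = 0 := by
  intro u hu
  have hau : D.bracket a u ∈ D.part 1 := by simpa using D.bracket_mem 0 1 a ha u hu
  refine D.nondegenerate.1 _ fun v => ?_
  obtain ⟨x, rfl⟩ := hQ.surjective hV v
  obtain ⟨y, hy⟩ := hQ.surjective hV (D.bracket a u)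
  have hy1 : y ∈ triplePart 1 := (hQ.mem_iff 1 y).1 (hy ▸ hau)
  have h1 : D.form (D.bracket a u) (Q x) = D.form (D.bracket a u) (Q (oddProj x)) := by
    rw [← hy, hQ.map_form, hQ.map_form, tripleForm_oddProj hy1]
  have hx := hQ.map_mem 1 _ (oddProj_mem x)
  rw [h1]
  have h2 := h _ (add_mem hu hx)
  simp only [map_add, LinearMap.add_apply, h _ hu, h _ hx, D.form_odd_symm ha hx hu] at h2
  linarith

theorem ad_eq_zero_or (hV : finrank ℝ V = 6) (hQ : D.IsFrame Q) :
    (∀ u ∈ D.part 1, D.bracket (Q evenLeft) u = 0) ∨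
      ∀ u ∈ D.part 1, D.bracket (Q evenRight) u = 0 := by
  have ml := hQ.map_mem 0 _ evenLeft_mem
  have mr := hQ.map_mem 0 _ evenRight_mem
  refine (quadratic_dichotomy (W := D.part 1) (D.form.comp (D.bracket (Q evenLeft)))
    (D.form.comp (D.bracket (Q evenRight))) (fun u hu v hv => D.form_odd_symm ml hu hv)
    (fun u hu v hv => D.form_odd_symm mr hu hv) fun u hu => ?_).imp
    (hQ.ad_eq_zero_of_quadratic hV ml) (hQ.ad_eq_zero_of_quadratic hV mr)
  -- For three equal odd vectors Jacobi reads `3 [u, [u, u]] = 0`. Expanding `[u, u]` in the even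
  -- frame and pairing with `u` leaves `-2` times the product of the two quadratic forms.
  have hj := D.jacobi 1 1 1 u hu u hu u hu
  have h3 : D.bracket u (D.bracket u u) = 0 := by
    rw [superSign_one_one] at hj
    have : (-3 : ℝ) • D.bracket u (D.bracket u u) = 0 := by
      rw [← hj]
      module
    exact (smul_eq_zero.1 this).resolve_left (by norm_num)
  have h4 : D.form (D.bracket u (D.bracket u u)) u = 0 := by
    rw [h3, map_zero, LinearMap.zero_apply]
  rw [hQ.bracket_odd_odd hV hu hu, map_add, map_smul, map_smul, D.bracket_even_comm ml hu,
    D.bracket_even_comm mr hu] at h4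
  simp only [map_add, map_smul, map_neg, LinearMap.add_apply, LinearMap.smul_apply,
    LinearMap.neg_apply, smul_eq_mul] at h4
  simp only [LinearMap.comp_apply]
  linarith

end IsFrame

/-! ### Every supertriple is standard up to duality. -/

namespace IsManinSupertriple

variable {S S' : Submodule ℝ V}

/-- The parameters are the entries of the symmetric form of `X = ad (Q evenLeft)`: `H` pairs `S`
with `S'`, and `α, β, γ` form the block of `S'`. The block of `S` vanishes because `S` is an
isotropic subalgebra containing `Q evenLeft`. -/
theorem isTriple_of_frame (h : D.IsManinSupertriple S S') (hV : finrank ℝ V = 6)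
    {Q : TripleSpace →ₗ[ℝ] V} (hQ : D.IsFrame Q) (hS : ∀ x ∈ tripleLeft, Q x ∈ S)
    (hS' : ∀ x ∈ tripleRight, Q x ∈ S')
    (hr : ∀ u ∈ D.part 1, D.bracket (Q evenRight) u = 0) :
    ∃ H α β γ, IsTriple D S S' H α β γ := by
  have ml := hQ.map_mem 0 _ evenLeft_mem
  let F : Fin 2 → TripleSpace := fun j => ((0, Pi.single j 1), (0, 0))
  let G : Fin 2 → TripleSpace := fun j => ((0, 0), (0, Pi.single j 1))
  have hF : ∀ j, Q (F j) ∈ D.part 1 := fun j =>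
    hQ.map_mem 1 _ (by simp [F, mem_triplePart_one])
  have hG : ∀ j, Q (G j) ∈ D.part 1 := fun j =>
    hQ.map_mem 1 _ (by simp [G, mem_triplePart_one])
  have hFS : ∀ j, Q (F j) ∈ S := fun j => hS _ rfl
  have hlS : Q evenLeft ∈ S := hS _ rfl
  let X := D.bracket (Q evenLeft)
  have hXFF : ∀ j k, D.form (X (Q (F j))) (Q (F k)) = 0 := fun j k =>
    h.left_isotropic.1 _ (h.left_subalgebra.bracket_mem _ hlS _ (hFS j)) _ (hFS k)
  have hXGF : ∀ j k, D.form (X (Q (G j))) (Q (F k)) = D.form (X (Q (F k))) (Q (G j)) :=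
    fun j k => D.form_odd_symm ml (hG j) (hF k)
  have hXGG : D.form (X (Q (G 1))) (Q (G 0)) = D.form (X (Q (G 0))) (Q (G 1)) :=
    D.form_odd_symm ml (hG 1) (hG 0)
  have hodd : ∀ x ∈ triplePart 1,
      x = x.1.2 0 • F 0 + x.1.2 1 • F 1 + (x.2.2 0 • G 0 + x.2.2 1 • G 1) := by
    intro x hx
    rw [mem_triplePart_one] at hx
    refine Prod.ext (Prod.ext ?_ (funext fun k => ?_)) (Prod.ext ?_ (funext fun k => ?_)) <;>
      [skip; fin_cases k; skip; fin_cases k] <;> simp [F, G, hx]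
  obtain ⟨P, hP, hPQ⟩ := hQ.exists_isIsoMap hV (fun x hx => hr _ (hQ.map_mem 1 x hx))
    (H := Matrix.of fun j k => D.form (X (Q (F j))) (Q (G k)))
    (α := D.form (X (Q (G 0))) (Q (G 0))) (β := D.form (X (Q (G 0))) (Q (G 1)))
    (γ := D.form (X (Q (G 1))) (Q (G 1))) (by
      intro x hx
      obtain ⟨y, hy⟩ := hQ.surjective hV (D.bracket (Q evenLeft) (Q x))
      have hy1 : y ∈ triplePart 1 := by
        rw [← hQ.mem_iff, hy]
        simpa using D.bracket_mem 0 1 _ ml _ (hQ.map_mem 1 x hx)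
      rw [← hy]
      congr 1
      rw [← sub_eq_zero]
      -- Odd vectors are compared through their products with odd vectors, which reduces the claim
      -- to the entries above.
      refine (tripleDouble 0 0 0 0).nondegenerate.1 _ fun z => ?_
      change tripleForm _ z = 0
      rw [← tripleForm_oddProj (sub_mem hy1 (tripleBracket_evenLeft_mem _ _ _ _ x)), map_sub,
        LinearMap.sub_apply, ← hQ.map_form, hy, sub_eq_zero]
      change D.form (X (Q x)) _ = _
      have ho := oddProj_mem z
      generalize oddProj z = z at ho
      conv_lhs => rw [hodd x hx, hodd z ho]
      simp only [map_add, map_smul, LinearMap.add_apply, LinearMap.smul_apply, smul_eq_mul, hXFF,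
        hXGF, hXGG]
      rw [tripleBracket_evenLeft, tripleForm_apply]
      simp only [Matrix.vecMul, Matrix.mulVec, dotProduct, Fin.sum_univ_two, Pi.add_apply,
        Pi.neg_apply, matN, Matrix.of_apply, Matrix.cons_val_zero, Matrix.cons_val_one,
        Matrix.cons_val']
      ring)
  refine ⟨_, _, _, _, TripleIsomorphic.symm ⟨P, hP, ?_, ?_⟩⟩
  · rw [hPQ]
    refine le_antisymm (Submodule.map_le_iff_le_comap.2 hS) fun v hv => ?_
    obtain ⟨x, rfl⟩ := hQ.surjective hV v
    have h1 : Q x = Q (x.1, 0) + Q (0, x.2) := by rw [← map_add]; simp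
    have hl : (x.1, 0) ∈ tripleLeft := rfl
    have h0 : Q (0, x.2) = 0 := by
      refine Submodule.disjoint_def.1 h.isCompl.disjoint _ ?_ (hS' _ rfl)
      rw [eq_sub_of_add_eq' h1.symm]
      exact sub_mem hv (hS _ hl)
    rw [h1, h0, add_zero]
    exact Submodule.mem_map_of_mem hl
  · rw [hPQ]
    refine le_antisymm (Submodule.map_le_iff_le_comap.2 hS') fun v hv => ?_
    obtain ⟨x, rfl⟩ := hQ.surjective hV v
    have h1 : Q x = Q (x.1, 0) + Q (0, x.2) := by rw [← map_add]; simp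
    have hl : (0, x.2) ∈ tripleRight := rfl
    have h0 : Q (x.1, 0) = 0 := by
      refine Submodule.disjoint_def.1 h.isCompl.disjoint _ (hS _ rfl) ?_
      rw [eq_sub_of_add_eq h1.symm]
      exact sub_mem hv (hS' _ hl)
    rw [h1, h0, zero_add]
    exact Submodule.mem_map_of_mem hl

theorem isTriple_of_central (h : D.IsManinSupertriple S S') (hD : D.HasSuperdim 2 4)
    (hc : ∀ w ∈ S' ⊓ D.part 0, ∀ u ∈ D.part 1, D.bracket w u = 0) :
    ∃ H α β γ, IsTriple D S S' H α β γ := by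
  obtain ⟨Q, hQ, hS, hS'⟩ := h.exists_frame hD
  exact h.isTriple_of_frame (LieSuperalgebra.HasSuperdim.finrank_eq hD) hQ hS hS'
    (hc _ ⟨hS' _ rfl, hQ.map_mem 0 _ evenRight_mem⟩)

/-- Every Manin supertriple of superdimension `(2, 4)` is some `(C|N^{α,β,γ})` or a dual of it. -/
theorem exists_isTriple_or_isDualTriple (h : D.IsManinSupertriple S S')
    (hD : D.HasSuperdim 2 4) :
    ∃ H α β γ, IsTriple D S S' H α β γ ∨ IsDualTriple D S S' H α β γ := by
  obtain ⟨Q, hQ, hS, hS'⟩ := h.exists_frame hD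
  have hV := LieSuperalgebra.HasSuperdim.finrank_eq hD
  rcases hQ.ad_eq_zero_or hV with h0 | h0
  -- Exchanging `S` and `S'` requires a new frame, since the form changes sign on odd vectors. By
  -- isotropy every even vector of `S` is a multiple of `Q evenLeft`, so the new second even vector
  -- is central.
  · obtain ⟨H, α, β, γ, ht⟩ := h.swap.isTriple_of_central hD fun w hw u hu => by
      rw [hQ.even_eq hV hw.2, h.left_isotropic.1 w hw.1 _ (hS evenLeft rfl)]
      simp [h0 u hu]
    exact ⟨H, α, β, γ, Or.inr ht.swap⟩
  · obtain ⟨H, α, β, γ, ht⟩ := h.isTriple_of_frame hV hQ hS hS' h0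
    exact ⟨H, α, β, γ, Or.inl ht⟩

end IsManinSupertriple

end MetricLieSuperalgebra

open MetricLieSuperalgebra

/-! ### Symplectic block maps and the isomorphisms they define. -/

open Matrix in
/-- The linear endomorphism of the standard space with the given blocks. -/
noncomputable def blockMap (s : ℝ) (K L M N : Matrix (Fin 2) (Fin 2) ℝ) :
    TripleSpace →ₗ[ℝ] TripleSpace where
  toFun x := ((s * x.1.1, x.1.2 ᵥ* K + x.2.2 ᵥ* L), (s⁻¹ * x.2.1, M *ᵥ x.2.2 + N *ᵥ x.1.2))
  map_add' x y := by
    refine Prod.ext (Prod.ext ?_ ?_) (Prod.ext ?_ ?_) <;>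
      simp only [Prod.fst_add, Prod.snd_add, add_vecMul, mulVec_add, mul_add] <;> abel
  map_smul' t x := by
    refine Prod.ext (Prod.ext ?_ ?_) (Prod.ext ?_ ?_) <;>
      simp only [Prod.smul_fst, Prod.smul_snd, smul_vecMul, mulVec_smul, smul_add,
        mul_left_comm, smul_eq_mul, RingHom.id_apply]

open Matrix in
theorem blockMap_apply (s : ℝ) (K L M N : Matrix (Fin 2) (Fin 2) ℝ) (x : TripleSpace) :
    blockMap s K L M N x =
      ((s * x.1.1, x.1.2 ᵥ* K + x.2.2 ᵥ* L), (s⁻¹ * x.2.1, M *ᵥ x.2.2 + N *ᵥ x.1.2)) := rfl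

open Matrix in
theorem vecMul_two (u : Fin 2 → ℝ) (M : Matrix (Fin 2) (Fin 2) ℝ) (k : Fin 2) :
    (u ᵥ* M) k = u 0 * M 0 k + u 1 * M 1 k := by
  simp only [vecMul, dotProduct, Fin.sum_univ_two]

open Matrix in
theorem mulVec_two (u : Fin 2 → ℝ) (M : Matrix (Fin 2) (Fin 2) ℝ) (k : Fin 2) :
    (M *ᵥ u) k = M k 0 * u 0 + M k 1 * u 1 := by
  simp only [mulVec, dotProduct, Fin.sum_univ_two]

open Matrix in
-- The hypothesis `h` says that the odd block is symplectic; on the even plane `s` and `s⁻¹` cancel.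
theorem isFrame_blockMap {H : Matrix (Fin 2) (Fin 2) ℝ} {α β γ s : ℝ}
    {K L M N : Matrix (Fin 2) (Fin 2) ℝ} (hs : s ≠ 0)
    (h : ∀ u w u' w' : Fin 2 → ℝ, (u ᵥ* K + w ᵥ* L) ⬝ᵥ (M *ᵥ w' + N *ᵥ u')
      - (M *ᵥ w + N *ᵥ u) ⬝ᵥ (u' ᵥ* K + w' ᵥ* L) = u ⬝ᵥ w' - w ⬝ᵥ u') :
    (tripleDouble H α β γ).IsFrame (blockMap s K L M N) := by
  refine ⟨forall_zmod_two (fun x hx => ?_) fun x hx => ?_, fun x y => ?_⟩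
  · rw [mem_triplePart_zero] at hx
    change _ ∈ triplePart 0
    rw [mem_triplePart_zero, blockMap_apply]
    simp [hx]
  · rw [mem_triplePart_one] at hx
    change _ ∈ triplePart 1
    rw [mem_triplePart_one, blockMap_apply]
    simp [hx]
  · change tripleForm _ _ = _
    rw [tripleForm_apply, tripleForm_apply]
    simp only [blockMap_apply]
    linear_combination h x.1.2 x.2.2 y.1.2 y.2.2
      + (x.1.1 * y.2.1 + x.2.1 * y.1.1) * mul_inv_cancel₀ hs

open Matrix in
-- The hypotheses `hl` and `hr` are the two components of the intertwining relation between the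
-- operators `ad b₁`, with factor `s`.
theorem exists_isIsoMap_blockMap {H H' : Matrix (Fin 2) (Fin 2) ℝ} {α β γ α' β' γ' s : ℝ}
    {K L M N : Matrix (Fin 2) (Fin 2) ℝ} (hs : s ≠ 0)
    (h : ∀ u w u' w' : Fin 2 → ℝ, (u ᵥ* K + w ᵥ* L) ⬝ᵥ (M *ᵥ w' + N *ᵥ u')
      - (M *ᵥ w + N *ᵥ u) ⬝ᵥ (u' ᵥ* K + w' ᵥ* L) = u ⬝ᵥ w' - w ⬝ᵥ u')
    (hl : ∀ u w : Fin 2 → ℝ, s • ((u ᵥ* K + w ᵥ* L) ᵥ* H + (M *ᵥ w + N *ᵥ u) ᵥ* matN α β γ) =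
      (u ᵥ* H' + w ᵥ* matN α' β' γ') ᵥ* K - (H' *ᵥ w) ᵥ* L)
    (hr : ∀ u w : Fin 2 → ℝ, s • (H *ᵥ (M *ᵥ w + N *ᵥ u)) =
      M *ᵥ (H' *ᵥ w) - N *ᵥ (u ᵥ* H' + w ᵥ* matN α' β' γ')) :
    ∃ P : TripleSpace ≃ₗ[ℝ] TripleSpace,
      (tripleDouble H' α' β' γ').IsIsoMap (tripleDouble H α β γ) P ∧
      (P : TripleSpace →ₗ[ℝ] TripleSpace) = blockMap s K L M N := by
  refine (isFrame_blockMap hs h).exists_isIsoMap finrank_tripleSpace (fun x _ => ?_)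
    (fun x _ => ?_)
  · have : blockMap s K L M N evenRight = s⁻¹ • evenRight := by
      rw [blockMap_apply]
      simp [evenRight]
    change tripleBracket H α β γ _ _ = 0
    rw [this, map_smul, LinearMap.smul_apply, tripleBracket_evenRight, smul_zero]
  · have : blockMap s K L M N evenLeft = s • evenLeft := by
      rw [blockMap_apply]
      simp [evenLeft]
    change tripleBracket H α β γ _ _ = _
    rw [this, map_smul, LinearMap.smul_apply, tripleBracket_evenLeft, tripleBracket_evenLeft]
    simp only [blockMap_apply]
    refine Prod.ext (Prod.ext ?_ ?_) (Prod.ext ?_ ?_)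
    · simp
    · simpa only [Prod.smul_fst, Prod.smul_snd, neg_vecMul, sub_eq_add_neg] using
        hl x.1.2 x.2.2
    · simp
    · simp only [Prod.smul_snd, smul_neg, hr, mulVec_neg]
      abel

/-- The change of basis of `C` with matrix `!![a, b; c, d]⁻¹` and the scaling of `b₁` by `s`
transform `(C|N^{α,β,γ})` into `(C'|N^{α',β',γ'})`. -/
structure TripleChange (H : Matrix (Fin 2) (Fin 2) ℝ) (α β γ : ℝ)
    (H' : Matrix (Fin 2) (Fin 2) ℝ) (α' β' γ' : ℝ) (s a b c d : ℝ) : Prop where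
  scale_ne : s ≠ 0
  det_ne : a * d - b * c ≠ 0
  h00 : a * H' 0 0 + b * H' 1 0 = s * (H 0 0 * a + H 0 1 * c)
  h01 : a * H' 0 1 + b * H' 1 1 = s * (H 0 0 * b + H 0 1 * d)
  h10 : c * H' 0 0 + d * H' 1 0 = s * (H 1 0 * a + H 1 1 * c)
  h11 : c * H' 0 1 + d * H' 1 1 = s * (H 1 0 * b + H 1 1 * d)
  hα : α' = s * (a ^ 2 * α + 2 * (a * c) * β + c ^ 2 * γ)
  hβ : β' = s * (a * b * α + (a * d + b * c) * β + c * d * γ)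
  hγ : γ' = s * (b ^ 2 * α + 2 * (b * d) * β + d ^ 2 * γ)

/-- The Manin supertriples `(C|N^{α,β,γ})` and `(C'|N^{α',β',γ'})` are isomorphic. -/
def TripleRel (H : Matrix (Fin 2) (Fin 2) ℝ) (α β γ : ℝ)
    (H' : Matrix (Fin 2) (Fin 2) ℝ) (α' β' γ' : ℝ) : Prop :=
  (tripleDouble H α β γ).TripleIsomorphic tripleLeft tripleRight
    (tripleDouble H' α' β' γ') tripleLeft tripleRight

/-- The superdoubles of `(C|N^{α,β,γ})` and `(C'|N^{α',β',γ'})` are isomorphic. -/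
def DoubleRel (H : Matrix (Fin 2) (Fin 2) ℝ) (α β γ : ℝ)
    (H' : Matrix (Fin 2) (Fin 2) ℝ) (α' β' γ' : ℝ) : Prop :=
  (tripleDouble H α β γ).Isomorphic (tripleDouble H' α' β' γ')

section

variable {H H' H'' : Matrix (Fin 2) (Fin 2) ℝ} {α β γ α' β' γ' α'' β'' γ'' s a b c d : ℝ}

theorem TripleRel.doubleRel (h : TripleRel H α β γ H' α' β' γ') :
    DoubleRel H α β γ H' α' β' γ' :=
  h.isomorphic

theorem TripleRel.symm (h : TripleRel H α β γ H' α' β' γ') : TripleRel H' α' β' γ' H α β γ :=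
  TripleIsomorphic.symm h

theorem TripleRel.trans (h : TripleRel H α β γ H' α' β' γ')
    (h' : TripleRel H' α' β' γ' H'' α'' β'' γ'') : TripleRel H α β γ H'' α'' β'' γ'' :=
  TripleIsomorphic.trans h h'

theorem DoubleRel.refl : DoubleRel H α β γ H α β γ := Isomorphic.refl _

theorem DoubleRel.symm (h : DoubleRel H α β γ H' α' β' γ') : DoubleRel H' α' β' γ' H α β γ :=
  Isomorphic.symm h

theorem DoubleRel.trans (h : DoubleRel H α β γ H' α' β' γ')
    (h' : DoubleRel H' α' β' γ' H'' α'' β'' γ'') : DoubleRel H α β γ H'' α'' β'' γ'' :=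
  Isomorphic.trans h h'

open Matrix in
-- The form is preserved when `f` and `f̃` transform contragrediently, by `A⁻¹` and `A`. The
-- equations of the change are `A H' = s H A` and `G' = s Aᵀ G A`, which is what this block-diagonal
-- map, going from the primed triple to the unprimed one, needs to intertwine `ad b₁`.
theorem TripleChange.tripleRel (h : TripleChange H α β γ H' α' β' γ' s a b c d) :
    TripleRel H α β γ H' α' β' γ' := by
  set A : Matrix (Fin 2) (Fin 2) ℝ := !![a, b; c, d] with hA
  have hH : A * H' = s • (H * A) := by
    ext i j
    fin_cases i <;> fin_cases j <;>
      simp only [hA, Matrix.mul_apply, Fin.sum_univ_two, Matrix.smul_apply, smul_eq_mul] <;>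
      [exact h.h00; exact h.h01; exact h.h10; exact h.h11]
  have hG : matN α' β' γ' = s • (Aᵀ * matN α β γ * A) := by
    ext i j
    simp only [Matrix.mul_apply, Fin.sum_univ_two, Matrix.smul_apply, smul_eq_mul,
      Matrix.transpose_apply]
    fin_cases i <;> fin_cases j
    · refine h.hα.trans ?_
      simp only [hA, matN, Matrix.of_apply, Fin.zero_eta, Matrix.cons_val_zero,
        Matrix.cons_val_one, Matrix.cons_val']
      ring
    · refine h.hβ.trans ?_
      simp only [hA, matN, Matrix.of_apply, Fin.zero_eta, Fin.mk_one, Matrix.cons_val_zero,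
        Matrix.cons_val_one, Matrix.cons_val']
      ring
    · refine h.hβ.trans ?_
      simp only [hA, matN, Matrix.of_apply, Fin.zero_eta, Fin.mk_one, Matrix.cons_val_zero,
        Matrix.cons_val_one, Matrix.cons_val']
      ring
    · refine h.hγ.trans ?_
      simp only [hA, matN, Matrix.of_apply, Fin.mk_one, Matrix.cons_val_zero,
        Matrix.cons_val_one, Matrix.cons_val']
      ring
  have hdet : IsUnit A.det := by
    rw [hA, det_fin_two_of]
    exact h.det_ne.isUnit
  have hi : A⁻¹ * A = 1 := nonsing_inv_mul A hdet
  have hi' : A * A⁻¹ = 1 := mul_nonsing_inv A hdet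
  have hH' : s • (A⁻¹ * H) = H' * A⁻¹ := by
    calc s • (A⁻¹ * H) = s • (A⁻¹ * (H * (A * A⁻¹))) := by rw [hi', Matrix.mul_one]
      _ = A⁻¹ * (s • (H * A)) * A⁻¹ := by
        simp only [Matrix.mul_smul, Matrix.smul_mul, Matrix.mul_assoc]
      _ = _ := by rw [← hH, ← Matrix.mul_assoc A⁻¹, hi, Matrix.one_mul]
  have hG' : s • (Aᵀ * matN α β γ) = matN α' β' γ' * A⁻¹ := by
    rw [hG, Matrix.smul_mul, Matrix.mul_assoc, hi', Matrix.mul_one]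
  obtain ⟨P, hP, hPQ⟩ := exists_isIsoMap_blockMap (H := H) (H' := H') (α := α) (β := β) (γ := γ)
    (α' := α') (β' := β') (γ' := γ') (K := A⁻¹) (L := 0) (M := A) (N := 0) h.scale_ne
    (fun u w u' w' => by
      simp only [vecMul_zero, zero_mulVec, add_zero, ← dotProduct_mulVec, mulVec_mulVec, hi,
        one_mulVec]
      rw [dotProduct_comm (A *ᵥ w), ← dotProduct_mulVec, mulVec_mulVec, hi, one_mulVec,
        dotProduct_comm w])
    (fun u w => by
      simp only [vecMul_zero, zero_mulVec, add_zero, sub_zero, add_vecMul, vecMul_vecMul, ← hH',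
        ← hG', smul_add, vecMul_smul]
      rw [← vecMul_transpose, vecMul_vecMul])
    (fun u w => by
      simp only [zero_mulVec, add_zero, sub_zero, mulVec_mulVec, hH, ← smul_mulVec])
  refine TripleIsomorphic.symm ⟨P, hP, ?_, ?_⟩
  · rw [hPQ]
    refine le_antisymm ?_ fun x hx => ?_
    · rintro _ ⟨x, hx, rfl⟩
      have hx : x.2 = 0 := hx
      change (blockMap s A⁻¹ 0 A 0 x).2 = 0
      simp [blockMap_apply, hx]
    · have hx : x.2 = 0 := hx
      refine ⟨((s⁻¹ * x.1.1, x.1.2 ᵥ* A), 0), rfl, ?_⟩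
      refine Prod.ext (Prod.ext ?_ ?_) ?_ <;>
        simp [blockMap_apply, h.scale_ne, hi', hx]
  · rw [hPQ]
    refine le_antisymm ?_ fun x hx => ?_
    · rintro _ ⟨x, hx, rfl⟩
      have hx : x.1 = 0 := hx
      change (blockMap s A⁻¹ 0 A 0 x).1 = 0
      simp [blockMap_apply, hx]
    · have hx : x.1 = 0 := hx
      refine ⟨(0, (s * x.2.1, A⁻¹ *ᵥ x.2.2)), rfl, ?_⟩
      refine Prod.ext ?_ (Prod.ext ?_ ?_) <;>
        simp only [blockMap_apply, hx, mulVec_mulVec, hi', one_mulVec, zero_mulVec, add_zero,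
          Prod.fst_zero, Prod.snd_zero, zero_vecMul, mul_zero, vecMul_zero,
          inv_mul_cancel_left₀ h.scale_ne]
      rfl

open Matrix in
-- The vector `b₁`, being even and in `C`, is only rescaled; `A` is the action on the odd part of
-- `N`. The `f̃`-components of `[b₁, f̃]` give the equation for `H`, and invariance of `⟨[b₁, f̃],
-- f̃'⟩` gives that for `G`.
theorem TripleRel.exists_change (h : TripleRel H α β γ H' α' β' γ') :
    ∃ s a b c d, TripleChange H α β γ H' α' β' γ' s a b c d := by
  obtain ⟨P, hP, hl, hr⟩ := TripleIsomorphic.symm h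
  have hPl : (P evenLeft).2 = 0 := by
    change P evenLeft ∈ tripleLeft
    rw [← hl]
    exact ⟨evenLeft, rfl, rfl⟩
  have hPr : ∀ x : TripleSpace, x.1 = 0 → (P x).1 = 0 := fun x hx => by
    change P x ∈ tripleRight
    rw [← hr]
    exact ⟨x, hx, rfl⟩
  have hPl' : (P evenLeft).1.2 = 0 :=
    ((mem_triplePart_zero _).1 ((hP.map_part 0 _).2 evenLeft_mem)).1
  set s := (P evenLeft).1.1 with hs
  have hPe : P evenLeft = s • evenLeft := by
    refine Prod.ext (Prod.ext ?_ ?_) ?_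
    · simp [evenLeft, hs]
    · rw [hPl']
      simp [evenLeft]
    · rw [hPl, Prod.smul_snd]
      exact (smul_zero s).symm
  let ι : (Fin 2 → ℝ) →ₗ[ℝ] TripleSpace := LinearMap.inr ℝ _ _ ∘ₗ LinearMap.inr ℝ _ _
  have hι : ∀ w, ι w = ((0, 0), (0, w)) := fun _ => rfl
  let A : Matrix (Fin 2) (Fin 2) ℝ := LinearMap.toMatrix'
    (LinearMap.snd ℝ _ _ ∘ₗ LinearMap.snd ℝ _ _ ∘ₗ (P : TripleSpace →ₗ[ℝ] TripleSpace) ∘ₗ ι)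
  have hPA : ∀ w, P (ι w) = ι (A *ᵥ w) := by
    intro w
    have h1 := hPr (ι w) rfl
    have h2 : (P (ι w)).2.1 = 0 := ((mem_triplePart_one _).1 ((hP.map_part 1 _).2
      ((mem_triplePart_one _).2 ⟨rfl, rfl⟩))).2
    refine Prod.ext h1 (Prod.ext h2 ?_)
    simp [A, hι]
  have hs0 : s ≠ 0 := by
    rintro h0
    rw [h0, zero_smul] at hPe
    have h1 : evenLeft = 0 := by simpa using hPe
    simpa [evenLeft] using congrArg (fun x : TripleSpace => x.1.1) h1
  have hdet : A.det ≠ 0 := by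
    intro h0
    obtain ⟨w, hw, hw0⟩ := exists_mulVec_eq_zero_iff.2 h0
    have h1 := hPA w
    rw [hw0, map_zero] at h1
    have h2 : ι w = 0 := by simpa using h1
    exact hw (congrArg (fun x : TripleSpace => x.2.2) h2)
  have hbr : ∀ w, P (tripleBracket H' α' β' γ' evenLeft (ι w)) =
      s • tripleBracket H α β γ evenLeft (ι (A *ᵥ w)) := by
    intro w
    have := hP.map_bracket evenLeft (ι w)
    rw [hPe, hPA, map_smul] at this
    exact this
  have hform : ∀ x y, tripleForm (P x) (P y) = tripleForm x y := hP.map_form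
  have hH : ∀ w v, ((A *ᵥ (H' *ᵥ w)) ⬝ᵥ v) = s * ((H *ᵥ (A *ᵥ w)) ⬝ᵥ v) := by
    intro w v
    have h1 := congrArg (fun x : TripleSpace => x.2.2) (hbr w)
    have h2 : tripleBracket H' α' β' γ' evenLeft (ι w) =
        ((0, w ᵥ* matN α' β' γ'), (0, 0)) + ι (-(H' *ᵥ w)) := by
      rw [tripleBracket_evenLeft]
      simp [hι]
    have h3 : (P (((0, w ᵥ* matN α' β' γ'), (0, 0)) : TripleSpace)).2 = 0 := by
      change P _ ∈ tripleLeft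
      rw [← hl]
      exact ⟨_, rfl, rfl⟩
    rw [h2, map_add, hPA, tripleBracket_evenLeft] at h1
    simp only [Prod.snd_add, h3] at h1
    simp only [hι, Prod.smul_snd, mulVec_neg, smul_neg, Prod.snd_zero, zero_add, neg_inj] at h1
    rw [h1, smul_dotProduct, smul_eq_mul]
  have hG : ∀ w v, (w ᵥ* matN α' β' γ') ⬝ᵥ v =
      s * (((A *ᵥ w) ᵥ* matN α β γ) ⬝ᵥ (A *ᵥ v)) := by
    intro w v
    have h1 := hform (tripleBracket H' α' β' γ' evenLeft (ι w)) (ι v)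
    rw [hbr, hPA, map_smul, LinearMap.smul_apply, tripleBracket_evenLeft, tripleBracket_evenLeft,
      tripleForm_apply, tripleForm_apply] at h1
    simpa [hι] using h1.symm
  have H00 := hH ![1, 0] ![1, 0]
  have H01 := hH ![0, 1] ![1, 0]
  have H10 := hH ![1, 0] ![0, 1]
  have H11 := hH ![0, 1] ![0, 1]
  have G00 := hG ![1, 0] ![1, 0]
  have G01 := hG ![1, 0] ![0, 1]
  have G11 := hG ![0, 1] ![0, 1]
  simp [dotProduct, mulVec, vecMul, Fin.sum_univ_two, matN] at H00 H01 H10 H11 G00 G01 G11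
  rw [det_fin_two] at hdet
  refine ⟨s, A 0 0, A 0 1, A 1 0, A 1 1, hs0, hdet, H00, H01, H10, H11, ?_, ?_, ?_⟩
  · rw [G00]; ring
  · rw [G01]; ring
  · rw [G11]; ring

/-- Replacing `f̃ᵏ` by `f̃ᵏ + Tᵏʲ f_j` with `T = !![p, q; q, r]`. -/
theorem doubleRel_shear (p q r : ℝ)
    (hα : α' = α + 2 * (p * H 0 0 + q * H 1 0))
    (hβ : β' = β + p * H 0 1 + q * H 1 1 + q * H 0 0 + r * H 1 0)
    (hγ : γ' = γ + 2 * (q * H 0 1 + r * H 1 1)) : DoubleRel H α β γ H α' β' γ' := by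
  -- Symmetry of `T` makes the shear symplectic; the hypotheses say `G' = G + T H + (T H)ᵀ`.
  obtain ⟨P, hP, -⟩ := exists_isIsoMap_blockMap (H := H) (H' := H) (α := α) (β := β) (γ := γ)
    (α' := α') (β' := β') (γ' := γ') (s := 1) (K := !![1, 0; 0, 1])
    (L := !![p, q; q, r]) (M := !![1, 0; 0, 1]) (N := 0)
    one_ne_zero
    (fun u w u' w' => by
      simp only [dotProduct, Fin.sum_univ_two, Pi.add_apply, vecMul_two, mulVec_two]
      simp
      ring)
    (fun u w => by
      ext k
      simp only [Pi.add_apply, Pi.sub_apply, Pi.smul_apply, vecMul_two, mulVec_two, smul_eq_mul]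
      fin_cases k <;> simp [matN, hα, hβ, hγ] <;> ring)
    (fun u w => by
      ext k
      simp only [Pi.add_apply, Pi.sub_apply, Pi.smul_apply, vecMul_two, mulVec_two, smul_eq_mul]
      fin_cases k <;> simp)
  exact Isomorphic.symm ⟨P, hP⟩

/-- Exchanging `f₂` and `f̃²`. -/
theorem doubleRel_swap_snd (a c d : ℝ) :
    DoubleRel !![a, 0; c, d] 0 0 0 !![a, 0; 0, -d] 0 (-c) 0 := by
  -- The entry `-1` of `L` against `1` of `N` keeps the exchange symplectic.
  obtain ⟨P, hP, -⟩ := exists_isIsoMap_blockMap (H := !![a, 0; c, d]) (H' := !![a, 0; 0, -d])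
    (α := 0) (β := 0) (γ := 0) (α' := 0) (β' := -c) (γ' := 0) (s := 1) (K := !![1, 0; 0, 0])
    (L := !![0, 0; 0, -1]) (M := !![1, 0; 0, 0]) (N := !![0, 0; 0, 1]) one_ne_zero
    (fun u w u' w' => by
      simp only [dotProduct, Fin.sum_univ_two, Pi.add_apply, vecMul_two, mulVec_two]
      simp
      ring)
    (fun u w => by
      ext k
      simp only [Pi.add_apply, Pi.sub_apply, Pi.smul_apply, vecMul_two, mulVec_two, smul_eq_mul]
      fin_cases k <;> simp [matN]; ring)
    (fun u w => by
      ext k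
      simp only [Pi.add_apply, Pi.sub_apply, Pi.smul_apply, vecMul_two, mulVec_two, smul_eq_mul]
      fin_cases k <;> simp [matN, mul_comm])
  exact Isomorphic.symm ⟨P, hP⟩

/-- Exchanging `f₁` and `f̃¹`. -/
theorem doubleRel_swap_fst (a d γ : ℝ) :
    DoubleRel !![a, 0; 0, d] 0 0 γ !![-a, 0; 0, d] 0 0 γ := by
  obtain ⟨P, hP, -⟩ := exists_isIsoMap_blockMap (H := !![a, 0; 0, d]) (H' := !![-a, 0; 0, d])
    (α := 0) (β := 0) (γ := γ) (α' := 0) (β' := 0) (γ' := γ) (s := 1) (K := !![0, 0; 0, 1])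
    (L := !![-1, 0; 0, 0]) (M := !![0, 0; 0, 1]) (N := !![1, 0; 0, 0]) one_ne_zero
    (fun u w u' w' => by
      simp only [dotProduct, Fin.sum_univ_two, Pi.add_apply, vecMul_two, mulVec_two]
      simp
      ring)
    (fun u w => by
      ext k
      simp only [Pi.add_apply, Pi.sub_apply, Pi.smul_apply, vecMul_two, mulVec_two, smul_eq_mul]
      fin_cases k <;> simp [matN]; ring)
    (fun u w => by
      ext k
      simp only [Pi.add_apply, Pi.sub_apply, Pi.smul_apply, vecMul_two, mulVec_two, smul_eq_mul]
      fin_cases k <;> simp [matN, mul_comm])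
  exact Isomorphic.symm ⟨P, hP⟩

end

/-! ### Normal forms of the matrix `H` -/

/-- A non-scalar `H` has a cyclic vector `v` among `(1, 0)`, `(0, 1)`, `(1, 1)`. With columns `v`
and `H v` the relation is Cayley–Hamilton. -/
theorem exists_companion {H : Matrix (Fin 2) (Fin 2) ℝ}
    (hH : ¬(H 0 1 = 0 ∧ H 1 0 = 0 ∧ H 0 0 = H 1 1)) :
    ∃ A : Matrix (Fin 2) (Fin 2) ℝ, IsUnit A.det ∧ A * !![0, -H.det; 1, H.trace] = H * A := by
  have key : ∀ x y : ℝ, x * (H 1 0 * x + H 1 1 * y) - (H 0 0 * x + H 0 1 * y) * y ≠ 0 →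
      ∃ A : Matrix (Fin 2) (Fin 2) ℝ, IsUnit A.det ∧
        A * !![0, -H.det; 1, H.trace] = H * A := by
    intro x y h
    refine ⟨!![x, H 0 0 * x + H 0 1 * y; y, H 1 0 * x + H 1 1 * y], ?_, ?_⟩
    · rw [Matrix.det_fin_two_of]
      exact h.isUnit
    · rw [Matrix.det_fin_two, Matrix.trace_fin_two]
      ext i j
      fin_cases i <;> fin_cases j <;>
        simp [Matrix.mul_apply, Fin.sum_univ_two] <;> ring
  by_cases h10 : H 1 0 = 0
  · by_cases h01 : H 0 1 = 0
    · refine key 1 1 ?_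
      rw [h10, h01]
      have : H 0 0 ≠ H 1 1 := fun h => hH ⟨h01, h10, h⟩
      intro h
      exact this (by linarith)
    · exact key 0 1 (by simpa using h01)
  · exact key 1 0 (by simpa using h10)

/-- Both matrices are conjugate to companion matrices, and `diag(1, s)` intertwines those up to the
factor `s`. -/
theorem exists_similar {H H' : Matrix (Fin 2) (Fin 2) ℝ}
    (hH : ¬(H 0 1 = 0 ∧ H 1 0 = 0 ∧ H 0 0 = H 1 1))
    (hH' : ¬(H' 0 1 = 0 ∧ H' 1 0 = 0 ∧ H' 0 0 = H' 1 1)) {s : ℝ} (hs : s ≠ 0)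
    (htr : H'.trace = s * H.trace) (hdet : H'.det = s ^ 2 * H.det) :
    ∃ A : Matrix (Fin 2) (Fin 2) ℝ, IsUnit A.det ∧ A * H' = s • (H * A) := by
  obtain ⟨A, hA, hAH⟩ := exists_companion hH
  obtain ⟨B, hB, hBH⟩ := exists_companion hH'
  have hD : !![1, 0; 0, s] * !![0, -H'.det; 1, H'.trace]
      = s • (!![0, -H.det; 1, H.trace] * !![1, 0; 0, s]) := by
    rw [htr, hdet]
    ext i j
    fin_cases i <;> fin_cases j <;> simp [Matrix.mul_apply, Fin.sum_univ_two]
    · ring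
    · exact Or.inl (by ring)
  have hi := B.mul_nonsing_inv hB
  have hi' := B.nonsing_inv_mul hB
  have hBH' : B⁻¹ * H' = !![0, -H'.det; 1, H'.trace] * B⁻¹ := by
    calc B⁻¹ * H' = B⁻¹ * (H' * B) * B⁻¹ := by
          rw [Matrix.mul_assoc, Matrix.mul_assoc, hi, Matrix.mul_one]
      _ = _ := by rw [← hBH, ← Matrix.mul_assoc, hi', Matrix.one_mul]
  refine ⟨A * !![1, 0; 0, s] * B⁻¹, ?_, ?_⟩
  · rw [Matrix.det_mul, Matrix.det_mul, Matrix.det_fin_two_of]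
    exact (hA.mul (by simpa using hs)).mul (Matrix.isUnit_nonsing_inv_det B hB)
  · rw [Matrix.mul_assoc, hBH', ← Matrix.mul_assoc, Matrix.mul_assoc A, hD, Matrix.mul_smul,
      ← Matrix.mul_assoc A, hAH, Matrix.smul_mul]
    simp only [Matrix.mul_assoc]

/-- The superalgebras `C` in the list, by their matrices. -/
inductive IsNormalMatrix : Matrix (Fin 2) (Fin 2) ℝ → Prop
  | A12 : IsNormalMatrix A12
  | C2 (p : ℝ) (hp : |p| < 1) : IsNormalMatrix (C2 p)
  | C2_one : IsNormalMatrix (C2 1)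
  | C2_neg_one : IsNormalMatrix (C2 (-1))
  | C3 : IsNormalMatrix C3
  | C4 : IsNormalMatrix C4
  | C5 (p : ℝ) (hp : 0 < p) : IsNormalMatrix (C5 p)
  | C5_zero : IsNormalMatrix (C5 0)

/-- Apart from scalar matrices, trace `τ` and determinant `δ` up to `(s τ, s² δ)` decide. The cases
are the signs of the discriminant `τ² - 4 δ`. -/
theorem exists_isNormalMatrix (H : Matrix (Fin 2) (Fin 2) ℝ) :
    ∃ H', IsNormalMatrix H' ∧ ∃ s : ℝ, s ≠ 0 ∧
      ∃ A : Matrix (Fin 2) (Fin 2) ℝ, IsUnit A.det ∧ A * H' = s • (H * A) := by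
  by_cases hH : H 0 1 = 0 ∧ H 1 0 = 0 ∧ H 0 0 = H 1 1
  · obtain ⟨h01, h10, h00⟩ := hH
    by_cases h11 : H 1 1 = 0
    · refine ⟨_, .A12, 1, one_ne_zero, 1, by simp, ?_⟩
      ext i j
      fin_cases i <;> fin_cases j <;> simp [A12, *]
    · refine ⟨_, .C2_one, (H 1 1)⁻¹, inv_ne_zero h11, 1, by simp, ?_⟩
      ext i j
      fin_cases i <;> fin_cases j <;> simp [C2, *]
  suffices h : ∃ H', IsNormalMatrix H' ∧ ¬(H' 0 1 = 0 ∧ H' 1 0 = 0 ∧ H' 0 0 = H' 1 1) ∧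
      ∃ s : ℝ, s ≠ 0 ∧ H'.trace = s * H.trace ∧ H'.det = s ^ 2 * H.det by
    obtain ⟨H', hn, hH', s, hs, htr, hdet⟩ := h
    exact ⟨H', hn, s, hs, exists_similar hH hH' hs htr hdet⟩
  generalize H.trace = τ
  generalize H.det = δ
  rcases lt_trichotomy (τ ^ 2 - 4 * δ) 0 with hΔ | hΔ | hΔ
  -- The eigenvalues are `(τ ± i r) / 2`: a factor `±2 / r` makes the imaginary parts `±1`, and its
  -- sign makes the real part nonnegative.
  · obtain ⟨r, hr, hr2⟩ : ∃ r : ℝ, 0 < r ∧ r ^ 2 = 4 * δ - τ ^ 2 :=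
      ⟨√(4 * δ - τ ^ 2), Real.sqrt_pos.2 (by linarith), Real.sq_sqrt (by linarith)⟩
    have hx : ∀ s : ℝ, s ^ 2 = 4 / r ^ 2 → (s * τ / 2) ^ 2 + 1 = s ^ 2 * δ := by
      intro s hs
      have : s ^ 2 * (4 * δ - τ ^ 2) = 4 := by
        rw [← hr2, hs]
        field_simp
      linarith
    have hnot : ∀ p : ℝ, ¬(C5 p 0 1 = 0 ∧ C5 p 1 0 = 0 ∧ C5 p 0 0 = C5 p 1 1) := by
      simp [C5]
    rcases lt_trichotomy τ 0 with hτ | hτ | hτ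
    · have h2 := hx (-(2 / r)) (by ring)
      refine ⟨_, .C5 (-(2 / r) * τ / 2) ?_, hnot _, -(2 / r), by simp [hr.ne'], ?_, ?_⟩
      · have : -(2 / r) * τ / 2 = -τ / r := by ring
        rw [this]
        exact div_pos (by linarith) hr
      · simp [C5, Matrix.trace_fin_two]
      · rw [← h2]
        simp [C5, Matrix.det_fin_two]
        ring
    · have h2 := hx (2 / r) (by ring)
      rw [hτ] at h2 ⊢
      refine ⟨_, .C5_zero, hnot _, 2 / r, by simp [hr.ne'], ?_, ?_⟩
      · simp [C5, Matrix.trace_fin_two]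
      · rw [← h2]
        simp [C5, Matrix.det_fin_two]
    · have h2 := hx (2 / r) (by ring)
      refine ⟨_, .C5 (2 / r * τ / 2) (by positivity), hnot _, 2 / r, by simp [hr.ne'], ?_, ?_⟩
      · simp [C5, Matrix.trace_fin_two]
      · rw [← h2]
        simp [C5, Matrix.det_fin_two]
        ring
  · by_cases hτ : τ = 0
    · refine ⟨_, .C3, by simp [C3], 1, one_ne_zero, ?_, ?_⟩
      · simp [C3, Matrix.trace_fin_two, hτ]
      · rw [hτ] at hΔ
        simp [C3, Matrix.det_fin_two]
        linarith
    · refine ⟨_, .C4, by simp [C4], 2 / τ, by simp [hτ], ?_, ?_⟩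
      · simp [C4, Matrix.trace_fin_two, hτ]
        norm_num
      · have : δ = τ ^ 2 / 4 := by linarith
        simp [C4, Matrix.det_fin_two, this]
        field_simp
        norm_num
  · obtain ⟨r, hr, hr2⟩ : ∃ r : ℝ, 0 < r ∧ r ^ 2 = τ ^ 2 - 4 * δ :=
      ⟨√(τ ^ 2 - 4 * δ), Real.sqrt_pos.2 hΔ, Real.sq_sqrt hΔ.le⟩
    -- Dividing by the eigenvalue of larger modulus leaves `1` and `p` with `-1 ≤ p < 1`.
    obtain ⟨x, y, hxy, hle, hτ, hδ⟩ : ∃ x y : ℝ, x ≠ y ∧ |y| ≤ |x| ∧ τ = x + y ∧ δ = x * y := by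
      rcases le_total 0 τ with h0 | h0
      · refine ⟨(τ + r) / 2, (τ - r) / 2, by intro h; linarith, abs_le_abs ?_ ?_, ?_, ?_⟩ <;>
          linarith
      · refine ⟨(τ - r) / 2, (τ + r) / 2, by intro h; linarith, ?_, ?_, ?_⟩
        · rw [abs_of_nonpos (by linarith : (τ - r) / 2 ≤ 0), abs_le]
          constructor <;> linarith
        all_goals linarith
    have hx : x ≠ 0 := by
      rintro rfl
      rw [abs_zero] at hle
      exact hxy (abs_nonpos_iff.1 hle).symm
    have hp : |y / x| ≤ 1 := by
      rw [abs_div]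
      exact div_le_one_of_le₀ hle (abs_nonneg _)
    have hp1 : y / x ≠ 1 := fun h => hxy (by rwa [div_eq_one_iff_eq hx, eq_comm] at h)
    have hn : IsNormalMatrix (C2 (y / x)) := by
      rcases hp.lt_or_eq with h | h
      · exact .C2 _ h
      · rcases abs_eq (zero_le_one) |>.1 h with h | h
        · exact absurd h hp1
        · rw [h]
          exact .C2_neg_one
    refine ⟨_, hn, ?_, x⁻¹, inv_ne_zero hx, ?_, ?_⟩
    · simp [C2, Ne.symm hp1]
    · simp [C2, Matrix.trace_fin_two, hτ]
      field_simp
    · simp [C2, Matrix.det_fin_two, hδ]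
      field_simp

theorem exists_tripleRel_isNormalMatrix (H : Matrix (Fin 2) (Fin 2) ℝ) (α β γ : ℝ) :
    ∃ H' α' β' γ', IsNormalMatrix H' ∧ TripleRel H α β γ H' α' β' γ' := by
  obtain ⟨H', hn, s, hs, A, hA, h⟩ := exists_isNormalMatrix H
  have he : ∀ i j, (A * H') i j = s * (H * A) i j := fun i j => by rw [h]; rfl
  simp only [Matrix.mul_apply, Fin.sum_univ_two] at he
  rw [Matrix.det_fin_two] at hA
  exact ⟨H', _, _, _, hn, TripleChange.tripleRel
    ⟨hs, hA.ne_zero, he 0 0, he 0 1, he 1 0, he 1 1, rfl, rfl, rfl⟩⟩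

/-! ### Normal forms of the matrix `G` -/

theorem TripleRel.refl {H : Matrix (Fin 2) (Fin 2) ℝ} {α β γ : ℝ} : TripleRel H α β γ H α β γ :=
  TripleChange.tripleRel (s := 1) (a := 1) (b := 0) (c := 0) (d := 1)
    ⟨by norm_num, by norm_num, by ring, by ring, by ring, by ring, by ring, by ring, by ring⟩

theorem exists_sq_mul_isSign {x : ℝ} (hx : x ≠ 0) : ∃ r ε : ℝ, 0 < r ∧ IsSign ε ∧ r ^ 2 * x = ε := by
  refine ⟨√(|x|⁻¹), x / |x|, Real.sqrt_pos.2 (by positivity), ?_, ?_⟩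
  · rcases abs_cases x with ⟨h, _⟩ | ⟨h, _⟩
    · left
      rw [h, div_self hx]
    · right
      rw [h, div_neg, div_self hx]
  · rw [Real.sq_sqrt (by positivity)]
    ring

theorem IsSign.ne_zero {ε : ℝ} (h : IsSign ε) : ε ≠ 0 := by
  rcases h with rfl | rfl <;> norm_num

theorem IsSign.neg {ε : ℝ} (h : IsSign ε) : IsSign (-ε) := by
  rcases h with rfl | rfl <;> simp [IsSign]

theorem IsSign.mul_self {ε : ℝ} (h : IsSign ε) : ε * ε = 1 := by
  rcases h with rfl | rfl <;> norm_num

theorem tripleRel_diag {p α β γ α' β' γ' : ℝ} (a d : ℝ) (ha : a ≠ 0) (hd : d ≠ 0)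
    (hα : α' = a ^ 2 * α) (hβ : β' = a * d * β) (hγ : γ' = d ^ 2 * γ) :
    TripleRel (C2 p) α β γ (C2 p) α' β' γ' :=
  TripleChange.tripleRel (s := 1) (a := a) (b := 0) (c := 0) (d := d)
    ⟨one_ne_zero, by simp [ha, hd], by simp [C2], by simp [C2], by simp [C2],
      by simp [C2, mul_comm], by rw [hα]; ring, by rw [hβ]; ring, by rw [hγ]; ring⟩

theorem tripleRel_abelian {α β γ α' β' γ' : ℝ} (s a b c d : ℝ) (hs : s ≠ 0)
    (h : a * d - b * c ≠ 0) (hα : α' = s * (a ^ 2 * α + 2 * (a * c) * β + c ^ 2 * γ))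
    (hβ : β' = s * (a * b * α + (a * d + b * c) * β + c * d * γ))
    (hγ : γ' = s * (b ^ 2 * α + 2 * (b * d) * β + d ^ 2 * γ)) :
    TripleRel A12 α β γ A12 α' β' γ' :=
  TripleChange.tripleRel (s := s) (a := a) (b := b) (c := c) (d := d)
    ⟨hs, h, by simp [A12], by simp [A12], by simp [A12], by simp [A12], hα, hβ, hγ⟩

/-- The matrices `A` with `A * C3 = s • (C3 * A)` are lower triangular with diagonal `a, s a`. -/
theorem tripleRel_C3 {α β γ α' β' γ' : ℝ} (s a c : ℝ) (hs : s ≠ 0) (ha : a ≠ 0)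
    (hα : α' = s * (a ^ 2 * α + 2 * (a * c) * β + c ^ 2 * γ))
    (hβ : β' = s ^ 2 * a * (a * β + c * γ)) (hγ : γ' = s ^ 3 * a ^ 2 * γ) :
    TripleRel C3 α β γ C3 α' β' γ' :=
  TripleChange.tripleRel (s := s) (a := a) (b := 0) (c := c) (d := s * a)
    ⟨hs, by simp [hs, ha], by simp [C3], by simp [C3], by simp [C3], by simp [C3], hα,
      by rw [hβ]; ring, by rw [hγ]; ring⟩

theorem tripleRel_C4 {α β γ α' β' γ' : ℝ} (a c : ℝ) (ha : a ≠ 0)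
    (hα : α' = a ^ 2 * α + 2 * (a * c) * β + c ^ 2 * γ)
    (hβ : β' = a * (a * β + c * γ)) (hγ : γ' = a ^ 2 * γ) :
    TripleRel C4 α β γ C4 α' β' γ' :=
  TripleChange.tripleRel (s := 1) (a := a) (b := 0) (c := c) (d := a)
    ⟨one_ne_zero, by simp [ha], by simp [C4], by simp [C4], by simp [C4, add_comm],
      by simp [C4], by rw [hα]; ring, by rw [hβ]; ring, by rw [hγ]; ring⟩

section Rotation

variable {H : Matrix (Fin 2) (Fin 2) ℝ} {α β γ α' β' γ' : ℝ}

/-- Under `h1` and `h2`, `H` combines the identity and a quarter turn, so it commutes with scaled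
rotations. This covers `A12`, `C2 1` and all `C5 p`. -/
theorem tripleRel_rotation (h1 : H 1 1 = H 0 0) (h2 : H 0 1 = -H 1 0 ) (x y : ℝ)
    (hxy : x ^ 2 + y ^ 2 ≠ 0) (hα : α' = x ^ 2 * α + 2 * (x * y) * β + y ^ 2 * γ)
    (hβ : β' = (x ^ 2 - y ^ 2) * β + x * y * (γ - α))
    (hγ : γ' = y ^ 2 * α - 2 * (x * y) * β + x ^ 2 * γ) :
    TripleRel H α β γ H α' β' γ' :=
  TripleChange.tripleRel (s := 1) (a := x) (b := -y) (c := y) (d := x)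
    ⟨one_ne_zero, by convert hxy using 1; ring, by rw [h2]; ring, by rw [h1, h2]; ring,
      by rw [h1]; ring, by rw [h1, h2]; ring, by rw [hα]; ring, by rw [hβ]; ring,
      by rw [hγ]; ring⟩

theorem exists_tripleRel_diagonal (h1 : H 1 1 = H 0 0) (h2 : H 0 1 = -H 1 0) (α β γ : ℝ) :
    ∃ α' γ', TripleRel H α β γ H α' 0 γ' := by
  by_cases hβ : β = 0
  · subst hβ
    exact ⟨α, γ, .refl⟩
  · have h0 : 0 ≤ (γ - α) ^ 2 + 4 * β ^ 2 := by positivity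
    -- The vector `(x, 1)` is an eigenvector of `G`: its `x` is a root of `β x² + (γ - α) x - β`.
    refine ⟨_, _, tripleRel_rotation h1 h2 ((α - γ + √((γ - α) ^ 2 + 4 * β ^ 2)) / (2 * β)) 1
      (by positivity) rfl ?_ rfl⟩
    have h3 := Real.sq_sqrt h0
    generalize √((γ - α) ^ 2 + 4 * β ^ 2) = q at h3
    field_simp
    linear_combination (-1 : ℝ) * h3

/-- After diagonalising `G`, a quarter turn can put the entry of larger modulus last, and a dilation
makes it `±1`. -/
theorem exists_tripleRel_rotation (h1 : H 1 1 = H 0 0) (h2 : H 0 1 = -H 1 0) (α β γ : ℝ) :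
    TripleRel H α β γ H 0 0 0 ∨
      ∃ κ ε, TripleRel H α β γ H κ 0 ε ∧ -1 ≤ κ ∧ κ ≤ 1 ∧ IsSign ε := by
  have key : ∀ x y : ℝ, |x| ≤ |y| → TripleRel H α β γ H x 0 y → y ≠ 0 →
      ∃ κ ε, TripleRel H α β γ H κ 0 ε ∧ -1 ≤ κ ∧ κ ≤ 1 ∧ IsSign ε := by
    intro x y hxy hr hy
    obtain ⟨r, ε, hr0, hε, hry⟩ := exists_sq_mul_isSign hy
    have h3 : |r ^ 2 * x| ≤ 1 := by
      have h4 : |ε| = 1 := by rcases hε with rfl | rfl <;> simp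
      rw [← h4, ← hry, abs_mul, abs_mul]
      gcongr
    refine ⟨r ^ 2 * x, ε, hr.trans (tripleRel_rotation h1 h2 r 0 (by positivity) (by ring)
      (by ring) (by rw [← hry]; ring)), (abs_le.1 h3).1, (abs_le.1 h3).2, hε⟩
  obtain ⟨x, y, hr⟩ := exists_tripleRel_diagonal h1 h2 α β γ
  have hr' : TripleRel H α β γ H y 0 x :=
    hr.trans (tripleRel_rotation h1 h2 0 1 (by norm_num) (by ring) (by ring) (by ring))
  by_cases hxy : x = 0 ∧ y = 0
  · left
    rw [hxy.1, hxy.2] at hr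
    exact hr
  · right
    rcases le_total |x| |y| with h | h
    · refine key x y h hr ?_
      rintro rfl
      exact hxy ⟨abs_nonpos_iff.1 (by simpa using h), rfl⟩
    · refine key y x h hr' ?_
      rintro rfl
      exact hxy ⟨rfl, abs_nonpos_iff.1 (by simpa using h)⟩

end Rotation

/-- The superalgebras `(C|N^{α,β,γ})` with `C` in the list are isomorphic to those in the table. -/
def HasTableForm (H : Matrix (Fin 2) (Fin 2) ℝ) (α β γ : ℝ) : Prop :=
  ∃ α' β' γ', InTable H α' β' γ' ∧ TripleRel H α β γ H α' β' γ'

theorem hasTableForm_A12 (α β γ : ℝ) : HasTableForm A12 α β γ := by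
  rcases exists_tripleRel_rotation (H := A12) rfl (by simp [A12]) α β γ with
    h | ⟨κ, ε, h, -, -, hε⟩
  · exact ⟨_, _, _, .row1, h⟩
  -- For abelian `C` the factor `s` is free: exchanging the entries and taking `s = ε` makes the
  -- first one `1`.
  · by_cases hκ : κ = 0
    · refine ⟨_, _, _, .row2, h.trans (tripleRel_abelian ε 0 1 1 0 hε.ne_zero (by norm_num) ?_
        (by ring) ?_)⟩
      · linear_combination -hε.mul_self
      · rw [hκ]
        ring
    · obtain ⟨r, ε', hr0, hε', hrκ⟩ := exists_sq_mul_isSign hκ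
      refine ⟨_, _, _, .row3 (ε * ε') ?_, h.trans (tripleRel_abelian ε 0 r 1 0 hε.ne_zero
        (by simp [hr0.ne']) ?_ (by ring) ?_)⟩
      · rcases hε with rfl | rfl
        · simpa using hε'
        · simpa using hε'.neg
      · linear_combination -hε.mul_self
      · rw [← hrκ]
        ring

theorem hasTableForm_C2_one (α β γ : ℝ) : HasTableForm (C2 1) α β γ := by
  have h1 : C2 1 1 1 = C2 1 0 0 := by simp [C2]
  have h2 : C2 1 0 1 = -C2 1 1 0 := by simp [C2]
  rcases exists_tripleRel_rotation h1 h2 α β γ with h | ⟨κ, ε, h, -, -, hε⟩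
  · exact ⟨_, _, _, .row9, h⟩
  · by_cases hκ : κ = 0
    · rw [hκ] at h
      exact ⟨_, _, _, .row12 ε hε, h⟩
    · obtain ⟨r, ε', hr0, hε', hrκ⟩ := exists_sq_mul_isSign hκ
      have h3 : TripleRel (C2 1) α β γ (C2 1) ε' 0 ε :=
        h.trans (tripleRel_diag r 1 hr0.ne' one_ne_zero hrκ.symm (by ring) (by ring))
      rcases hε with rfl | rfl <;> rcases hε' with rfl | rfl
      · exact ⟨_, _, _, .row10 1 (Or.inl rfl), h3⟩
      · exact ⟨_, _, _, .row11, h3.trans (tripleRel_rotation h1 h2 0 1 (by norm_num) (by ring)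
          (by ring) (by ring))⟩
      · exact ⟨_, _, _, .row11, h3⟩
      · exact ⟨_, _, _, .row10 (-1) (Or.inr rfl), h3⟩

/-- Diagonal changes multiply `α, β, γ` by `a², a d, d²`, so `α` and `γ` become `0` or `±1`. If one
of them vanishes, a free factor normalises `β` as well; otherwise only the sign of `β` can be
adjusted. -/
theorem exists_tripleRel_C2 (p α β γ : ℝ) :
    TripleRel (C2 p) α β γ (C2 p) 0 0 0 ∨ TripleRel (C2 p) α β γ (C2 p) 0 1 0 ∨
    (∃ δ ε, (δ = 0 ∨ δ = 1) ∧ IsSign ε ∧ TripleRel (C2 p) α β γ (C2 p) 0 δ ε) ∨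
    (∃ δ ε, (δ = 0 ∨ δ = 1) ∧ IsSign ε ∧ TripleRel (C2 p) α β γ (C2 p) ε δ 0) ∨
    ∃ κ ε ε', 0 ≤ κ ∧ IsSign ε ∧ IsSign ε' ∧ TripleRel (C2 p) α β γ (C2 p) ε κ ε' := by
  by_cases hα : α = 0
  · by_cases hγ : γ = 0
    · by_cases hβ : β = 0
      · left
        rw [hα, hβ, hγ]
        exact .refl
      · right; left
        refine tripleRel_diag 1 β⁻¹ one_ne_zero (inv_ne_zero hβ) ?_ ?_ ?_ <;> simp [*]
    · right; right; left
      obtain ⟨r, ε, hr, hε, hrγ⟩ := exists_sq_mul_isSign hγ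
      by_cases hβ : β = 0
      · refine ⟨0, ε, Or.inl rfl, hε, ?_⟩
        refine tripleRel_diag 1 r one_ne_zero hr.ne' ?_ ?_ ?_ <;> simp [*]
      · refine ⟨1, ε, Or.inr rfl, hε, ?_⟩
        refine tripleRel_diag (r * β)⁻¹ r (by simp [hr.ne', hβ]) hr.ne' ?_ ?_ ?_
        · simp [*]
        · field_simp
        · rw [hrγ]
  · obtain ⟨r, ε, hr, hε, hrα⟩ := exists_sq_mul_isSign hα
    right; right; right
    by_cases hγ : γ = 0
    · left
      by_cases hβ : β = 0
      · refine ⟨0, ε, Or.inl rfl, hε, ?_⟩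
        refine tripleRel_diag r 1 hr.ne' one_ne_zero ?_ ?_ ?_ <;> simp [*]
      · refine ⟨1, ε, Or.inr rfl, hε, ?_⟩
        refine tripleRel_diag r (r * β)⁻¹ hr.ne' (by simp [hr.ne', hβ]) ?_ ?_ ?_
        · rw [hrα]
        · field_simp
        · simp [*]
    · right
      obtain ⟨q, ε', hq, hε', hqγ⟩ := exists_sq_mul_isSign hγ
      rcases le_total 0 β with hβ | hβ
      · exact ⟨r * q * β, ε, ε', by positivity, hε, hε',
          tripleRel_diag r q hr.ne' hq.ne' hrα.symm rfl hqγ.symm⟩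
      · refine ⟨r * (-q) * β, ε, ε', ?_, hε, hε',
          tripleRel_diag r (-q) hr.ne' (neg_ne_zero.2 hq.ne') hrα.symm rfl ?_⟩
        · have : 0 ≤ r * q * (-β) := mul_nonneg (by positivity) (by linarith)
          linarith
        · rw [← hqγ]
          ring

theorem hasTableForm_C2 {p : ℝ} (hp : |p| < 1) (α β γ : ℝ) : HasTableForm (C2 p) α β γ := by
  rcases exists_tripleRel_C2 p α β γ with h | h | ⟨δ, ε, hδ, hε, h⟩ | ⟨δ, ε, hδ, hε, h⟩ |
    ⟨κ, ε, ε', hκ, hε, hε', h⟩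
  · exact ⟨_, _, _, .row4 p hp, h⟩
  · exact ⟨_, _, _, .row5 p hp, h⟩
  · exact ⟨_, _, _, .row6 p δ ε hp hδ hε, h⟩
  · exact ⟨_, _, _, .row7 p δ ε hp hδ hε, h⟩
  · exact ⟨_, _, _, .row8 p κ ε ε' hp hκ hε hε', h⟩

/-- Exchanging the eigenvectors together with `b₁ ↦ -b₁` preserves `C2 p` only for `p = -1`. -/
theorem tripleRel_C2_neg_one (α β γ : ℝ) :
    TripleRel (C2 (-1)) α β γ (C2 (-1)) (-γ) β (-α) :=
  TripleChange.tripleRel (s := -1) (a := 0) (b := 1) (c := -1) (d := 0)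
    ⟨by norm_num, by norm_num, by simp [C2], by simp [C2], by simp [C2], by simp [C2],
      by ring, by ring, by ring⟩

theorem hasTableForm_C2_neg_one (α β γ : ℝ) : HasTableForm (C2 (-1)) α β γ := by
  rcases exists_tripleRel_C2 (-1) α β γ with h | h | ⟨δ, ε, hδ, hε, h⟩ | ⟨δ, ε, hδ, hε, h⟩ |
    ⟨κ, ε, ε', hκ, hε, hε', h⟩
  · exact ⟨_, _, _, .row13, h⟩
  · exact ⟨_, _, _, .row14, h⟩
  · exact ⟨_, _, _, .row15 δ ε hδ hε, h⟩
  · have := h.trans (tripleRel_C2_neg_one _ _ _)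
    rw [neg_zero] at this
    exact ⟨_, _, _, .row15 δ (-ε) hδ hε.neg, this⟩
  · have h' := h.trans (tripleRel_C2_neg_one _ _ _)
    rcases hε with rfl | rfl <;> rcases hε' with rfl | rfl
    · exact ⟨_, _, _, .row16 κ hκ, h⟩
    · exact ⟨_, _, _, .row17 κ 1 hκ (Or.inl rfl), h⟩
    · refine ⟨_, _, _, .row17 κ (-1) hκ (Or.inr rfl), ?_⟩
      rwa [neg_neg]
    · rw [neg_neg] at h'
      exact ⟨_, _, _, .row16 κ hκ, h'⟩

/-- The entry `c` completes the square and removes `β`; `s` takes the sign of `γ`, which is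
multiplied by `s³ a²`. -/
theorem exists_tripleRel_C3 {α β γ : ℝ} (hγ : γ ≠ 0) :
    ∃ m, TripleRel C3 α β γ C3 m 0 1 := by
  obtain ⟨r, ε, hr, hε, hrγ⟩ := exists_sq_mul_isSign hγ
  refine ⟨_, tripleRel_C3 ε r (-(r * β) / γ) hε.ne_zero hr.ne' rfl ?_ ?_⟩
  · field_simp
    ring
  · linear_combination -(1 + ε * ε) * hε.mul_self - ε ^ 3 * hrγ

theorem hasTableForm_C3 (α β γ : ℝ) : HasTableForm C3 α β γ := by
  by_cases hγ : γ = 0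
  · by_cases hβ : β = 0
    · by_cases hα : α = 0
      · rw [hα, hβ, hγ]
        exact ⟨_, _, _, .row18, .refl⟩
      · obtain ⟨r, ε, hr, hε, hrα⟩ := exists_sq_mul_isSign hα
        refine ⟨_, _, _, .row20, tripleRel_C3 ε r 0 hε.ne_zero hr.ne' ?_ ?_ ?_⟩
        · linear_combination -hε.mul_self - ε * hrα
        all_goals simp [*]
    · obtain ⟨r, ε, hr, hε, hrβ⟩ := exists_sq_mul_isSign hβ
      refine ⟨_, _, _, .row21 ε hε, tripleRel_C3 1 r (-(r * α) / (2 * β)) one_ne_zero hr.ne'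
        ?_ ?_ ?_⟩
      · rw [hγ]
        field_simp
        ring
      · rw [hγ, ← hrβ]
        ring
      · simp [*]
  · obtain ⟨m, h⟩ := exists_tripleRel_C3 hγ (α := α) (β := β)
    by_cases hm : m = 0
    · rw [hm] at h
      exact ⟨_, _, _, .row22, h⟩
    · obtain ⟨r, ε, hr, hε, hrm⟩ := exists_sq_mul_isSign hm
      -- Here `s³ a² = 1` keeps `γ = 1`, while `s a² = r²` normalises `α`.
      refine ⟨_, _, _, .row19 ε hε, h.trans (tripleRel_C3 r⁻¹ (r * √r) 0 (inv_ne_zero hr.ne')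
        (by positivity) ?_ (by ring) ?_)⟩
      · rw [← hrm, mul_pow, Real.sq_sqrt hr.le]
        field_simp
        ring
      · rw [mul_pow, Real.sq_sqrt hr.le]
        field_simp

theorem hasTableForm_C4 (α β γ : ℝ) : HasTableForm C4 α β γ := by
  by_cases hγ : γ = 0
  · by_cases hβ : β = 0
    · by_cases hα : α = 0
      · rw [hα, hβ, hγ]
        exact ⟨_, _, _, .row23, .refl⟩
      · obtain ⟨r, ε, hr, hε, hrα⟩ := exists_sq_mul_isSign hα
        refine ⟨_, _, _, .row24 ε hε, tripleRel_C4 r 0 hr.ne' ?_ ?_ ?_⟩ <;> simp [*]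
    · obtain ⟨r, ε, hr, hε, hrβ⟩ := exists_sq_mul_isSign hβ
      refine ⟨_, _, _, .row25 ε hε, tripleRel_C4 r (-(r * α) / (2 * β)) hr.ne' ?_ ?_ ?_⟩
      · rw [hγ]
        field_simp
        ring
      · rw [hγ, ← hrβ]
        ring
      · simp [*]
  · obtain ⟨r, ε, hr, hε, hrγ⟩ := exists_sq_mul_isSign hγ
    -- Normalising `γ` uses up `r` and completing the square uses up `c`, so what is left of `α` is
    -- a continuous parameter.
    refine ⟨_, _, _, .row26 (r ^ 2 * (α - β ^ 2 / γ)) ε hε,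
      tripleRel_C4 r (-(r * β) / γ) hr.ne' ?_ ?_ hrγ.symm⟩
    · field_simp
      ring
    · field_simp
      ring

theorem hasTableForm_C5 {p : ℝ} (hp : 0 < p) (α β γ : ℝ) : HasTableForm (C5 p) α β γ := by
  have h1 : C5 p 1 1 = C5 p 0 0 := by simp [C5]
  have h2 : C5 p 0 1 = -C5 p 1 0 := by simp [C5]
  rcases exists_tripleRel_rotation h1 h2 α β γ with h | ⟨κ, ε, h, hκ, hκ', hε⟩
  · exact ⟨_, _, _, .row27 p hp, h⟩
  · rcases hκ.lt_or_eq with hκ | rfl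
    · exact ⟨_, _, _, .row28 p κ ε hp hκ hκ' hε, h⟩
    -- The diagonal `(-1, 1)` is a quarter turn of `(1, -1)` and is listed in the latter form.
    · rcases hε with rfl | rfl
      · exact ⟨_, _, _, .row28 p 1 (-1) hp (by norm_num) le_rfl (Or.inr rfl), h.trans
          (tripleRel_rotation h1 h2 0 1 (by norm_num) (by ring) (by ring) (by ring))⟩
      · exact ⟨_, _, _, .row29 p hp, h⟩

/-- A reflection of the `f`-plane together with `b₁ ↦ -b₁` preserves `C5 p` only for `p = 0`; it
absorbs the sign of `γ`. -/
theorem tripleRel_C5_zero (α β γ : ℝ) : TripleRel (C5 0) α β γ (C5 0) (-α) β (-γ) :=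
  TripleChange.tripleRel (s := -1) (a := 1) (b := 0) (c := 0) (d := -1)
    ⟨by norm_num, by norm_num, by simp [C5], by simp [C5], by simp [C5], by simp [C5],
      by ring, by ring, by ring⟩

theorem hasTableForm_C5_zero (α β γ : ℝ) : HasTableForm (C5 0) α β γ := by
  have h1 : C5 0 1 1 = C5 0 0 0 := by simp [C5]
  have h2 : C5 0 0 1 = -C5 0 1 0 := by simp [C5]
  rcases exists_tripleRel_rotation h1 h2 α β γ with h | ⟨κ, ε, h, hκ, hκ', hε⟩
  · exact ⟨_, _, _, .row30, h⟩
  · rcases hε with rfl | rfl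
    · exact ⟨_, _, _, .row31 κ hκ hκ', h⟩
    · refine ⟨_, _, _, .row31 (-κ) (by linarith) (by linarith), ?_⟩
      simpa using h.trans (tripleRel_C5_zero _ _ _)

theorem exists_inTable (H : Matrix (Fin 2) (Fin 2) ℝ) (α β γ : ℝ) :
    ∃ H' α' β' γ', InTable H' α' β' γ' ∧ TripleRel H α β γ H' α' β' γ' := by
  obtain ⟨H', α', β', γ', hn, h⟩ := exists_tripleRel_isNormalMatrix H α β γ
  obtain ⟨α'', β'', γ'', ht, h'⟩ : HasTableForm H' α' β' γ' := by
    cases hn with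
    | A12 => exact hasTableForm_A12 _ _ _
    | C2 p hp => exact hasTableForm_C2 hp _ _ _
    | C2_one => exact hasTableForm_C2_one _ _ _
    | C2_neg_one => exact hasTableForm_C2_neg_one _ _ _
    | C3 => exact hasTableForm_C3 _ _ _
    | C4 => exact hasTableForm_C4 _ _ _
    | C5 p hp => exact hasTableForm_C5 hp _ _ _
    | C5_zero => exact hasTableForm_C5_zero _ _ _
  exact ⟨H', α'', β'', γ'', ht, h.trans h'⟩

theorem exists_lists_of_isNormalMatrix {H : Matrix (Fin 2) (Fin 2) ℝ} (hn : IsNormalMatrix H)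
    (α β γ : ℝ) : ∃ c : SuperdoubleClass, c.Lists H α β γ := by
  cases hn with
  | A12 =>
    rcases lt_trichotomy (α * γ) (β ^ 2) with h | h | h
    · exact ⟨_, .III_abelian _ _ _ h⟩
    · by_cases h0 : (α, β, γ) = (0, 0, 0)
      · simp only [Prod.mk.injEq] at h0
        obtain ⟨rfl, rfl, rfl⟩ := h0
        exact ⟨_, .I⟩
      · exact ⟨_, .X _ _ _ h0 h⟩
    · exact ⟨_, .IX _ _ _ h⟩
  | C2 p hp =>
    rw [abs_lt] at hp
    rcases lt_trichotomy p 0 with h | rfl | h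
    · have := SuperdoubleClass.Lists.II_neg ⟨-p, by linarith, by linarith⟩ α β γ
      simp only [neg_neg] at this
      exact ⟨_, this⟩
    · by_cases hγ : γ = 0
      · rw [hγ]
        exact ⟨_, .II_zero _ _⟩
      · exact ⟨_, .VI _ _ _ hγ⟩
    · exact ⟨_, .II_pos ⟨p, h, hp.2⟩ _ _ _⟩
  | C2_one => exact ⟨_, .II_one _ _ _⟩
  | C2_neg_one =>
    by_cases hβ : β = 0
    · rw [hβ]
      exact ⟨_, .II_one_neg _ _⟩
    · exact ⟨_, .IV_neg _ _ _ hβ⟩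
  | C3 =>
    by_cases hγ : γ = 0
    · rw [hγ]
      exact ⟨_, .III _ _⟩
    · exact ⟨_, .VII _ _ _ hγ⟩
  | C4 => exact ⟨_, .IV _ _ _⟩
  | C5 p hp => exact ⟨_, .V ⟨p, hp⟩ _ _ _⟩
  | C5_zero =>
    by_cases h : α = -γ
    · have : γ = -α := by rw [h, neg_neg]
      rw [this]
      exact ⟨_, .V_zero _ _⟩
    · exact ⟨_, .VIII _ _ _ h⟩

theorem exists_lists (H : Matrix (Fin 2) (Fin 2) ℝ) (α β γ : ℝ) :
    ∃ (c : SuperdoubleClass) (H' : _) (α' β' γ' : ℝ), c.Lists H' α' β' γ' ∧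
      TripleRel H α β γ H' α' β' γ' := by
  obtain ⟨H', α', β', γ', hn, h⟩ := exists_tripleRel_isNormalMatrix H α β γ
  obtain ⟨c, hc⟩ := exists_lists_of_isNormalMatrix hn α' β' γ'
  exact ⟨c, H', α', β', γ', hc, h⟩

/-! ### Superdoubles listed in the same class -/

/-- The determinant of `G` is multiplied by `(s det A)²`, so its sign is invariant. -/
theorem TripleRel.disc_eq {H H' : Matrix (Fin 2) (Fin 2) ℝ} {α β γ α' β' γ' : ℝ}
    (h : TripleRel H α β γ H' α' β' γ') :
    ∃ t ≠ 0, α' * γ' - β' ^ 2 = t ^ 2 * (α * γ - β ^ 2) := by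
  obtain ⟨s, a, b, c, d, h⟩ := h.exists_change
  refine ⟨s * (a * d - b * c), mul_ne_zero h.scale_ne h.det_ne, ?_⟩
  rw [h.hα, h.hβ, h.hγ]
  ring

theorem exists_tripleRel_A12 (α β γ : ℝ) :
    TripleRel A12 α β γ A12 0 0 0 ∨ TripleRel A12 α β γ A12 1 0 0 ∨
      TripleRel A12 α β γ A12 1 0 1 ∨ TripleRel A12 α β γ A12 1 0 (-1) := by
  obtain ⟨α', β', γ', ht, hr⟩ := hasTableForm_A12 α β γ
  generalize hH : A12 = H at ht
  cases ht with
  | row1 => exact Or.inl hr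
  | row2 => exact Or.inr (Or.inl hr)
  | row3 ε hε =>
    rcases hε with rfl | rfl
    · exact Or.inr (Or.inr (Or.inl hr))
    · exact Or.inr (Or.inr (Or.inr hr))
  | _ => simp [A12, C2, C3, C4, C5, ← Matrix.ext_iff, Fin.forall_fin_two] at hH

theorem tripleRel_A12_of_neg {α β γ : ℝ} (h : α * γ < β ^ 2) :
    TripleRel A12 α β γ A12 1 0 (-1) := by
  rcases exists_tripleRel_A12 α β γ with hr | hr | hr | hr
  all_goals
    obtain ⟨t, ht, hd⟩ := hr.disc_eq
    have h1 : t ^ 2 * (α * γ - β ^ 2) < 0 :=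
      mul_neg_of_pos_of_neg (by positivity) (by linarith)
    first | exact hr | linarith

theorem tripleRel_A12_of_pos {α β γ : ℝ} (h : α * γ > β ^ 2) :
    TripleRel A12 α β γ A12 1 0 1 := by
  rcases exists_tripleRel_A12 α β γ with hr | hr | hr | hr
  all_goals
    obtain ⟨t, ht, hd⟩ := hr.disc_eq
    have h1 : 0 < t ^ 2 * (α * γ - β ^ 2) := mul_pos (by positivity) (by linarith)
    first | exact hr | linarith

theorem tripleRel_A12_of_eq {α β γ : ℝ} (h : (α, β, γ) ≠ (0, 0, 0)) (h' : α * γ = β ^ 2) :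
    TripleRel A12 α β γ A12 1 0 0 := by
  rcases exists_tripleRel_A12 α β γ with hr | hr | hr | hr
  · obtain ⟨s, a, b, c, d, hc⟩ := hr.symm.exists_change
    refine absurd ?_ h
    rw [hc.hα, hc.hβ, hc.hγ]
    simp
  all_goals
    obtain ⟨t, ht, hd⟩ := hr.disc_eq
    rw [h', sub_self, mul_zero] at hd
    first | exact hr | norm_num at hd

/-- The superdouble chosen to represent a class. -/
def SuperdoubleClass.rep : SuperdoubleClass → Matrix (Fin 2) (Fin 2) ℝ × ℝ × ℝ × ℝ
  | .I => (A12, 0, 0, 0)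
  | .II p => (C2 p, 0, 0, 0)
  | .II_one => (C2 1, 0, 0, 0)
  | .II_zero => (C2 0, 0, 0, 0)
  | .III => (A12, 1, 0, -1)
  | .IV => (C4, 0, 0, 0)
  | .V p => (C5 p, 0, 0, 0)
  | .V_zero => (C5 0, 0, 0, 0)
  | .VI => (C2 0, 0, 0, 1)
  | .VII => (C3, 0, 0, 1)
  | .VIII => (C5 0, 0, 0, 1)
  | .IX => (A12, 1, 0, 1)
  | .X => (A12, 1, 0, 0)

/-- The map `T ↦ T H + (T H)ᵀ` multiplies the three entries of `T` by `2`, `1 + p`, `2 p`, none of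
which is zero. -/
theorem doubleRel_C2 {p : ℝ} (hp : p ≠ 0) (hp' : p ≠ -1) (α β γ : ℝ) :
    DoubleRel (C2 p) α β γ (C2 p) 0 0 0 := by
  have h1 : 1 + p ≠ 0 := fun h => hp' (by linarith)
  refine doubleRel_shear (-α / 2) (-β / (1 + p)) (-γ / (2 * p)) ?_ ?_ ?_
  · simp [C2]
    ring
  · simp [C2]
    field_simp
    ring
  · simp [C2]
    field_simp
    ring

theorem doubleRel_C2_neg (p : ℝ) : DoubleRel (C2 p) 0 0 0 (C2 (-p)) 0 0 0 := by
  simpa [C2] using doubleRel_swap_snd 1 0 p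

theorem doubleRel_C4 (α β γ : ℝ) : DoubleRel C4 α β γ C4 0 0 0 := by
  refine doubleRel_shear (-α / 2 + (β - γ / 2) / 2) (-(β - γ / 2) / 2) (-γ / 2) ?_ ?_ ?_ <;>
  · simp [C4]
    ring

/-- No two eigenvalues of `H` sum to zero, so `T ↦ T H + (T H)ᵀ` is bijective. The value of `q`
solves what remains after eliminating the diagonal of `T`. -/
theorem doubleRel_C5 {p : ℝ} (hp : p ≠ 0) (α β γ : ℝ) : DoubleRel (C5 p) α β γ (C5 p) 0 0 0 := by
  have h1 : 1 + p ^ 2 ≠ 0 := by positivity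
  set q := (-(β * p) + (γ - α) / 2) / (2 * (1 + p ^ 2)) with hq
  refine doubleRel_shear ((-α / 2 - q) / p) q ((q - γ / 2) / p) ?_ ?_ ?_
  · simp [C5]
    field_simp
    ring
  · simp [C5]
    field_simp
    rw [hq]
    field_simp
    ring
  · simp [C5]
    field_simp
    ring

/-- For `p = 0` shears change `G` only by traceless matrices, so the trace survives. -/
theorem doubleRel_C5_zero (α β γ : ℝ) : DoubleRel (C5 0) α β γ (C5 0) 0 0 (α + γ) := by
  refine doubleRel_shear β (-α / 2) 0 ?_ ?_ ?_ <;>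
  · simp [C5]
    try ring

/-- Shears remove what they can from `G`. Exchanging `f₂` with `f̃²` joins `C2 p` to `C2 (-p)`, `C3`
to the abelian `C`, and `C4` to `C2 (-1)` with `β ≠ 0`. -/
theorem SuperdoubleClass.Lists.doubleRel_rep {c : SuperdoubleClass}
    {H : Matrix (Fin 2) (Fin 2) ℝ} {α β γ : ℝ} (h : c.Lists H α β γ) :
    DoubleRel H α β γ c.rep.1 c.rep.2.1 c.rep.2.2.1 c.rep.2.2.2 := by
  cases h with
  | I => exact .refl
  | II_pos p => exact doubleRel_C2 p.2.1.ne' (by linarith [p.2.1]) _ _ _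
  | II_neg p =>
    have := (doubleRel_C2 (p := -p) (neg_ne_zero.2 p.2.1.ne') (by linarith [p.2.2]) α β γ).trans
      (doubleRel_C2_neg _)
    rwa [neg_neg] at this
  | II_one => exact doubleRel_C2 one_ne_zero (by norm_num) _ _ _
  | II_one_neg lam κ =>
    have h1 : DoubleRel (C2 (-1)) α 0 γ (C2 (-1)) 0 0 0 := by
      refine doubleRel_shear (-α / 2) 0 (γ / 2) ?_ ?_ ?_ <;> simp [C2] <;> ring
    have := h1.trans (doubleRel_C2_neg _)
    rwa [neg_neg] at this
  | II_zero =>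
    refine doubleRel_shear (-α / 2) (-β) 0 ?_ ?_ ?_ <;> simp [C2, SuperdoubleClass.rep]
    ring
  | III =>
    have h1 : DoubleRel C3 α β 0 C3 0 0 0 := by
      refine doubleRel_shear 0 (-α / 2) (-β) ?_ ?_ ?_ <;> simp [C3]
      ring
    have h2 : DoubleRel C3 0 0 0 A12 0 (-1) 0 := by
      have h3 : (!![0, 0; 0, -0] : Matrix (Fin 2) (Fin 2) ℝ) = A12 := by
        ext i j
        fin_cases i <;> fin_cases j <;> simp [A12]
      rw [← h3]
      exact doubleRel_swap_snd 0 1 0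
    exact (h1.trans h2).trans (tripleRel_A12_of_neg (by norm_num)).doubleRel
  | III_abelian _ _ _ h => exact (tripleRel_A12_of_neg h).doubleRel
  | IV => exact doubleRel_C4 _ _ _
  | IV_neg _ _ _ h =>
    have h1 : DoubleRel (C2 (-1)) α β γ (C2 (-1)) 0 β 0 := by
      refine doubleRel_shear (-α / 2) 0 (γ / 2) ?_ ?_ ?_ <;> simp [C2] <;> ring
    have h2 : DoubleRel (C2 (-1)) 0 β 0 (C2 (-1)) 0 (-1) 0 :=
      (tripleRel_diag 1 (-β⁻¹) one_ne_zero (by simp [h]) (by ring) (by field_simp)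
        (by ring)).doubleRel
    exact (h1.trans h2).trans (doubleRel_swap_snd 1 1 1).symm
  | V p => exact doubleRel_C5 (ne_of_gt p.2) _ _ _
  | V_zero =>
    have := doubleRel_C5_zero α β (-α)
    rwa [add_neg_cancel] at this
  | VI _ _ _ h =>
    obtain ⟨r, ε, hr, hε, hrγ⟩ := exists_sq_mul_isSign h
    have h1 : DoubleRel (C2 0) α β γ (C2 0) 0 0 γ := by
      refine doubleRel_shear (-α / 2) (-β) 0 ?_ ?_ ?_ <;> simp [C2]
      ring
    have h2 : DoubleRel (C2 0) 0 0 γ (C2 0) 0 0 ε :=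
      (tripleRel_diag 1 r one_ne_zero hr.ne' (by ring) (by ring) hrγ.symm).doubleRel
    rcases hε with rfl | rfl
    · exact h1.trans h2
    -- Exchanging `f₁` with `f̃¹` negates the eigenvalue `1`; then `b₁ ↦ -b₁` restores it and flips
    -- the sign of `γ`.
    · have h3 : TripleRel !![-1, 0; 0, 0] 0 0 (-1) (C2 0) 0 0 1 :=
        TripleChange.tripleRel (s := -1) (a := 1) (b := 0) (c := 0) (d := 1)
          ⟨by norm_num, by norm_num, by simp [C2], by simp [C2], by simp [C2], by simp [C2],
            by ring, by ring, by ring⟩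
      exact ((h1.trans h2).trans (doubleRel_swap_fst 1 0 (-1))).trans h3.doubleRel
  | VII _ _ _ h =>
    obtain ⟨m, h1⟩ := exists_tripleRel_C3 h (α := α) (β := β)
    refine h1.doubleRel.trans (doubleRel_shear 0 (-m / 2) 0 ?_ ?_ ?_) <;>
      simp [C3, SuperdoubleClass.rep]
    ring
  | VIII _ _ _ h =>
    have h0 : α + γ ≠ 0 := fun h' => h (by linarith)
    obtain ⟨r, ε, hr, hε, hrγ⟩ := exists_sq_mul_isSign h0
    have h1 : DoubleRel (C5 0) α β γ (C5 0) 0 0 ε :=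
      (doubleRel_C5_zero α β γ).trans (tripleRel_rotation (by simp [C5]) (by simp [C5]) r 0
        (by positivity) (by ring) (by ring) (by rw [← hrγ]; ring)).doubleRel
    rcases hε with rfl | rfl
    · exact h1
    · have := h1.trans (tripleRel_C5_zero _ _ _).doubleRel
      simpa [SuperdoubleClass.rep] using this
  | IX _ _ _ h => exact (tripleRel_A12_of_pos h).doubleRel
  | X _ _ _ h h' => exact (tripleRel_A12_of_eq h h').doubleRel

/-! ### Invariants of superdoubles -/

/-- Isomorphic superdoubles have proportional operators `ad b₁`. -/
theorem DoubleRel.exists_intertwining {H H' : Matrix (Fin 2) (Fin 2) ℝ} {α β γ α' β' γ' : ℝ}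
    (h : DoubleRel H α β γ H' α' β' γ') :
    ∃ t : ℝ, t ≠ 0 ∧ ∃ P : TripleSpace ≃ₗ[ℝ] TripleSpace,
      (∀ x y, tripleForm (P x) (P y) = tripleForm x y) ∧
      ∀ x, P (tripleBracket H α β γ evenLeft x) = t • tripleBracket H' α' β' γ' evenLeft (P x) := by
  obtain ⟨P, hP⟩ := h
  have hform : ∀ x y, tripleForm (P x) (P y) = tripleForm x y := hP.map_form
  have hbr : ∀ x y, P (tripleBracket H α β γ x y) = tripleBracket H' α' β' γ' (P x) (P y) :=
    hP.map_bracket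
  have hmem : P evenLeft ∈ triplePart 0 := (hP.map_part 0 _).2 evenLeft_mem
  have he := eq_even_of_mem hmem
  set t := (P evenLeft).1.1
  set r := (P evenLeft).2.1
  -- The vector `b₁` is null, so its even image is a multiple of `b₁` or of `b̃¹`.
  have htr : t * r = 0 := by
    have h1 := hform evenLeft evenLeft
    rw [he] at h1
    simp [tripleForm_apply, evenLeft, evenRight] at h1
    rcases mul_eq_zero.1 (by linarith : (2 * t) * r = 0) with h2 | h2
    · rw [(by linarith : t = 0), zero_mul]
    · rw [h2, mul_zero]
  rcases mul_eq_zero.1 htr with h0 | h0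
  -- If `b₁` maps to a multiple of `b̃¹`, it acts by zero. Then every even vector does, in both
  -- superdoubles, and any factor works.
  · rw [h0, zero_smul, zero_add] at he
    have hl : ∀ x, tripleBracket H α β γ evenLeft x = 0 := by
      intro x
      have := hbr evenLeft x
      rw [he, map_smul, LinearMap.smul_apply, tripleBracket_evenRight, smul_zero] at this
      simpa using this
    refine ⟨1, one_ne_zero, P, hform, fun x => ?_⟩
    have hmem' : P.symm evenLeft ∈ triplePart 0 := (hP.symm.map_part 0 _).2 evenLeft_mem
    have h1 := hbr (P.symm evenLeft) x
    rw [P.apply_symm_apply, eq_even_of_mem hmem'] at h1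
    rw [one_smul, ← h1, hl, map_zero]
    simp [hl, tripleBracket_evenRight]
  · rw [h0, zero_smul, add_zero] at he
    refine ⟨t, fun ht => ?_, P, hform, fun x => ?_⟩
    · rw [ht, zero_smul] at he
      have h1 : evenLeft = 0 := by simpa using he
      simpa [evenLeft] using congrArg (fun x : TripleSpace => x.1.1) h1
    · rw [hbr, he, map_smul, LinearMap.smul_apply]

theorem trace_tripleSpace (f : TripleSpace →ₗ[ℝ] TripleSpace) :
    LinearMap.trace ℝ TripleSpace f =
      (f ((1, 0), (0, 0))).1.1 + ((f ((0, ![1, 0]), (0, 0))).1.2 0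
        + (f ((0, ![0, 1]), (0, 0))).1.2 1) + ((f ((0, 0), (1, 0))).2.1
        + ((f ((0, 0), (0, ![1, 0]))).2.2 0 + (f ((0, 0), (0, ![0, 1]))).2.2 1)) := by
  let b := ((Basis.singleton Unit ℝ).prod (Pi.basisFun ℝ (Fin 2))).prod
    ((Basis.singleton Unit ℝ).prod (Pi.basisFun ℝ (Fin 2)))
  have h0 : (Pi.single 0 1 : Fin 2 → ℝ) = ![1, 0] := by
    ext i
    fin_cases i <;> simp
  have h1 : (Pi.single 1 1 : Fin 2 → ℝ) = ![0, 1] := by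
    ext i
    fin_cases i <;> simp
  rw [LinearMap.trace_eq_matrix_trace ℝ b, Matrix.trace]
  simp [Fintype.sum_sum_type, LinearMap.toMatrix_apply, b, h0, h1]
  rfl

/-- The trace of the square of `ad b₁` is twice that of `H ^ 2`, and likewise for fourth powers. -/
theorem DoubleRel.exists_trace_eq {H H' : Matrix (Fin 2) (Fin 2) ℝ} {α β γ α' β' γ' : ℝ}
    (h : DoubleRel H α β γ H' α' β' γ') :
    ∃ μ : ℝ, 0 < μ ∧ (H ^ 2).trace = μ * (H' ^ 2).trace ∧
      (H ^ 4).trace = μ ^ 2 * (H' ^ 4).trace := by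
  -- On the odd part `ad b₁` is block triangular with diagonal blocks `Hᵀ` and `-H`; `G` sits off
  -- the diagonal and does not affect traces.
  have key : ∀ (H : Matrix (Fin 2) (Fin 2) ℝ) (α β γ : ℝ),
      LinearMap.trace ℝ _ (tripleBracket H α β γ evenLeft ^ 2) = 2 * (H ^ 2).trace ∧
      LinearMap.trace ℝ _ (tripleBracket H α β γ evenLeft ^ 4) = 2 * (H ^ 4).trace := by
    intro H α β γ
    have h4 : H ^ 4 = H ^ 2 * H ^ 2 := by rw [← pow_add]
    rw [h4]
    simp only [pow_succ, pow_zero, one_mul, trace_tripleSpace, Module.End.mul_apply,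
      tripleBracket_evenLeft, Matrix.trace_fin_two, Matrix.mul_apply, Fin.sum_univ_two,
      Pi.add_apply, Pi.neg_apply, vecMul_two, mulVec_two]
    constructor <;>
    · simp
      ring
  obtain ⟨t, ht, P, -, hP⟩ := h.exists_intertwining
  set X := tripleBracket H α β γ evenLeft with hX
  set X' := tripleBracket H' α' β' γ' evenLeft with hX'
  have hc : P.conj X = t • X' := by
    refine LinearMap.ext fun x => ?_
    rw [LinearEquiv.conj_apply_apply, hP, P.apply_symm_apply]
    rfl
  have hpow : ∀ n : ℕ, LinearMap.trace ℝ _ (X ^ n) = t ^ n * LinearMap.trace ℝ _ (X' ^ n) := by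
    intro n
    have h1 : P.conj (X ^ n) = (P.conj X) ^ n := map_pow (P.conjAlgEquiv ℝ) X n
    rw [← LinearMap.trace_conj' (X ^ n) P, h1, hc, smul_pow, map_smul, smul_eq_mul]
  have h2 := hpow 2
  have h4 := hpow 4
  rw [hX, hX', (key _ _ _ _).1, (key _ _ _ _).1] at h2
  rw [hX, hX', (key _ _ _ _).2, (key _ _ _ _).2] at h4
  exact ⟨t ^ 2, by positivity, by linarith, by linarith⟩

section Predicates

variable (H : Matrix (Fin 2) (Fin 2) ℝ) (α β γ : ℝ)

/-- `b₁` is central. -/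
def AdZero : Prop := ∀ x, tripleBracket H α β γ evenLeft x = 0

/-- The cube of `ad b₁` is a multiple of `ad b₁`. -/
def AdCubic : Prop :=
  ∃ k : ℝ, ∀ x, tripleBracket H α β γ evenLeft (tripleBracket H α β γ evenLeft
    (tripleBracket H α β γ evenLeft x)) = k • tripleBracket H α β γ evenLeft x

/-- The quadratic form of `ad b₁` is semidefinite. -/
def AdSemidefinite : Prop :=
  ∀ x y, 0 ≤ tripleForm (tripleBracket H α β γ evenLeft x) x *
    tripleForm (tripleBracket H α β γ evenLeft y) y

/-- The quadratic form of `ad b₁` has rank at most one. -/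
def AdRankOne : Prop :=
  ∀ x y, tripleForm (tripleBracket H α β γ evenLeft x) x *
    tripleForm (tripleBracket H α β γ evenLeft y) y =
      tripleForm (tripleBracket H α β γ evenLeft x) y ^ 2

end Predicates

section

variable {H H' : Matrix (Fin 2) (Fin 2) ℝ} {α β γ α' β' γ' : ℝ}

theorem DoubleRel.adZero (h : DoubleRel H α β γ H' α' β' γ') (h' : AdZero H' α' β' γ') :
    AdZero H α β γ := by
  obtain ⟨t, ht, P, -, hP⟩ := h.exists_intertwining
  intro x
  have := hP x
  rw [h', smul_zero] at this
  simpa using this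

theorem DoubleRel.adCubic (h : DoubleRel H α β γ H' α' β' γ') (h' : AdCubic H' α' β' γ') :
    AdCubic H α β γ := by
  obtain ⟨t, ht, P, -, hP⟩ := h.exists_intertwining
  obtain ⟨k, hk⟩ := h'
  refine ⟨t ^ 2 * k, fun x => P.injective ?_⟩
  rw [map_smul, hP, hP, hP, map_smul, map_smul, map_smul, hk]
  module

/-- The quadratic form is determined only up to a factor `t` of either sign; in a product of two
values it enters as `t²`. -/
theorem DoubleRel.adSemidefinite (h : DoubleRel H α β γ H' α' β' γ')
    (h' : AdSemidefinite H' α' β' γ') : AdSemidefinite H α β γ := by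
  obtain ⟨t, ht, P, hf, hP⟩ := h.exists_intertwining
  intro x y
  rw [← hf, ← hf _ y, hP, hP, map_smul, map_smul, LinearMap.smul_apply, LinearMap.smul_apply,
    smul_eq_mul, smul_eq_mul]
  have := mul_nonneg (sq_nonneg t) (h' (P x) (P y))
  linarith

theorem DoubleRel.adRankOne (h : DoubleRel H α β γ H' α' β' γ')
    (h' : AdRankOne H' α' β' γ') : AdRankOne H α β γ := by
  obtain ⟨t, ht, P, hf, hP⟩ := h.exists_intertwining
  intro x y
  rw [← hf, ← hf _ y, ← hf _ y, hP, hP, map_smul, map_smul, LinearMap.smul_apply,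
    LinearMap.smul_apply, LinearMap.smul_apply, smul_eq_mul, smul_eq_mul, smul_eq_mul]
  linear_combination t ^ 2 * h' (P x) (P y)

theorem tripleForm_ad (x y : TripleSpace) :
    tripleForm (tripleBracket H α β γ evenLeft x) y =
      (x.1.2 0 * H 0 0 + x.1.2 1 * H 1 0 + (x.2.2 0 * α + x.2.2 1 * β)) * y.2.2 0 +
      (x.1.2 0 * H 0 1 + x.1.2 1 * H 1 1 + (x.2.2 0 * β + x.2.2 1 * γ)) * y.2.2 1 +
      ((H 0 0 * x.2.2 0 + H 0 1 * x.2.2 1) * y.1.2 0 +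
        (H 1 0 * x.2.2 0 + H 1 1 * x.2.2 1) * y.1.2 1) := by
  rw [tripleBracket_evenLeft, tripleForm_apply]
  simp only [dotProduct, Fin.sum_univ_two, Pi.add_apply, Pi.neg_apply, vecMul_two, mulVec_two,
    matN, Matrix.of_apply, Matrix.cons_val', Matrix.cons_val_zero, Matrix.cons_val_one]
  ring

end

/-! ### The spectrum up to scale, and the separation of classes sharing it. -/

/-- The eigenvalues of `ad b₁`, up to a common factor. -/
inductive Spectrum : Type
  | nilpotent
  | real (p : ℝ)
  | complex (p : ℝ)

def SuperdoubleClass.spectrum : SuperdoubleClass → Spectrum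
  | .I => .nilpotent
  | .II p => .real p
  | .II_one => .real 1
  | .II_zero => .real 0
  | .III => .nilpotent
  | .IV => .real 1
  | .V p => .complex p
  | .V_zero => .complex 0
  | .VI => .real 0
  | .VII => .nilpotent
  | .VIII => .complex 0
  | .IX => .nilpotent
  | .X => .nilpotent

/-- Eigenvalues come in pairs `±λ` and matter up to a common real factor; each possibility has one
representative in this range. -/
def Spectrum.IsReduced : Spectrum → Prop
  | .nilpotent => True
  | .real p => 0 ≤ p ∧ p ≤ 1
  | .complex p => 0 ≤ p

/-- The sum runs over one eigenvalue from each pair `±λ`: over `1, p` or over `p ± i`. -/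
def Spectrum.traceSq : Spectrum → ℝ
  | .nilpotent => 0
  | .real p => 1 + p ^ 2
  | .complex p => 2 * (p ^ 2 - 1)

def Spectrum.traceFourth : Spectrum → ℝ
  | .nilpotent => 0
  | .real p => 1 + p ^ 4
  | .complex p => 2 * (p ^ 4 - 6 * p ^ 2 + 1)

theorem SuperdoubleClass.isReduced_spectrum (c : SuperdoubleClass) : c.spectrum.IsReduced := by
  cases c with
  | II p => exact ⟨p.2.1.le, p.2.2.le⟩
  | V p => exact le_of_lt p.2
  | _ => norm_num [spectrum, Spectrum.IsReduced]

theorem SuperdoubleClass.trace_rep (c : SuperdoubleClass) :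
    (c.rep.1 ^ 2).trace = c.spectrum.traceSq ∧ (c.rep.1 ^ 4).trace = c.spectrum.traceFourth := by
  have h4 : c.rep.1 ^ 4 = c.rep.1 ^ 2 * c.rep.1 ^ 2 := by rw [← pow_add]
  rw [h4]
  simp only [pow_two, Matrix.trace_fin_two, Matrix.mul_apply, Fin.sum_univ_two]
  cases c <;> simp [rep, A12, C2, C3, C4, C5, spectrum, Spectrum.traceSq, Spectrum.traceFourth] <;>
    first
    | done
    | (constructor <;> ring)

/-- These are the first two power sums of the squared eigenvalues, so the product and squared
difference of the latter are known up to `μ²`. The sign of the squared difference tells real from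
complex; the product and the first power sum then determine `p`. -/
theorem Spectrum.eq_of_trace {S T : Spectrum} (hS : S.IsReduced) (hT : T.IsReduced) {μ : ℝ}
    (hμ : 0 < μ) (h2 : S.traceSq = μ * T.traceSq) (h4 : S.traceFourth = μ ^ 2 * T.traceFourth) :
    S = T := by
  cases S with
  | nilpotent =>
    cases T with
    | nilpotent => rfl
    | real p =>
      simp only [traceSq] at h2
      have : 0 < μ * (1 + p ^ 2) := by positivity
      linarith
    | complex p =>
      simp only [traceSq, traceFourth] at h2 h4
      have : 0 < 2 * (μ * (p ^ 2 + 1)) ^ 2 := by positivity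
      nlinarith
  | real p =>
    cases T with
    | nilpotent =>
      simp only [traceSq] at h2
      have : 0 < 1 + p ^ 2 := by positivity
      linarith
    | real q =>
      simp only [traceSq, traceFourth, IsReduced] at h2 h4 hS hT
      -- Compare `(traceSq² - traceFourth) / 2`, the product of the squared eigenvalues.
      have h5 : p ^ 2 = (μ * q) ^ 2 := by
        linear_combination (1 / 2 * (1 + p ^ 2) + 1 / 2 * μ * (1 + q ^ 2)) * h2 - 1 / 2 * h4
      have h6 : p = μ * q := by
        rwa [sq_eq_sq₀ hS.1 (mul_nonneg hμ.le hT.1)] at h5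
      -- Either `μ = 1`, or `p q = 1`, which in the reduced range means `p = q = 1`.
      have h7 : (1 - μ) * (1 - p * q) = 0 := by
        rw [h6] at h2 ⊢
        linear_combination h2
      rcases mul_eq_zero.1 h7 with h | h
      · rw [h6, (by linarith : μ = 1), one_mul]
      · congr 1
        nlinarith [hS.1, hS.2, hT.1, hT.2]
    | complex q =>
      simp only [traceSq, traceFourth, IsReduced] at h2 h4 hS hT
      -- Compare `2 traceFourth - traceSq²`, the squared difference of the squared eigenvalues.
      have h5 : (1 - p ^ 2) ^ 2 + 16 * (μ * q) ^ 2 = 0 := by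
        linear_combination 2 * h4 - (1 + p ^ 2 + μ * (2 * (q ^ 2 - 1))) * h2
      have h6 : μ * q = 0 := by
        have : (μ * q) ^ 2 = 0 := by nlinarith [sq_nonneg (1 - p ^ 2), sq_nonneg (μ * q)]
        exact pow_eq_zero_iff two_ne_zero |>.1 this
      have h7 : q = 0 := (mul_eq_zero.1 h6).resolve_left hμ.ne'
      rw [h7] at h2
      nlinarith [sq_nonneg p]
  | complex p =>
    cases T with
    | nilpotent =>
      simp only [traceSq, traceFourth] at h2 h4
      have : 0 < 2 * (p ^ 2 + 1) ^ 2 := by positivity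
      nlinarith
    | real q =>
      simp only [traceSq, traceFourth, IsReduced] at h2 h4 hS hT
      have h5 : (μ * (1 - q ^ 2)) ^ 2 + 16 * p ^ 2 = 0 := by
        linear_combination -2 * h4 + (2 * (p ^ 2 - 1) + μ * (1 + q ^ 2)) * h2
      have h6 : p ^ 2 = 0 := by nlinarith [sq_nonneg (μ * (1 - q ^ 2)), sq_nonneg p]
      rw [h6] at h2
      have : 0 < μ * (1 + q ^ 2) := by positivity
      linarith
    | complex q =>
      simp only [traceSq, traceFourth, IsReduced] at h2 h4 hS hT
      have h5 : (p ^ 2 + 1) ^ 2 = (μ * (q ^ 2 + 1)) ^ 2 := by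
        linear_combination (p ^ 2 - 1 + μ * (q ^ 2 - 1)) * h2 - 1 / 2 * h4
      rw [sq_eq_sq₀ (by positivity) (by positivity)] at h5
      have h6 : μ = 1 := by linarith
      rw [h6] at h5
      have h7 : p ^ 2 = q ^ 2 := by linarith
      rw [sq_eq_sq₀ hS hT] at h7
      rw [h7]

/-- The relation is odd in `H`, so it also holds for the other block `-H`. -/
theorem adCubic_of_mul {H : Matrix (Fin 2) (Fin 2) ℝ} {k : ℝ} (hH : H * H * H = k • H) :
    AdCubic H 0 0 0 := by
  have h0 : matN 0 0 0 = 0 := by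
    ext i j
    fin_cases i <;> fin_cases j <;> rfl
  refine ⟨k, fun x => ?_⟩
  simp only [tripleBracket_evenLeft, h0, Matrix.vecMul_zero, add_zero, Matrix.vecMul_vecMul,
    Matrix.mulVec_neg, Matrix.mulVec_mulVec, neg_neg, hH, ← Matrix.mul_assoc]
  refine Prod.ext (Prod.ext ?_ ?_) (Prod.ext ?_ ?_)
  · simp
  · simp only [Matrix.vecMul_smul, Prod.smul_fst, Prod.smul_snd]
  · simp
  · simp only [Matrix.smul_mulVec, Prod.smul_snd, smul_neg]

theorem adCubic_A12 (α β γ : ℝ) : AdCubic A12 α β γ := by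
  refine ⟨0, fun x => ?_⟩
  simp only [tripleBracket_evenLeft, A12, Matrix.vecMul_zero, Matrix.zero_mulVec, neg_zero,
    Matrix.zero_vecMul, add_zero, zero_smul]
  rfl

theorem SuperdoubleClass.adCubic_rep : ∀ c ∈ ({.II_one, .II_zero, .III, .V_zero, .IX, .X} :
    Set SuperdoubleClass), AdCubic c.rep.1 c.rep.2.1 c.rep.2.2.1 c.rep.2.2.2 := by
  rintro c (rfl | rfl | rfl | rfl | rfl | rfl)
  · refine adCubic_of_mul (k := 1) ?_
    simp [rep, C2]
  · refine adCubic_of_mul (k := 1) ?_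
    ext i j
    fin_cases i <;> fin_cases j <;> simp [rep, C2]
  · exact adCubic_A12 _ _ _
  · refine adCubic_of_mul (k := -1) ?_
    simp [rep, C5]
  · exact adCubic_A12 _ _ _
  · exact adCubic_A12 _ _ _

/-- The obstruction is a Jordan block at a nonzero eigenvalue (`IV`, `VIII`), a nilpotent block
beside the eigenvalue `1` (`VI`), or a nonzero cube of a nilpotent operator (`VII`). -/
theorem SuperdoubleClass.not_adCubic_rep : ∀ c ∈ ({.IV, .VI, .VII, .VIII} :
    Set SuperdoubleClass), ¬AdCubic c.rep.1 c.rep.2.1 c.rep.2.2.1 c.rep.2.2.2 := by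
  rintro c (rfl | rfl | rfl | rfl) ⟨k, hk⟩
  · have h1 := congrFun (congrArg (fun x : TripleSpace => x.1.2) (hk ((0, ![0, 1]), (0, 0)))) 0
    have h2 := congrFun (congrArg (fun x : TripleSpace => x.1.2) (hk ((0, ![0, 1]), (0, 0)))) 1
    simp [tripleBracket_evenLeft, rep, C4] at h1 h2
    linarith
  · have h1 := congrFun (congrArg (fun x : TripleSpace => x.1.2) (hk ((0, ![1, 0]), (0, 0)))) 0
    have h2 := congrFun (congrArg (fun x : TripleSpace => x.1.2) (hk ((0, 0), (0, ![0, 1])))) 1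
    simp [tripleBracket_evenLeft, rep, C2, matN] at h1 h2
    linarith
  · have h1 := congrFun (congrArg (fun x : TripleSpace => x.1.2) (hk ((0, 0), (0, ![1, 0])))) 0
    simp [tripleBracket_evenLeft, rep, C3, matN, Matrix.vecHead, Matrix.vecTail] at h1
  · have h1 := congrFun (congrArg (fun x : TripleSpace => x.1.2) (hk ((0, 0), (0, ![0, 1])))) 1
    have h2 := congrFun (congrArg (fun x : TripleSpace => x.2.2) (hk ((0, 0), (0, ![0, 1])))) 0
    simp [tripleBracket_evenLeft, rep, C5, matN] at h1 h2
    linarith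

theorem adZero_I : AdZero A12 0 0 0 := by
  intro x
  have h0 : matN 0 0 0 = 0 := by
    ext i j
    fin_cases i <;> fin_cases j <;> rfl
  simp only [tripleBracket_evenLeft, A12, h0, Matrix.vecMul_zero, Matrix.zero_mulVec, neg_zero,
    add_zero]
  rfl

theorem not_adZero_A12 {β γ : ℝ} : ¬AdZero A12 1 β γ := by
  intro h
  have h1 := congrFun (congrArg (fun x : TripleSpace => x.1.2) (h ((0, 0), (0, ![1, 0])))) 0
  simp [tripleBracket_evenLeft, A12, matN] at h1

theorem adSemidefinite_A12 {γ : ℝ} (hγ : 0 ≤ γ) : AdSemidefinite A12 1 0 γ := by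
  have h : ∀ x, 0 ≤ tripleForm (tripleBracket A12 1 0 γ evenLeft x) x := by
    intro x
    rw [tripleForm_ad]
    simp only [A12, Matrix.zero_apply]
    have := mul_nonneg hγ (sq_nonneg (x.2.2 1))
    nlinarith [sq_nonneg (x.2.2 0)]
  exact fun x y => mul_nonneg (h x) (h y)

theorem not_adSemidefinite_III : ¬AdSemidefinite A12 1 0 (-1) := by
  intro h
  have := h ((0, 0), (0, ![1, 0])) ((0, 0), (0, ![0, 1]))
  simp only [tripleForm_ad, A12] at this
  norm_num at this

theorem adRankOne_X : AdRankOne A12 1 0 0 := by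
  intro x y
  simp only [tripleForm_ad, A12, Matrix.zero_apply]
  ring

theorem not_adRankOne_IX : ¬AdRankOne A12 1 0 1 := by
  intro h
  have := h ((0, 0), (0, ![1, 0])) ((0, 0), (0, ![0, 1]))
  simp only [tripleForm_ad, A12] at this
  norm_num at this

/-- The classes sharing a spectrum are `II_one`, `IV`; `II_zero`, `VI`; `V_zero`, `VIII`; and the
nilpotent `I`, `III`, `VII`, `IX`, `X`. Each such pair is excluded in one of its two orders. -/
theorem SuperdoubleClass.separated {c c' : SuperdoubleClass}
    (h : DoubleRel c.rep.1 c.rep.2.1 c.rep.2.2.1 c.rep.2.2.2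
      c'.rep.1 c'.rep.2.1 c'.rep.2.2.1 c'.rep.2.2.2) :
    ¬(c ∈ ({.II_one, .II_zero, .III, .V_zero, .IX, .X} : Set SuperdoubleClass) ∧
      c' ∈ ({.IV, .VI, .VII, .VIII} : Set SuperdoubleClass)) ∧
    ¬(c = .I ∧ c' ∈ ({.III, .VII, .IX, .X} : Set SuperdoubleClass)) ∧
    ¬(c ∈ ({.IX, .X} : Set SuperdoubleClass) ∧ c' = .III) ∧ ¬(c = .X ∧ c' = .IX) := by
  refine ⟨?_, ?_, ?_, ?_⟩
  · rintro ⟨h1, h2⟩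
    exact not_adCubic_rep _ h2 (h.symm.adCubic (adCubic_rep _ h1))
  · rintro ⟨rfl, rfl | rfl | rfl | rfl⟩
    · exact not_adZero_A12 (h.symm.adZero adZero_I)
    · exact not_adCubic_rep .VII (by simp) (h.symm.adCubic (adCubic_A12 _ _ _))
    · exact not_adZero_A12 (h.symm.adZero adZero_I)
    · exact not_adZero_A12 (h.symm.adZero adZero_I)
  · rintro ⟨rfl | rfl, rfl⟩
    · exact not_adSemidefinite_III (h.symm.adSemidefinite (adSemidefinite_A12 zero_le_one))
    · exact not_adSemidefinite_III (h.symm.adSemidefinite (adSemidefinite_A12 le_rfl))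
  · rintro ⟨rfl, rfl⟩
    exact not_adRankOne_IX (h.symm.adRankOne adRankOne_X)

/-- The representatives of different classes are not isomorphic. -/
theorem SuperdoubleClass.eq_of_doubleRel_rep {c c' : SuperdoubleClass}
    (h : DoubleRel c.rep.1 c.rep.2.1 c.rep.2.2.1 c.rep.2.2.2
      c'.rep.1 c'.rep.2.1 c'.rep.2.2.1 c'.rep.2.2.2) : c = c' := by
  obtain ⟨μ, hμ, h2, h4⟩ := h.exists_trace_eq
  rw [c.trace_rep.1, c'.trace_rep.1] at h2
  rw [c.trace_rep.2, c'.trace_rep.2] at h4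
  have hs := Spectrum.eq_of_trace c.isReduced_spectrum c'.isReduced_spectrum hμ h2 h4
  have h1 := separated h
  have h2 := separated h.symm
  clear h
  have a0 : ∀ p : Set.Ioo (0 : ℝ) 1, ¬(p : ℝ) = 0 := fun p => p.2.1.ne'
  have a1 : ∀ p : Set.Ioo (0 : ℝ) 1, ¬(p : ℝ) = 1 := fun p => p.2.2.ne
  have b0 : ∀ p : Set.Ioi (0 : ℝ), ¬(p : ℝ) = 0 := fun p => ne_of_gt p.2
  have a0' : ∀ p : Set.Ioo (0 : ℝ) 1, ¬0 = (p : ℝ) := fun p => p.2.1.ne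
  have a1' : ∀ p : Set.Ioo (0 : ℝ) 1, ¬1 = (p : ℝ) := fun p => p.2.2.ne'
  have b0' : ∀ p : Set.Ioi (0 : ℝ), ¬0 = (p : ℝ) := fun p => ne_of_lt p.2
  cases c <;> cases c' <;> simp [spectrum, a0, a1, b0, a0', a1', b0', Subtype.ext_iff] at hs h1 h2 ⊢
  all_goals exact hs

/-! ### The rows of the table for a given superalgebra `C` -/

section Inversion

variable {α β γ : ℝ}

theorem InTable.of_A12 (h : InTable A12 α β γ) :
    (α = 0 ∧ β = 0 ∧ γ = 0) ∨ (α = 1 ∧ β = 0 ∧ (γ = 0 ∨ γ = 1 ∨ γ = -1)) := by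
  -- The index must become a variable before case analysis; rows with another `C` are then refuted
  -- by comparing matrix entries.
  generalize hH : A12 = H at h
  cases h with
  | row1 => simp
  | row2 => simp
  | row3 ε hε => exact Or.inr ⟨rfl, rfl, Or.inr hε⟩
  | _ => simp [A12, C2, C3, C4, C5, ← Matrix.ext_iff, Fin.forall_fin_two] at hH

theorem InTable.of_C2 {p : ℝ} (hp : |p| < 1) (h : InTable (C2 p) α β γ) :
    (α = 0 ∧ (β = 0 ∨ β = 1) ∧ γ = 0) ∨ (α = 0 ∧ (β = 0 ∨ β = 1) ∧ IsSign γ) ∨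
    (IsSign α ∧ (β = 0 ∨ β = 1) ∧ γ = 0) ∨ (IsSign α ∧ 0 ≤ β ∧ IsSign γ) := by
  have hp1 : ¬p = 1 := by
    rintro rfl
    norm_num at hp
  have hp2 : ¬p = -1 := by
    rintro rfl
    norm_num at hp
  generalize hH : C2 p = H at h
  cases h with
  | row4 => simp
  | row5 => simp
  | row6 p δ ε hp hδ hε => exact Or.inr (Or.inl ⟨rfl, hδ, hε⟩)
  | row7 p δ ε hp hδ hε => exact Or.inr (Or.inr (Or.inl ⟨hε, hδ, rfl⟩))
  | row8 p κ ε ε' hp hκ hε hε' => exact Or.inr (Or.inr (Or.inr ⟨hε, hκ, hε'⟩))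
  | _ => simp [A12, C2, C3, C4, C5, ← Matrix.ext_iff, Fin.forall_fin_two, hp1, hp2] at hH

theorem InTable.of_C2_one (h : InTable (C2 1) α β γ) :
    β = 0 ∧ ((α = 0 ∧ γ = 0) ∨ (IsSign α ∧ γ = α) ∨ (α = 1 ∧ γ = -1) ∨ (α = 0 ∧ IsSign γ)) := by
  generalize hH : C2 1 = H at h
  cases h with
  | row4 p hp | row5 p hp | row6 p _ _ hp | row7 p _ _ hp | row8 p _ _ _ hp =>
    simp [C2] at hH
    rw [← hH] at hp
    norm_num at hp
  | row9 => simp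
  | row10 ε hε => simp [hε]
  | row11 => simp
  | row12 ε hε => simp [hε]
  | row13 | row14 | row15 | row16 | row17 =>
    simp [C2] at hH
    norm_num at hH
  | _ => simp [A12, C2, C3, C4, C5, ← Matrix.ext_iff, Fin.forall_fin_two] at hH

theorem InTable.of_C2_neg_one (h : InTable (C2 (-1)) α β γ) :
    (α = 0 ∧ (β = 0 ∨ β = 1) ∧ γ = 0) ∨ (α = 0 ∧ (β = 0 ∨ β = 1) ∧ IsSign γ) ∨
    (α = 1 ∧ 0 ≤ β ∧ γ = 1) ∨ (IsSign α ∧ 0 ≤ β ∧ γ = -α) := by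
  generalize hH : C2 (-1) = H at h
  cases h with
  | row4 p hp | row5 p hp | row6 p _ _ hp | row7 p _ _ hp | row8 p _ _ _ hp =>
    simp [C2] at hH
    rw [← hH] at hp
    norm_num at hp
  | row9 | row10 | row11 | row12 =>
    simp [C2] at hH
    norm_num at hH
  | row13 => simp
  | row14 => simp
  | row15 δ ε hδ hε => exact Or.inr (Or.inl ⟨rfl, hδ, hε⟩)
  | row16 κ hκ => simp [hκ]
  | row17 κ ε hκ hε => simp [hκ, hε]
  | _ => simp [A12, C2, C3, C4, C5, ← Matrix.ext_iff, Fin.forall_fin_two] at hH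

theorem InTable.of_C3 (h : InTable C3 α β γ) :
    (γ = 1 ∧ β = 0 ∧ (α = 0 ∨ IsSign α)) ∨
    (γ = 0 ∧ ((β = 0 ∧ (α = 0 ∨ α = 1)) ∨ (α = 0 ∧ IsSign β))) := by
  generalize hH : C3 = H at h
  cases h with
  | row18 => simp
  | row19 ε hε => simp [hε]
  | row20 => simp
  | row21 ε hε => simp [hε]
  | row22 => simp
  | _ => simp [A12, C2, C3, C4, C5, ← Matrix.ext_iff, Fin.forall_fin_two] at hH

theorem InTable.of_C4 (h : InTable C4 α β γ) :
    (IsSign γ ∧ β = 0) ∨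
    (γ = 0 ∧ ((β = 0 ∧ (α = 0 ∨ IsSign α)) ∨ (α = 0 ∧ IsSign β))) := by
  generalize hH : C4 = H at h
  cases h with
  | row23 => simp
  | row24 ε hε => simp [hε]
  | row25 ε hε => simp [hε]
  | row26 κ ε hε => simp [hε]
  | _ => simp [A12, C2, C3, C4, C5, ← Matrix.ext_iff, Fin.forall_fin_two] at hH

theorem InTable.of_C5 {p : ℝ} (hp : 0 < p) (h : InTable (C5 p) α β γ) :
    β = 0 ∧ ((α = 0 ∧ γ = 0) ∨ (-1 < α ∧ α ≤ 1 ∧ γ = 1) ∨ (-1 ≤ α ∧ α ≤ 1 ∧ γ = -1)) := by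
  generalize hH : C5 p = H at h
  cases h with
  | row27 => simp
  | row28 p κ ε hp hκ hκ' hε =>
    rcases hε with rfl | rfl
    · exact ⟨rfl, Or.inr (Or.inl ⟨hκ, hκ', rfl⟩)⟩
    · exact ⟨rfl, Or.inr (Or.inr ⟨hκ.le, hκ', rfl⟩)⟩
  | row29 => exact ⟨rfl, Or.inr (Or.inr (by norm_num))⟩
  | _ => simp [A12, C2, C3, C4, C5, ← Matrix.ext_iff, Fin.forall_fin_two, hp.ne'] at hH

theorem InTable.of_C5_zero (h : InTable (C5 0) α β γ) :
    β = 0 ∧ ((α = 0 ∧ γ = 0) ∨ (-1 ≤ α ∧ α ≤ 1 ∧ γ = 1)) := by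
  generalize hH : C5 0 = H at h
  cases h with
  | row27 p hp | row28 p _ _ hp | row29 p hp =>
    simp [C5] at hH
    exact absurd hH hp.ne
  | row30 => simp
  | row31 κ hκ hκ' => exact ⟨rfl, Or.inr ⟨hκ, hκ', rfl⟩⟩
  | _ => simp [A12, C2, C3, C4, C5, ← Matrix.ext_iff, Fin.forall_fin_two] at hH

theorem InTable.isNormalMatrix {H : Matrix (Fin 2) (Fin 2) ℝ} (h : InTable H α β γ) :
    IsNormalMatrix H := by
  cases h with
  | row1 | row2 | row3 => exact .A12
  | row4 p hp | row5 p hp | row6 p _ _ hp | row7 p _ _ hp | row8 p _ _ _ hp => exact .C2 p hp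
  | row9 | row10 | row11 | row12 => exact .C2_one
  | row13 | row14 | row15 | row16 | row17 => exact .C2_neg_one
  | row18 | row19 | row20 | row21 | row22 => exact .C3
  | row23 | row24 | row25 | row26 => exact .C4
  | row27 p hp | row28 p _ _ hp | row29 p hp => exact .C5 p hp
  | row30 | row31 => exact .C5_zero

end Inversion

/-! ### Isomorphic supertriples have the same superalgebra `C` -/

namespace TripleChange

variable {H H' : Matrix (Fin 2) (Fin 2) ℝ} {α β γ α' β' γ' s a b c d : ℝ}

theorem trace_eq (h : TripleChange H α β γ H' α' β' γ' s a b c d) :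
    H' 0 0 + H' 1 1 = s * (H 0 0 + H 1 1) := by
  refine mul_left_cancel₀ h.det_ne ?_
  linear_combination d * h.h00 - b * h.h10 - c * h.h01 + a * h.h11

theorem det_eq (h : TripleChange H α β γ H' α' β' γ' s a b c d) :
    H' 0 0 * H' 1 1 - H' 0 1 * H' 1 0 = s ^ 2 * (H 0 0 * H 1 1 - H 0 1 * H 1 0) := by
  refine mul_left_cancel₀ h.det_ne ?_
  linear_combination (c * H' 0 1 + d * H' 1 1) * h.h00 + s * (H 0 0 * a + H 0 1 * c) * h.h11
    - (c * H' 0 0 + d * H' 1 0) * h.h01 - s * (H 0 0 * b + H 0 1 * d) * h.h10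

theorem disc_matrix_eq (h : TripleChange H α β γ H' α' β' γ' s a b c d) :
    (H' 0 0 - H' 1 1) ^ 2 + 4 * (H' 0 1 * H' 1 0) =
      s ^ 2 * ((H 0 0 - H 1 1) ^ 2 + 4 * (H 0 1 * H 1 0)) := by
  linear_combination (H' 0 0 + H' 1 1 + s * (H 0 0 + H 1 1)) * h.trace_eq - 4 * h.det_eq

theorem scalar (h : TripleChange H α β γ H' α' β' γ' s a b c d)
    (hH : H 0 1 = 0 ∧ H 1 0 = 0 ∧ H 0 0 = H 1 1) :
    H' 0 1 = 0 ∧ H' 1 0 = 0 ∧ H' 0 0 = H' 1 1 := by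
  obtain ⟨h1, h2, h3⟩ := hH
  have e00 := h.h00
  have e01 := h.h01
  have e10 := h.h10
  have e11 := h.h11
  rw [h1, h3] at e00 e01
  rw [h2] at e10 e11
  refine ⟨mul_left_cancel₀ h.det_ne ?_, mul_left_cancel₀ h.det_ne ?_,
    mul_left_cancel₀ h.det_ne ?_⟩
  · linear_combination d * e01 - b * e11
  · linear_combination a * e10 - c * e00
  · linear_combination d * e00 - b * e10 + c * e01 - a * e11

theorem scale_sq_eq_one {p q : ℝ} (h : TripleChange (C5 p) α β γ (C5 q) α' β' γ' s a b c d) :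
    s ^ 2 = 1 := by
  have := h.disc_matrix_eq
  norm_num [C5] at this
  rcases this with rfl | rfl <;> norm_num

end TripleChange

theorem isNormalMatrix_cases {H : Matrix (Fin 2) (Fin 2) ℝ} (h : IsNormalMatrix H) :
    H = A12 ∨ H = C2 1 ∨ H = C3 ∨ H = C4 ∨ (∃ p, -1 ≤ p ∧ p < 1 ∧ H = C2 p) ∨
      ∃ p, 0 ≤ p ∧ H = C5 p := by
  cases h with
  | A12 => simp
  | C2 p hp =>
    rw [abs_lt] at hp
    exact Or.inr (Or.inr (Or.inr (Or.inr (Or.inl ⟨p, hp.1.le, hp.2, rfl⟩))))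
  | C2_one => simp
  | C2_neg_one =>
    exact Or.inr (Or.inr (Or.inr (Or.inr (Or.inl ⟨-1, le_rfl, by norm_num, rfl⟩))))
  | C3 => simp
  | C4 => simp
  | C5 p hp => exact Or.inr (Or.inr (Or.inr (Or.inr (Or.inr ⟨p, hp.le, rfl⟩))))
  | C5_zero => exact Or.inr (Or.inr (Or.inr (Or.inr (Or.inr ⟨0, le_rfl, rfl⟩))))

/-- The trace scales by `s`, the discriminant by `s²`, and being scalar is preserved in both
directions; this separates the normal forms. -/
theorem TripleRel.eq_of_isNormalMatrix {H H' : Matrix (Fin 2) (Fin 2) ℝ}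
    {α β γ α' β' γ' : ℝ} (hr : TripleRel H α β γ H' α' β' γ') (hH : IsNormalMatrix H)
    (hH' : IsNormalMatrix H') : H = H' := by
  obtain ⟨s, a, b, c, d, h⟩ := hr.exists_change
  obtain ⟨s', a', b', c', d', h'⟩ := hr.symm.exists_change
  have ht := h.trace_eq
  have hd := h.disc_matrix_eq
  have hs := h.scalar
  have hs' := h'.scalar
  have hpos : 0 < s ^ 2 := by
    have := h.scale_ne
    positivity
  have hs0 := h.scale_ne
  clear h h' hr
  rcases isNormalMatrix_cases hH with rfl | rfl | rfl | rfl | ⟨p, hp, hp', rfl⟩ | ⟨p, hp, rfl⟩ <;>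
    rcases isNormalMatrix_cases hH' with rfl | rfl | rfl | rfl | ⟨q, hq, hq', rfl⟩ | ⟨q, hq, rfl⟩ <;>
    clear hH hH' <;> try rfl
  all_goals try (simp [A12, C2, C3, C4, C5, hs0] at ht hd hs hs'; done)
  all_goals try (exfalso; simp [A12, C2, C3, C4, C5, hs0] at hd; linarith)
  · simp only [C2, Matrix.of_apply, Matrix.cons_val', Matrix.cons_val_zero,
      Matrix.cons_val_one] at ht hd
    congr 1
    rcases hp.lt_or_eq with hp | rfl
    -- The traces `1 + p > 0` and `1 + q ≥ 0` make `s` positive. Then `1 - p` also scales by `s`,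
    -- and adding the two relations gives `s = 1`.
    · have h1 : 0 < s := by
        refine lt_of_le_of_ne (le_of_not_gt fun h => ?_) hs0.symm
        nlinarith
      have h2 : (1 - q) ^ 2 = (s * (1 - p)) ^ 2 := by linear_combination hd
      rw [sq_eq_sq₀ (by linarith) (mul_nonneg h1.le (by linarith))] at h2
      have h3 : s = 1 := by linarith
      rw [h3] at h2
      linarith
    · linarith
  · simp only [C2, C5, Matrix.of_apply, Matrix.cons_val', Matrix.cons_val_zero,
      Matrix.cons_val_one] at ht hd
    nlinarith [sq_nonneg (s * (1 - p))]
  · simp only [C2, C5, Matrix.of_apply, Matrix.cons_val', Matrix.cons_val_zero,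
      Matrix.cons_val_one] at ht hd
    nlinarith [sq_nonneg (1 - q)]
  · simp only [C5, Matrix.of_apply, Matrix.cons_val', Matrix.cons_val_zero,
      Matrix.cons_val_one] at ht hd
    congr 1
    have h1 : s ^ 2 = 1 := by linarith
    have h2 : p ^ 2 = q ^ 2 := by
      linear_combination (-(1 / 2) * (q + s * p)) * ht - p ^ 2 * h1
    rwa [sq_eq_sq₀ hp hq] at h2

/-! ### Isomorphic supertriples in the table are equal -/

section Uniqueness

variable {α β γ α' β' γ' s a b c d : ℝ}

theorem IsSign.eq_of_mul_pos {x y t : ℝ} (hx : IsSign x) (hy : IsSign y) (ht : 0 ≤ t)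
    (h : y = t * x) : x = y := by
  rcases hx with rfl | rfl <;> rcases hy with rfl | rfl <;> first | rfl | (exfalso; linarith)

theorem IsSign.eq_of_sq_mul {x y t : ℝ} (hx : IsSign x) (hy : IsSign y)
    (h : y = t ^ 2 * x) : x = y :=
  hx.eq_of_mul_pos hy (sq_nonneg t) h

theorem IsSign.sq_eq_one_of_sq_mul {x y t : ℝ} (hx : IsSign x) (hy : IsSign y)
    (h : y = t ^ 2 * x) : t ^ 2 = 1 := by
  have := hx.eq_of_sq_mul hy h
  rw [← this] at h
  have h1 : (t ^ 2 - 1) * x = 0 := by linarith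
  linarith [(mul_eq_zero.1 h1).resolve_right hx.ne_zero]

theorem eq_of_zero_or_one {x y t : ℝ} (hx : x = 0 ∨ x = 1) (hy : y = 0 ∨ y = 1) (ht : t ≠ 0)
    (h : y = t * x) : x = y := by
  rcases hx with rfl | rfl
  · simpa using h.symm
  · rcases hy with rfl | rfl
    · exact absurd (by linarith) ht
    · rfl

theorem eq_of_nonneg_of_sq {x y t : ℝ} (hx : 0 ≤ x) (hy : 0 ≤ y) (ht : t ^ 2 = 1)
    (h : y = t * x) : x = y := by
  have : x ^ 2 = y ^ 2 := by
    rw [h]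
    linear_combination -x ^ 2 * ht
  rwa [sq_eq_sq₀ hx hy] at this

theorem TripleChange.eq_A12 (h : TripleChange A12 α β γ A12 α' β' γ' s a b c d)
    (ht : InTable A12 α β γ) (ht' : InTable A12 α' β' γ') :
    α = α' ∧ β = β' ∧ γ = γ' := by
  have h1 := h.hα
  obtain ⟨t, ht0, hd⟩ := h.tripleRel.disc_eq
  have h0 : 0 < t ^ 2 := by positivity
  have h4 := h.scale_ne
  have h5 := h.det_ne
  have h6 := h.hγ
  have h7 := h.hβ
  rcases ht.of_A12 with ⟨rfl, rfl, rfl⟩ | ⟨rfl, rfl, rfl | rfl | rfl⟩ <;>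
    rcases ht'.of_A12 with ⟨rfl, rfl, rfl⟩ | ⟨rfl, rfl, rfl | rfl | rfl⟩ <;>
    first
    | exact ⟨rfl, rfl, rfl⟩
    | (exfalso; linarith)
    | skip
  -- The case left is `(1, 0, 0)` against `(0, 0, 0)`, where `a = b = 0` contradicts invertibility.
  exfalso
  simp [h4] at h1 h6
  rw [h1, h6] at h5
  simp at h5

/-- The trace forces `s = 1` and the distinct eigenvalues force `A` to be diagonal. -/
theorem TripleChange.eq_C2 {p : ℝ} (hp : |p| < 1)
    (h : TripleChange (C2 p) α β γ (C2 p) α' β' γ' s a b c d)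
    (ht : InTable (C2 p) α β γ) (ht' : InTable (C2 p) α' β' γ') :
    α = α' ∧ β = β' ∧ γ = γ' := by
  rw [abs_lt] at hp
  have h1 := h.trace_eq
  have h2 := h.h01
  have h3 := h.h10
  simp [C2] at h1 h2 h3
  have hs : s = 1 := by
    have : (s - 1) * (1 + p) = 0 := by linarith
    linarith [(mul_eq_zero.1 this).resolve_right (by linarith)]
  subst hs
  have hb : b = 0 := by
    have : (1 - p) * b = 0 := by linarith
    exact (mul_eq_zero.1 this).resolve_left (by linarith)
  have hc : c = 0 := by
    have : (1 - p) * c = 0 := by linarith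
    exact (mul_eq_zero.1 this).resolve_left (by linarith)
  have hdet := h.det_ne
  have hα := h.hα
  have hβ := h.hβ
  have hγ := h.hγ
  simp [hb, hc] at hdet hα hβ hγ
  have had : a * d ≠ 0 := mul_ne_zero hdet.1 hdet.2
  have key : (α = 0 ↔ α' = 0) ∧ (γ = 0 ↔ γ' = 0) := by
    rw [hα, hγ]
    simp [hdet]
  rcases ht.of_C2 (abs_lt.2 hp) with ⟨rfl, hb1, rfl⟩ | ⟨rfl, hb1, hg⟩ | ⟨ha, hb1, rfl⟩ |
    ⟨ha, hb1, hg⟩ <;>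
  rcases ht'.of_C2 (abs_lt.2 hp) with ⟨rfl, hb1', rfl⟩ | ⟨rfl, hb1', hg'⟩ | ⟨ha', hb1', rfl⟩ |
    ⟨ha', hb1', hg'⟩ <;>
  first
  | exact absurd (key.1.1 rfl) (IsSign.ne_zero ‹_›)
  | exact absurd (key.1.2 rfl) (IsSign.ne_zero ‹_›)
  | exact absurd (key.2.1 rfl) (IsSign.ne_zero ‹_›)
  | exact absurd (key.2.2 rfl) (IsSign.ne_zero ‹_›)
  | skip
  · exact ⟨rfl, eq_of_zero_or_one hb1 hb1' had hβ, rfl⟩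
  · exact ⟨rfl, eq_of_zero_or_one hb1 hb1' had hβ, hg.eq_of_sq_mul hg' hγ⟩
  · exact ⟨ha.eq_of_sq_mul ha' hα, eq_of_zero_or_one hb1 hb1' had hβ, rfl⟩
  · refine ⟨ha.eq_of_sq_mul ha' hα, eq_of_nonneg_of_sq hb1 hb1' ?_ hβ, hg.eq_of_sq_mul hg' hγ⟩
    rw [mul_pow, ha.sq_eq_one_of_sq_mul ha' hα, hg.sq_eq_one_of_sq_mul hg' hγ, one_mul]

/-- Here `s = 1` and `A` is arbitrary, so this is Sylvester's law of inertia. -/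
theorem TripleChange.eq_C2_one (h : TripleChange (C2 1) α β γ (C2 1) α' β' γ' s a b c d)
    (ht : InTable (C2 1) α β γ) (ht' : InTable (C2 1) α' β' γ') :
    α = α' ∧ β = β' ∧ γ = γ' := by
  have h1 := h.trace_eq
  simp [C2] at h1
  have hs : s = 1 := by linarith
  subst hs
  obtain ⟨t, ht0, hd⟩ := h.tripleRel.disc_eq
  have h0 : 0 < t ^ 2 := by positivity
  have hdet := h.det_ne
  have hα := h.hα
  have hγ := h.hγ
  obtain ⟨rfl, hf⟩ := ht.of_C2_one
  obtain ⟨rfl, hf'⟩ := ht'.of_C2_one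
  simp only [mul_zero, add_zero, one_mul] at hα hγ
  rcases hf with ⟨rfl, rfl⟩ | ⟨ha, rfl⟩ | ⟨rfl, rfl⟩ | ⟨rfl, hg⟩ <;>
    rcases hf' with ⟨rfl, rfl⟩ | ⟨ha', rfl⟩ | ⟨rfl, rfl⟩ | ⟨rfl, hg'⟩
  · exact ⟨rfl, rfl, rfl⟩
  · exact absurd (by linarith) ha'.ne_zero
  · linarith
  · exact absurd (by linarith) hg'.ne_zero
  · rw [ha.mul_self] at hd
    linarith
  · have := ha.eq_of_mul_pos ha' (t := b ^ 2 + d ^ 2) (by positivity) (by linarith)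
    exact ⟨this, rfl, this⟩
  · rw [ha.mul_self] at hd
    linarith
  · rw [ha.mul_self] at hd
    linarith
  · linarith
  · linarith [ha'.mul_self]
  · exact ⟨rfl, rfl, rfl⟩
  · linarith
  · simp [hg.ne_zero] at hα hγ
    simp [hα, hγ] at hdet
  · linarith [ha'.mul_self]
  · linarith
  · exact ⟨rfl, rfl, hg.eq_of_sq_mul hg' (t := d) (by linarith)⟩

/-- The discriminant gives `s = ±1`; `A` is diagonal for `s = 1` and antidiagonal for `s = -1`. -/
theorem TripleChange.eq_C2_neg_one
    (h : TripleChange (C2 (-1)) α β γ (C2 (-1)) α' β' γ' s a b c d)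
    (ht : InTable (C2 (-1)) α β γ) (ht' : InTable (C2 (-1)) α' β' γ') :
    α = α' ∧ β = β' ∧ γ = γ' := by
  have h1 := h.disc_matrix_eq
  have h00 := h.h00
  have h01 := h.h01
  have h10 := h.h10
  have h11 := h.h11
  have hdet := h.det_ne
  have hα := h.hα
  have hβ := h.hβ
  have hγ := h.hγ
  norm_num [C2] at h1 h00 h01 h10 h11
  have key : ((α' = a ^ 2 * α ∧ β' = a * d * β ∧ γ' = d ^ 2 * γ) ∧ a ≠ 0 ∧ d ≠ 0) ∨
      ((α' = -(c ^ 2 * γ) ∧ β' = -(b * c) * β ∧ γ' = -(b ^ 2 * α)) ∧ b ≠ 0 ∧ c ≠ 0) := by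
    rcases h1 with rfl | rfl
    · obtain rfl : b = 0 := by linarith
      obtain rfl : c = 0 := by linarith
      simp at hdet
      exact Or.inl ⟨⟨by rw [hα]; ring, by rw [hβ]; ring, by rw [hγ]; ring⟩, hdet⟩
    · obtain rfl : a = 0 := by linarith
      obtain rfl : d = 0 := by linarith
      simp at hdet
      exact Or.inr ⟨⟨by rw [hα]; ring, by rw [hβ]; ring, by rw [hγ]; ring⟩, hdet⟩
  clear hα hβ hγ hdet h h1 h00 h01 h10 h11
  rcases key with ⟨⟨hα, hβ, hγ⟩, ha0, hd0⟩ | ⟨⟨hα, hβ, hγ⟩, hb0, hc0⟩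
  · have key : (α = 0 ↔ α' = 0) ∧ (γ = 0 ↔ γ' = 0) := by
      rw [hα, hγ]
      simp [ha0, hd0]
    have had : a * d ≠ 0 := mul_ne_zero ha0 hd0
    rcases ht.of_C2_neg_one with ⟨rfl, hb1, rfl⟩ | ⟨rfl, hb1, hg⟩ | ⟨rfl, hb1, rfl⟩ |
      ⟨ha, hb1, rfl⟩ <;>
    rcases ht'.of_C2_neg_one with ⟨rfl, hb1', rfl⟩ | ⟨rfl, hb1', hg'⟩ | ⟨rfl, hb1', rfl⟩ |
      ⟨ha', hb1', rfl⟩ <;>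
    first
    | exact absurd (key.1.1 rfl) (IsSign.ne_zero ‹_›)
    | exact absurd (key.1.2 rfl) (IsSign.ne_zero ‹_›)
    | exact absurd (key.2.1 rfl) (IsSign.ne_zero ‹_›)
    | exact absurd (key.2.2 rfl) (IsSign.ne_zero ‹_›)
    | exact absurd (key.1.1 rfl) one_ne_zero
    | exact absurd (key.1.2 rfl) one_ne_zero
    | skip
    · exact ⟨rfl, eq_of_zero_or_one hb1 hb1' had hβ, rfl⟩
    · exact ⟨rfl, eq_of_zero_or_one hb1 hb1' had hβ, hg.eq_of_sq_mul hg' hγ⟩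
    · refine ⟨rfl, eq_of_nonneg_of_sq hb1 hb1' ?_ hβ, rfl⟩
      rw [mul_pow]
      linear_combination -hα - a ^ 2 * hγ
    · rcases ha' with rfl | rfl <;> nlinarith [sq_nonneg a, sq_nonneg d]
    · rcases ha with rfl | rfl <;> nlinarith [sq_nonneg a, sq_nonneg d]
    · have h2 := ha.eq_of_sq_mul ha' hα
      refine ⟨h2, eq_of_nonneg_of_sq hb1 hb1' ?_ hβ, by rw [h2]⟩
      rw [mul_pow, ha.sq_eq_one_of_sq_mul ha' hα,
        ha.sq_eq_one_of_sq_mul ha' (t := d) (by linarith), one_mul]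
  · have key : (α = 0 ↔ γ' = 0) ∧ (γ = 0 ↔ α' = 0) := by
      rw [hα, hγ]
      simp [hb0, hc0]
    have hbc : -(b * c) ≠ 0 := neg_ne_zero.2 (mul_ne_zero hb0 hc0)
    rcases ht.of_C2_neg_one with ⟨rfl, hb1, rfl⟩ | ⟨rfl, hb1, hg⟩ | ⟨rfl, hb1, rfl⟩ |
      ⟨ha, hb1, rfl⟩ <;>
    rcases ht'.of_C2_neg_one with ⟨rfl, hb1', rfl⟩ | ⟨rfl, hb1', hg'⟩ | ⟨rfl, hb1', rfl⟩ |
      ⟨ha', hb1', rfl⟩ <;>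
    first
    | exact absurd (key.1.1 rfl) (IsSign.ne_zero ‹_›)
    | exact absurd (key.1.2 rfl) (IsSign.ne_zero ‹_›)
    | exact absurd (key.2.1 rfl) (IsSign.ne_zero ‹_›)
    | exact absurd (key.2.2 rfl) (IsSign.ne_zero ‹_›)
    | exact absurd (key.1.1 rfl) one_ne_zero
    | exact absurd (key.1.2 rfl) one_ne_zero
    | exact absurd (key.2.2 rfl) one_ne_zero
    | exact absurd (key.1.1 rfl) (neg_ne_zero.2 (IsSign.ne_zero ‹_›))
    | exact absurd (key.2.2 rfl) (neg_ne_zero.2 (IsSign.ne_zero ‹_›))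
    | skip
    · exact ⟨rfl, eq_of_zero_or_one hb1 hb1' hbc hβ, rfl⟩
    · nlinarith [sq_nonneg c]
    · rcases ha' with rfl | rfl <;> nlinarith [sq_nonneg b, sq_nonneg c]
    · rcases ha with rfl | rfl <;> nlinarith [sq_nonneg c, sq_nonneg b]
    · have h2 := ha.eq_of_sq_mul ha' (t := c) (by linarith)
      refine ⟨h2, eq_of_nonneg_of_sq hb1 hb1' ?_ hβ, by rw [h2]⟩
      rw [neg_sq, mul_pow, ha.sq_eq_one_of_sq_mul ha' (t := c) (by linarith),
        ha.sq_eq_one_of_sq_mul ha' (t := b) (by linarith), one_mul]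

theorem TripleChange.eq_C3 (h : TripleChange C3 α β γ C3 α' β' γ' s a b c d)
    (ht : InTable C3 α β γ) (ht' : InTable C3 α' β' γ') :
    α = α' ∧ β = β' ∧ γ = γ' := by
  have h00 := h.h00
  have h10 := h.h10
  have hs := h.scale_ne
  have hdet := h.det_ne
  have hα := h.hα
  have hβ := h.hβ
  have hγ := h.hγ
  simp [C3] at h00 h10
  subst h00
  subst h10
  have ha : a ≠ 0 := by
    rintro rfl
    simp at hdet
  have ha2 : 0 < a ^ 2 := by positivity
  have hs2 : 0 < s ^ 2 := by positivity
  rcases ht.of_C3 with ⟨rfl, rfl, hα1⟩ | ⟨rfl, ⟨rfl, hα1⟩ | ⟨rfl, hβ1⟩⟩ <;>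
    rcases ht'.of_C3 with ⟨rfl, rfl, hα1'⟩ | ⟨rfl, ⟨rfl, hα1'⟩ | ⟨rfl, hβ1'⟩⟩ <;>
    simp [hs, ha] at hα hβ hγ
  · subst hβ
    -- Keeping `γ = 1` forces `s > 0`, so the sign of `α` cannot change.
    have hs3 : s * (s ^ 2 * a ^ 2) = 1 := by linarith
    have hs4 : 0 < s := by
      by_contra hn
      nlinarith [mul_pos hs2 ha2]
    refine ⟨?_, rfl, rfl⟩
    rcases hα1 with rfl | hα1 <;> rcases hα1' with rfl | hα1'
    · rfl
    · exact absurd (by linarith) hα1'.ne_zero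
    · simp [hs, ha, hα1.ne_zero] at hα
    · exact hα1.eq_of_mul_pos hα1' (t := s * a ^ 2) (by positivity) (by linarith)
  · exact ⟨eq_of_zero_or_one hα1 hα1' (t := s * a ^ 2) (by positivity) (by linarith), rfl, rfl⟩
  · exact absurd hβ hβ1'.ne_zero
  · exact absurd hβ hβ1.ne_zero
  · exact ⟨rfl, hβ1.eq_of_sq_mul hβ1' (t := s * a) (by linarith), rfl⟩

theorem TripleChange.eq_C4 (h : TripleChange C4 α β γ C4 α' β' γ' s a b c d)
    (ht : InTable C4 α β γ) (ht' : InTable C4 α' β' γ') :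
    α = α' ∧ β = β' ∧ γ = γ' := by
  have h1 := h.trace_eq
  have h00 := h.h00
  have h10 := h.h10
  have hdet := h.det_ne
  have hα := h.hα
  have hβ := h.hβ
  have hγ := h.hγ
  simp [C4] at h1 h00 h10
  have hs : s = 1 := by linarith
  subst hs
  have hb : b = 0 := by linarith
  have hd : d = a := by linarith
  subst hb hd
  have hd : d ≠ 0 := by
    rintro rfl
    simp at hdet
  rcases ht.of_C4 with ⟨hγ1, rfl⟩ | ⟨rfl, ⟨rfl, hα1⟩ | ⟨rfl, hβ1⟩⟩ <;>
    rcases ht'.of_C4 with ⟨hγ1', rfl⟩ | ⟨rfl, ⟨rfl, hα1'⟩ | ⟨rfl, hβ1'⟩⟩ <;>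
    simp [hd] at hα hβ hγ
  · obtain rfl := hβ.resolve_right hγ1.ne_zero
    refine ⟨?_, rfl, hγ1.eq_of_sq_mul hγ1' hγ⟩
    rw [hα, hγ1.sq_eq_one_of_sq_mul hγ1' hγ]
    ring
  · exact absurd hγ hγ1.ne_zero
  · exact absurd hγ hγ1.ne_zero
  · exact absurd hγ hγ1'.ne_zero
  · refine ⟨?_, rfl, rfl⟩
    rcases hα1 with rfl | hα1 <;> rcases hα1' with rfl | hα1'
    · rfl
    · exact absurd (by linarith) hα1'.ne_zero
    · simp [hd, hα1.ne_zero] at hα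
    · exact hα1.eq_of_sq_mul hα1' hα
  · exact absurd hβ hβ1'.ne_zero
  · exact absurd hγ hγ1'.ne_zero
  · exact absurd hβ hβ1.ne_zero
  · exact ⟨rfl, hβ1.eq_of_sq_mul hβ1' (t := d) (by linarith), rfl⟩

theorem zero_of_rotation (hac : a ^ 2 + c ^ 2 ≠ 0) (h : a * c * (γ - α) = 0)
    (h0 : a ^ 2 * α + c ^ 2 * γ = 0) (h1 : c ^ 2 * α + a ^ 2 * γ = 0) : γ = 0 := by
  have h2 : α + γ = 0 := by
    refine (mul_eq_zero.1 (?_ : (a ^ 2 + c ^ 2) * (α + γ) = 0)).resolve_left hac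
    linear_combination h0 + h1
  refine (mul_eq_zero.1 (?_ : (a ^ 2 + c ^ 2) ^ 2 * γ = 0)).resolve_left (pow_ne_zero 2 hac)
  linear_combination 2 * a * c * h + (a ^ 2 - c ^ 2) * h1
    + (2 * a ^ 2 * c ^ 2 - c ^ 2 * (a ^ 2 - c ^ 2)) * h2

/-- Here `s = 1` and `A` is a scaled rotation. Keeping `G` diagonal leaves scaled quarter turns,
dilations, or scalar `G`; the bounds on `κ` exclude any change. -/
theorem TripleChange.eq_C5 {p : ℝ} (hp : 0 < p)
    (h : TripleChange (C5 p) α β γ (C5 p) α' β' γ' s a b c d)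
    (ht : InTable (C5 p) α β γ) (ht' : InTable (C5 p) α' β' γ') :
    α = α' ∧ β = β' ∧ γ = γ' := by
  have h1 := h.trace_eq
  have h00 := h.h00
  have h01 := h.h01
  have hdet := h.det_ne
  have hα := h.hα
  have hβ := h.hβ
  have hγ := h.hγ
  simp only [C5, Matrix.of_apply, Matrix.cons_val', Matrix.cons_val_zero,
    Matrix.cons_val_one] at h1 h00 h01
  obtain rfl : s = 1 := by
    have : (s - 1) * p = 0 := by linarith
    linarith [(mul_eq_zero.1 this).resolve_right hp.ne']
  obtain rfl : b = -c := by linarith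
  obtain rfl : d = a := by linarith
  obtain ⟨rfl, hf⟩ := ht.of_C5 hp
  obtain ⟨rfl, hf'⟩ := ht'.of_C5 hp
  have hρ : d ^ 2 + c ^ 2 ≠ 0 := fun h => hdet (by linear_combination h)
  replace hα : α' = d ^ 2 * α + c ^ 2 * γ := by linear_combination hα
  replace hβ : d * c * (γ - α) = 0 := by linear_combination -hβ
  replace hγ : γ' = c ^ 2 * α + d ^ 2 * γ := by linear_combination hγ
  rcases hf with ⟨rfl, rfl⟩ | hf
  · rcases hf' with ⟨rfl, rfl⟩ | ⟨_, _, rfl⟩ | ⟨_, _, rfl⟩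
    · exact ⟨rfl, rfl, rfl⟩
    · linarith
    · linarith
  rcases hf' with ⟨rfl, rfl⟩ | hf'
  · have := zero_of_rotation hρ hβ hα.symm hγ.symm
    rcases hf with ⟨_, _, rfl⟩ | ⟨_, _, rfl⟩ <;> linarith
  have hcases : (d = 0 ∧ c ≠ 0) ∨ (c = 0 ∧ d ≠ 0) ∨ γ = α := by
    rcases mul_eq_zero.1 hβ with h1 | h1
    · by_cases hd : d = 0
      · refine Or.inl ⟨hd, ?_⟩
        rintro rfl
        simp [hd] at hρ
      · exact Or.inr (Or.inl ⟨(mul_eq_zero.1 h1).resolve_left hd, hd⟩)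
    · exact Or.inr (Or.inr (by linarith))
  rcases hcases with ⟨rfl, h0⟩ | ⟨rfl, h0⟩ | rfl
  · replace h0 : 0 < c ^ 2 := by positivity
    generalize c ^ 2 = q at *
    rcases hf with ⟨h2, h3, rfl⟩ | ⟨h2, h3, rfl⟩ <;>
      rcases hf' with ⟨h2', h3', rfl⟩ | ⟨h2', h3', rfl⟩
    · have : α = 1 := by nlinarith
      exact ⟨by nlinarith, rfl, rfl⟩
    · nlinarith
    · nlinarith
    · have : α = -1 := by nlinarith
      exact ⟨by nlinarith, rfl, rfl⟩
  · replace h0 : 0 < d ^ 2 := by positivity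
    generalize d ^ 2 = q at *
    rcases hf with ⟨h2, h3, rfl⟩ | ⟨h2, h3, rfl⟩ <;>
      rcases hf' with ⟨h2', h3', rfl⟩ | ⟨h2', h3', rfl⟩
    · obtain rfl : q = 1 := by linarith
      exact ⟨by linarith, rfl, rfl⟩
    · linarith
    · linarith
    · obtain rfl : q = 1 := by linarith
      exact ⟨by linarith, rfl, rfl⟩
  · replace hρ : 0 < d ^ 2 + c ^ 2 := by positivity
    obtain rfl : γ' = α' := by linarith
    rcases hf with ⟨h2, h3, rfl⟩ | ⟨h2, h3, rfl⟩ <;>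
      rcases hf' with ⟨h2', h3', rfl⟩ | ⟨h2', h3', rfl⟩ <;>
      first | exact ⟨rfl, rfl, rfl⟩ | linarith

theorem TripleChange.eq_C5_zero (h : TripleChange (C5 0) α β γ (C5 0) α' β' γ' s a b c d)
    (ht : InTable (C5 0) α β γ) (ht' : InTable (C5 0) α' β' γ') :
    α = α' ∧ β = β' ∧ γ = γ' := by
  have hs := h.scale_sq_eq_one
  have h00 := h.h00
  have h01 := h.h01
  have hdet := h.det_ne
  have hα := h.hα
  have hβ := h.hβ
  have hγ := h.hγ
  simp only [C5, Matrix.of_apply, Matrix.cons_val', Matrix.cons_val_zero,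
    Matrix.cons_val_one] at h00 h01
  obtain rfl : b = -(s * c) := by linarith
  obtain rfl : a = s * d := by linarith
  obtain ⟨rfl, hf⟩ := ht.of_C5_zero
  obtain ⟨rfl, hf'⟩ := ht'.of_C5_zero
  have hρ : d ^ 2 + c ^ 2 ≠ 0 := fun h => hdet (by linear_combination s * h)
  replace hα : α' = s * (d ^ 2 * α + c ^ 2 * γ) := by
    linear_combination hα + s * d ^ 2 * α * hs
  replace hβ : d * c * (γ - α) = 0 := by
    linear_combination -s * hβ + d * c * (α * (1 + s ^ 2) - γ) * hs
  replace hγ : γ' = s * (c ^ 2 * α + d ^ 2 * γ) := by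
    linear_combination hγ + s * c ^ 2 * α * hs
  have h1 : s = 1 ∨ s = -1 := by simpa using hs
  have hρ' : 0 < d ^ 2 + c ^ 2 := by positivity
  rcases hf with ⟨rfl, rfl⟩ | ⟨h2, h3, rfl⟩ <;> rcases hf' with ⟨rfl, rfl⟩ | ⟨h2', h3', rfl⟩
  · exact ⟨rfl, rfl, rfl⟩
  · linarith
  · refine absurd (zero_of_rotation hρ hβ ?_ ?_) one_ne_zero
    · linear_combination -(d ^ 2 * α + c ^ 2) * hs - s * hα
    · linear_combination -(c ^ 2 * α + d ^ 2) * hs - s * hγ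
  · rcases h1 with rfl | rfl
    · rcases mul_eq_zero.1 hβ with h1 | h1
      · rcases mul_eq_zero.1 h1 with rfl | rfl
        · have : α = 1 := by nlinarith
          exact ⟨by nlinarith, rfl, rfl⟩
        · obtain h4 : d ^ 2 = 1 := by linarith
          exact ⟨by rw [hα, h4]; ring, rfl, rfl⟩
      · obtain rfl : α = 1 := by linarith
        exact ⟨by linarith, rfl, rfl⟩
    -- For `s = -1` the trace of `G` changes sign, yet the bounds make it nonnegative on both sides,
    -- so it vanishes.
    · have h4 : α' + 1 = -((d ^ 2 + c ^ 2) * (α + 1)) := by linear_combination hα + hγ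
      have h5 : 0 ≤ (d ^ 2 + c ^ 2) * (α + 1) := mul_nonneg hρ'.le (by linarith)
      have h6 : (d ^ 2 + c ^ 2) * (α + 1) = 0 := by linarith
      have h7 := (mul_eq_zero.1 h6).resolve_left hρ
      exact ⟨by linarith, rfl, rfl⟩

theorem TripleRel.eq_of_inTable {H H' : Matrix (Fin 2) (Fin 2) ℝ}
    (hr : TripleRel H α β γ H' α' β' γ') (ht : InTable H α β γ) (ht' : InTable H' α' β' γ') :
    H = H' ∧ α = α' ∧ β = β' ∧ γ = γ' := by
  have hH := hr.eq_of_isNormalMatrix ht.isNormalMatrix ht'.isNormalMatrix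
  subst hH
  refine ⟨rfl, ?_⟩
  obtain ⟨s, a, b, c, d, h⟩ := hr.exists_change
  have hn := ht.isNormalMatrix
  clear hr
  cases hn with
  | A12 => exact h.eq_A12 ht ht'
  | C2 p hp => exact h.eq_C2 hp ht ht'
  | C2_one => exact h.eq_C2_one ht ht'
  | C2_neg_one => exact h.eq_C2_neg_one ht ht'
  | C3 => exact h.eq_C3 ht ht'
  | C4 => exact h.eq_C4 ht ht'
  | C5 p hp => exact h.eq_C5 hp ht ht'
  | C5_zero => exact h.eq_C5_zero ht ht'

end Uniqueness

/-! ### The standard supertriples -/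

section Standard

variable {H H' : Matrix (Fin 2) (Fin 2) ℝ} {α β γ α' β' γ' : ℝ}

theorem finrank_triplePart_zero : finrank ℝ (triplePart 0) = 2 := by
  let e : triplePart 0 ≃ₗ[ℝ] ℝ × ℝ :=
    { toFun := fun x => (x.1.1.1, x.1.2.1)
      map_add' := fun _ _ => rfl
      map_smul' := fun _ _ => rfl
      invFun := fun y => ⟨((y.1, 0), (y.2, 0)), by simp [mem_triplePart_zero]⟩
      left_inv := by
        rintro ⟨⟨⟨s, u⟩, ⟨t, w⟩⟩, hx⟩
        obtain ⟨rfl, rfl⟩ := (mem_triplePart_zero _).1 hx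
        rfl
      right_inv := fun _ => rfl }
  rw [e.finrank_eq]
  simp

theorem finrank_triplePart_one : finrank ℝ (triplePart 1) = 4 := by
  let e : triplePart 1 ≃ₗ[ℝ] (Fin 2 → ℝ) × (Fin 2 → ℝ) :=
    { toFun := fun x => (x.1.1.2, x.1.2.2)
      map_add' := fun _ _ => rfl
      map_smul' := fun _ _ => rfl
      invFun := fun y => ⟨((0, y.1), (0, y.2)), by simp [mem_triplePart_one]⟩
      left_inv := by
        rintro ⟨⟨⟨s, u⟩, ⟨t, w⟩⟩, hx⟩
        obtain ⟨rfl, rfl⟩ := (mem_triplePart_one _).1 hx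
        rfl
      right_inv := fun _ => rfl }
  rw [e.finrank_eq]
  simp

theorem hasSuperdim_tripleDouble (H : Matrix (Fin 2) (Fin 2) ℝ) (α β γ : ℝ) :
    (tripleDouble H α β γ).HasSuperdim 2 4 :=
  ⟨inferInstance, finrank_triplePart_zero, finrank_triplePart_one⟩

theorem mem_tripleLeft (x : TripleSpace) : x ∈ tripleLeft ↔ x.2 = 0 := LinearMap.mem_ker

theorem mem_tripleRight (x : TripleSpace) : x ∈ tripleRight ↔ x.1 = 0 := LinearMap.mem_ker

theorem isSubalgebra_tripleLeft (H : Matrix (Fin 2) (Fin 2) ℝ) (α β γ : ℝ) :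
    (tripleDouble H α β γ).IsSubalgebra tripleLeft where
  graded := by
    refine le_antisymm (fun x hx => ?_) (sup_le inf_le_left inf_le_left)
    rw [mem_tripleLeft] at hx
    refine Submodule.mem_sup.2 ⟨((x.1.1, 0), 0), ⟨?_, ?_⟩, ((0, x.1.2), 0), ⟨?_, ?_⟩, ?_⟩
    · simp [mem_tripleLeft]
    · exact (mem_triplePart_zero _).2 ⟨rfl, rfl⟩
    · simp [mem_tripleLeft]
    · exact (mem_triplePart_one _).2 ⟨rfl, rfl⟩
    · exact Prod.ext (by simp) (by simp [hx])
  bracket_mem := by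
    rintro ⟨⟨s, u⟩, t, w⟩ hx ⟨⟨s', u'⟩, t', w'⟩ hy
    rw [mem_tripleLeft, Prod.mk_eq_zero] at hx hy
    obtain ⟨rfl, rfl⟩ := hx
    obtain ⟨rfl, rfl⟩ := hy
    rw [mem_tripleLeft]
    refine Prod.ext ?_ (funext fun k => ?_) <;> simp [tripleDouble, tripleBracket]

theorem isSubalgebra_tripleRight (H : Matrix (Fin 2) (Fin 2) ℝ) (α β γ : ℝ) :
    (tripleDouble H α β γ).IsSubalgebra tripleRight where
  graded := by
    refine le_antisymm (fun x hx => ?_) (sup_le inf_le_left inf_le_left)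
    rw [mem_tripleRight] at hx
    refine Submodule.mem_sup.2 ⟨(0, (x.2.1, 0)), ⟨?_, ?_⟩, (0, (0, x.2.2)), ⟨?_, ?_⟩, ?_⟩
    · simp [mem_tripleRight]
    · exact (mem_triplePart_zero _).2 ⟨rfl, rfl⟩
    · simp [mem_tripleRight]
    · exact (mem_triplePart_one _).2 ⟨rfl, rfl⟩
    · exact Prod.ext (by simp [hx]) (by simp)
  bracket_mem := by
    rintro ⟨⟨s, u⟩, t, w⟩ hx ⟨⟨s', u'⟩, t', w'⟩ hy
    rw [mem_tripleRight, Prod.mk_eq_zero] at hx hy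
    obtain ⟨rfl, rfl⟩ := hx
    obtain ⟨rfl, rfl⟩ := hy
    rw [mem_tripleRight]
    refine Prod.ext ?_ (funext fun k => ?_) <;> simp [tripleDouble, tripleBracket]

theorem isMaximalIsotropic_tripleLeft (H : Matrix (Fin 2) (Fin 2) ℝ) (α β γ : ℝ) :
    (tripleDouble H α β γ).IsMaximalIsotropic tripleLeft := by
  refine ⟨fun x hx y hy => ?_, fun T hT hle => le_antisymm (fun x hx => ?_) hle⟩
  · rw [mem_tripleLeft] at hx hy
    change tripleForm x y = 0
    simp [tripleForm_apply, hx, hy]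
  · have h1 : ∀ s u, tripleForm x ((s, u), 0) = 0 := fun s u =>
      hT x hx _ (hle ((mem_tripleLeft _).2 rfl))
    rw [mem_tripleLeft]
    refine Prod.ext ?_ (funext fun k => ?_)
    · simpa [tripleForm_apply] using h1 1 0
    · simpa [tripleForm_apply] using h1 0 (Pi.single k 1)

theorem isMaximalIsotropic_tripleRight (H : Matrix (Fin 2) (Fin 2) ℝ) (α β γ : ℝ) :
    (tripleDouble H α β γ).IsMaximalIsotropic tripleRight := by
  refine ⟨fun x hx y hy => ?_, fun T hT hle => le_antisymm (fun x hx => ?_) hle⟩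
  · rw [mem_tripleRight] at hx hy
    change tripleForm x y = 0
    simp [tripleForm_apply, hx, hy]
  · have h1 : ∀ s u, tripleForm x (0, (s, u)) = 0 := fun s u =>
      hT x hx _ (hle ((mem_tripleRight _).2 rfl))
    rw [mem_tripleRight]
    refine Prod.ext ?_ (funext fun k => ?_)
    · simpa [tripleForm_apply] using h1 1 0
    · simpa [tripleForm_apply] using h1 0 (Pi.single k 1)

theorem isManinSupertriple_tripleDouble (H : Matrix (Fin 2) (Fin 2) ℝ) (α β γ : ℝ) :
    (tripleDouble H α β γ).IsManinSupertriple tripleLeft tripleRight where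
  left_subalgebra := isSubalgebra_tripleLeft H α β γ
  right_subalgebra := isSubalgebra_tripleRight H α β γ
  left_isotropic := isMaximalIsotropic_tripleLeft H α β γ
  right_isotropic := isMaximalIsotropic_tripleRight H α β γ
  isCompl := by
    rw [isCompl_iff, Submodule.disjoint_def, Submodule.codisjoint_iff_exists_add_eq]
    refine ⟨fun x h1 h2 => Prod.ext ((mem_tripleRight x).1 h2) ((mem_tripleLeft x).1 h1),
      fun x => ⟨(x.1, 0), (0, x.2), ?_, ?_, ?_⟩⟩
    · simp [mem_tripleLeft]
    · simp [mem_tripleRight]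
    · simp
  even_odd := by
    rintro x ⟨-, hx⟩ y ⟨-, hy⟩
    have hx := (mem_triplePart_zero x).1 hx
    have hy := (mem_triplePart_one y).1 hy
    change tripleForm x y = 0
    simp [tripleForm_apply, hx, hy]
  odd_even := by
    rintro x ⟨-, hx⟩ y ⟨-, hy⟩
    have hx := (mem_triplePart_one x).1 hx
    have hy := (mem_triplePart_zero y).1 hy
    change tripleForm x y = 0
    simp [tripleForm_apply, hx, hy]

theorem AdZero.eq_zero (h : AdZero H α β γ) : H = 0 ∧ α = 0 ∧ β = 0 ∧ γ = 0 := by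
  have h1 : ∀ i j, H i j = 0 ∧ matN α β γ i j = 0 := fun i j => by
    have e1 := h ((0, Pi.single i 1), 0)
    have e2 := h (0, (0, Pi.single i 1))
    rw [tripleBracket_evenLeft] at e1 e2
    have e3 := congrArg (fun x : TripleSpace => x.1.2 j) e1
    have e4 := congrArg (fun x : TripleSpace => x.1.2 j) e2
    simp at e3 e4
    exact ⟨e3, e4⟩
  refine ⟨Matrix.ext fun i j => (h1 i j).1, ?_, ?_, ?_⟩
  · simpa [matN] using (h1 0 0).2
  · simpa [matN] using (h1 0 1).2
  · simpa [matN] using (h1 1 1).2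

/-- A supertriple isomorphic to a dual one has abelian superdouble. -/
theorem adZero_of_tripleIsomorphic_dual
    (h : (tripleDouble H α β γ).TripleIsomorphic tripleLeft tripleRight
      (tripleDouble H' α' β' γ') tripleRight tripleLeft) : AdZero H α β γ := by
  obtain ⟨P, hP, hl, -⟩ := h
  -- The image of `b₁` is an even vector of `N`, hence a multiple of the central `b̃¹`.
  have h1 : P evenLeft ∈ tripleRight := by
    rw [← hl]
    exact ⟨evenLeft, (mem_tripleLeft _).2 rfl, rfl⟩
  have h2 := eq_even_of_mem ((hP.map_part 0 evenLeft).2 evenLeft_mem)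
  rw [(mem_tripleRight _).1 h1, Prod.fst_zero, zero_smul, zero_add] at h2
  intro x
  refine P.injective ?_
  have h3 := hP.map_bracket evenLeft x
  rw [map_zero]
  refine h3.trans ?_
  rw [h2]
  change tripleBracket H' α' β' γ' _ _ = 0
  rw [map_smul, LinearMap.smul_apply, tripleBracket_evenRight, smul_zero]

/-- Both superdoubles are abelian, so all parameters vanish. Thus uniqueness in the table survives
passing to duals. -/
theorem eq_of_tripleIsomorphic_dual
    (h : (tripleDouble H α β γ).TripleIsomorphic tripleLeft tripleRight
      (tripleDouble H' α' β' γ') tripleRight tripleLeft) :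
    H = H' ∧ α = α' ∧ β = β' ∧ γ = γ' := by
  obtain ⟨rfl, rfl, rfl, rfl⟩ := (adZero_of_tripleIsomorphic_dual h).eq_zero
  obtain ⟨rfl, rfl, rfl, rfl⟩ := (adZero_of_tripleIsomorphic_dual h.symm.swap).eq_zero
  exact ⟨rfl, rfl, rfl, rfl⟩

end Standard

/-! ### The classification -/

section Classification

variable {V W : Type*} [AddCommGroup V] [Module ℝ V] [AddCommGroup W] [Module ℝ W]
  {D : MetricLieSuperalgebra V} {E : MetricLieSuperalgebra W} {S S' : Submodule ℝ V}
  {c c' : SuperdoubleClass} {H H' : Matrix (Fin 2) (Fin 2) ℝ} {α β γ α' β' γ' : ℝ}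

theorem IsTriple.trans (h : IsTriple D S S' H α β γ) (h' : TripleRel H α β γ H' α' β' γ') :
    IsTriple D S S' H' α' β' γ' :=
  TripleIsomorphic.trans h h'

theorem IsDualTriple.trans (h : IsDualTriple D S S' H α β γ)
    (h' : TripleRel H α β γ H' α' β' γ') : IsDualTriple D S S' H' α' β' γ' :=
  TripleIsomorphic.trans h (TripleIsomorphic.swap h')

theorem isomorphic_of_isTriple_or_isDualTriple
    (h : IsTriple D S S' H α β γ ∨ IsDualTriple D S S' H α β γ) :
    D.Isomorphic (tripleDouble H α β γ) :=
  h.elim TripleIsomorphic.isomorphic TripleIsomorphic.isomorphic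

theorem MetricLieSuperalgebra.IsManinSupertriple.exists_lists (h : D.IsManinSupertriple S S')
    (hD : D.HasSuperdim 2 4) :
    ∃ c H α β γ, SuperdoubleClass.Lists c H α β γ ∧
      (IsTriple D S S' H α β γ ∨ IsDualTriple D S S' H α β γ) := by
  obtain ⟨H, α, β, γ, ht⟩ := h.exists_isTriple_or_isDualTriple hD
  obtain ⟨c, H', α', β', γ', hl, hr⟩ := _root_.exists_lists H α β γ
  exact ⟨c, H', α', β', γ', hl, ht.imp (fun h => h.trans hr) fun h => h.trans hr⟩

theorem SuperdoubleClass.Lists.belongsTo (hl : c.Lists H α β γ)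
    (h : IsTriple D S S' H α β γ ∨ IsDualTriple D S S' H α β γ) : BelongsTo D c :=
  ⟨H, α, β, γ, hl, isomorphic_of_isTriple_or_isDualTriple h⟩

theorem BelongsTo.isomorphic_of_lists (h : BelongsTo D c) (hl : c.Lists H α β γ) :
    D.Isomorphic (tripleDouble H α β γ) := by
  obtain ⟨_, _, _, _, hl', h⟩ := h
  exact h.trans (hl'.doubleRel_rep.trans hl.doubleRel_rep.symm)

theorem BelongsTo.isomorphic (h : BelongsTo D c) (h' : BelongsTo E c) : D.Isomorphic E := by
  obtain ⟨_, _, _, _, hl, h'⟩ := h'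
  exact (h.isomorphic_of_lists hl).trans h'.symm

theorem BelongsTo.of_isomorphic (h : BelongsTo D c) (h' : E.Isomorphic D) : BelongsTo E c :=
  let ⟨_, _, _, _, hl, h⟩ := h
  ⟨_, _, _, _, hl, h'.trans h⟩

theorem BelongsTo.eq (h : BelongsTo D c) (h' : BelongsTo D c') : c = c' := by
  obtain ⟨_, _, _, _, hl, h⟩ := h
  obtain ⟨_, _, _, _, hl', h'⟩ := h'
  exact SuperdoubleClass.eq_of_doubleRel_rep
    (hl.doubleRel_rep.symm.trans ((h.symm.trans h').trans hl'.doubleRel_rep))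

theorem MetricLieSuperalgebra.IsDrinfeldSuperdouble.exists_belongsTo
    (h : D.IsDrinfeldSuperdouble) (hD : D.HasSuperdim 2 4) : ∃ c, BelongsTo D c := by
  obtain ⟨S, S', h⟩ := h
  obtain ⟨c, H, α, β, γ, hl, ht⟩ := h.exists_lists hD
  exact ⟨c, hl.belongsTo ht⟩

theorem eq_of_inTable (ht : InTable H α β γ) (ht' : InTable H' α' β' γ')
    (h : IsTriple D S S' H α β γ ∨ IsDualTriple D S S' H α β γ)
    (h' : IsTriple D S S' H' α' β' γ' ∨ IsDualTriple D S S' H' α' β' γ') :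
    H = H' ∧ α = α' ∧ β = β' ∧ γ = γ' := by
  rcases h with h | h <;> rcases h' with h' | h'
  · exact TripleRel.eq_of_inTable (TripleIsomorphic.trans (TripleIsomorphic.symm h) h') ht ht'
  · exact eq_of_tripleIsomorphic_dual (TripleIsomorphic.trans (TripleIsomorphic.symm h) h')
  · exact eq_of_tripleIsomorphic_dual
      (TripleIsomorphic.trans (TripleIsomorphic.symm h) h').swap
  · exact TripleRel.eq_of_inTable
      (TripleIsomorphic.trans (TripleIsomorphic.symm h) h').swap ht ht'

end Classification

theorem theorem3 :
    -- every listed supertriple is a Manin supertriple of superdimension (2, 4)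
    (∀ (c : SuperdoubleClass) (H : Matrix (Fin 2) (Fin 2) ℝ) (α β γ : ℝ), c.Lists H α β γ →
      (tripleDouble H α β γ).HasSuperdim 2 4 ∧
      (tripleDouble H α β γ).IsManinSupertriple tripleLeft tripleRight) ∧
    -- every superdouble of superdimension (2, 4) belongs to exactly one class
    (∀ (V : Type*) [AddCommGroup V] [Module ℝ V] (D : MetricLieSuperalgebra V),
      D.HasSuperdim 2 4 → D.IsDrinfeldSuperdouble → ∃! c : SuperdoubleClass, BelongsTo D c) ∧
    -- and decomposes into all supertriples listed in its class, and their duals,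
    (∀ (V : Type*) [AddCommGroup V] [Module ℝ V] (D : MetricLieSuperalgebra V),
      D.HasSuperdim 2 4 → D.IsDrinfeldSuperdouble → ∀ c : SuperdoubleClass, BelongsTo D c →
      (∀ (H : Matrix (Fin 2) (Fin 2) ℝ) (α β γ : ℝ), c.Lists H α β γ →
        (∃ S S' : Submodule ℝ V, D.IsManinSupertriple S S' ∧ IsTriple D S S' H α β γ) ∧
        (∃ S S' : Submodule ℝ V, D.IsManinSupertriple S S' ∧ IsDualTriple D S S' H α β γ)) ∧
      -- and into no others
      (∀ S S' : Submodule ℝ V, D.IsManinSupertriple S S' →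
        ∃ (H : Matrix (Fin 2) (Fin 2) ℝ) (α β γ : ℝ), c.Lists H α β γ ∧
          (IsTriple D S S' H α β γ ∨ IsDualTriple D S S' H α β γ))) ∧
    -- two superdoubles are isomorphic exactly if they belong to the same class
    (∀ (V W : Type*) [AddCommGroup V] [Module ℝ V] [AddCommGroup W] [Module ℝ W]
      (D : MetricLieSuperalgebra V) (E : MetricLieSuperalgebra W),
      D.HasSuperdim 2 4 → D.IsDrinfeldSuperdouble →
      E.HasSuperdim 2 4 → E.IsDrinfeldSuperdouble →
      (D.Isomorphic E ↔ ∃ c : SuperdoubleClass, BelongsTo D c ∧ BelongsTo E c)) ∧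
    -- every Manin supertriple is, up to T-duality, isomorphic to exactly one in the table
    (∀ (V : Type*) [AddCommGroup V] [Module ℝ V] (D : MetricLieSuperalgebra V)
      (S S' : Submodule ℝ V), D.HasSuperdim 2 4 → D.IsManinSupertriple S S' →
      ∃! t : Matrix (Fin 2) (Fin 2) ℝ × ℝ × ℝ × ℝ, InTable t.1 t.2.1 t.2.2.1 t.2.2.2 ∧
        (IsTriple D S S' t.1 t.2.1 t.2.2.1 t.2.2.2 ∨
          IsDualTriple D S S' t.1 t.2.1 t.2.2.1 t.2.2.2)) := by
  refine ⟨fun c H α β γ _ =>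
      ⟨hasSuperdim_tripleDouble H α β γ, isManinSupertriple_tripleDouble H α β γ⟩,
    fun V _ _ D hD h => ?_, fun V _ _ D hD h c hc => ⟨fun H α β γ hl => ?_, fun S S' hS => ?_⟩,
    fun V W _ _ _ _ D E hD hD' _ _ => ⟨fun h => ?_, fun ⟨c, h, h'⟩ => h.isomorphic h'⟩,
    fun V _ _ D S S' hD h => ?_⟩
  · obtain ⟨c, hc⟩ := h.exists_belongsTo hD
    exact ⟨c, hc, fun c' hc' => hc'.eq hc⟩
  · have h1 := hc.isomorphic_of_lists hl
    have h2 := isManinSupertriple_tripleDouble H α β γ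
    exact ⟨h1.exists_tripleIsomorphic h2, h1.exists_tripleIsomorphic h2.swap⟩
  · obtain ⟨c', H, α, β, γ, hl, ht⟩ := hS.exists_lists hD
    -- Any decomposition places the superdouble in some class, and that class is unique.
    obtain rfl := hc.eq (hl.belongsTo ht)
    exact ⟨H, α, β, γ, hl, ht⟩
  · obtain ⟨c, hc⟩ := hD'.exists_belongsTo hD
    exact ⟨c, hc, hc.of_isomorphic h.symm⟩
  · obtain ⟨H, α, β, γ, ht⟩ := h.exists_isTriple_or_isDualTriple hD
    obtain ⟨H', α', β', γ', hl, hr⟩ := exists_inTable H α β γ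
    have ht' := ht.imp (fun h => h.trans hr) fun h => h.trans hr
    refine ⟨(H', α', β', γ'), ⟨hl, ht'⟩, ?_⟩
    rintro ⟨H'', α'', β'', γ''⟩ ⟨hl', ht''⟩
    obtain ⟨rfl, rfl, rfl, rfl⟩ := eq_of_inTable hl hl' ht' ht''
    rfl
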